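/- **Setting.** Fix an even integer $p\ge 2$. For each $N$ let $v_{\rm sig}\in\mathbb R^N$ be random with an arbitrary law supported on $|v_{\rm sig}|=\sqrt N$, and, independently of it, let $G$ be a tensor of order $p$ and dimension $N$ from one of four ensembles: independent real standard Gaussian entries; independent complex Gaussian entries with real and imaginary parts independent of mean $0$ and variance $1/2$; or the symmetrization (average over all permutations of the $p$ indices) of one of these. Let $T_0=\lambda v_{\rm sig}^{\otimes p}+G$. For an integer $n_{bos}\ge p/2$ and a tensor $T$ let $$H(T)=\frac12\sum_{i_1,\dots,i_{p/2}}\Bigl(\sum_{\mu_1,\dots,\mu_p}T_{\mu_1,\dots,\mu_p}\,|\mu_1\rangle_{i_1}\langle\mu_{1+p/2}|\otimes\cdots\otimes|\mu_{p/2}\rangle_{i_{p/2}}\langle\mu_p|+{\rm h.c.}\Bigr)$$ on $(\mathbb C^N)^{\otimes n_{bos}}$, the outer sum being over distinct $i_1,\dots,i_{p/2}\in\{1,\dots,n_{bos}\}$. The single-particle density matrix $\rho_1$ of a normalized vector or mixed state is the average over the $n_{bos}$ qudits of the one-qudit reduced density matrices (for a symmetric vector, the reduced density matrix of any one qudit).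 Put $$E_0=\lambda\,(p/2)!\tbinom{n_{bos}}{p/2}N^{p/2},\qquad E_{max}=\sqrt{2J\log N}\;n_{bos}^{p/4+1/2}N^{p/4},\qquad E_{cut}=\tfrac12(E_0+E_{max}),$$ where $J=J(N)$ is any sequence with $J=a\,(p/2)!\binom{n_{bos}}{p/2}/n_{bos}^{p/2}+o(1)$, with $a=1$ for the real and $a=2$ for the complex ensembles. "With high probability" means with probability $1-o(1)$ as $N\to\infty$. **Theorem.** There is $\theta>0$ depending only on $p$ such that the following holds for every $\theta'>p/4$ and all sequences $n_{bos}=n_{bos}(N)$, $\lambda=\lambda(N)$ with $n_{bos}\ge p/2$, $n_{bos}=O(N^\theta)$, $\lambda=\Omega(N^{-\theta'})$ (in particular $\lambda>0$ for large $N$) and $\lambda=O(N^{-p/4})$. 1. There is a deterministic sequence $o(1)$ such that, with high probability, simultaneously for all $c'>0$ and all normalized vectors $\Psi$ (respectively, all mixed states $\sigma$) in $(\mathbb C^N)^{\otimes n_{bos}}$ with $\langle\Psi|H(T_0)|\Psi\rangle\ge(1+c')E_{max}$ (respectively ${\rm tr}(\sigma H(T_0))\ge(1+c')E_{max}$), the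 single-particle density matrix satisfies $$\frac{\langle v_{\rm sig}|\rho_1|v_{\rm sig}\rangle}{N}\ge(c'-o(1))\frac{E_{max}}{E_0}.$$ 2. If $c>0$ is fixed and $E_0\ge(1+c)E_{max}$ for all large $N$, then with high probability every normalized vector $\Psi$ with $\langle\Psi|H(T_0)|\Psi\rangle\ge E_{cut}$, and every mixed state $\sigma$ with ${\rm tr}(\sigma H(T_0))\ge E_{cut}$, satisfies $$\frac{\langle v_{\rm sig}|\rho_1|v_{\rm sig}\rangle}{N}\ge\frac12\,\frac{c}{1+c}.$$ 3. Under the hypothesis of part 2, the following spectral algorithm achieves recovery: given $T_0$, if the largest eigenvalue of $H(T_0)$ exceeds $E_{cut}$, return the single-particle density matrix of the leading eigenvector or of any normalized vector in the span of the eigenvectors with eigenvalue $\ge E_{cut}$; otherwise return nothing. That is, for some constant $\kappa>0$, with high probability the algorithm returns a matrix, and every matrix $\rho$ that it may return is positive semidefinite of trace $1$ with $\langle v_{\rm sig}|\rho|v_{\rm sig}\rangle/N\ge\kappa$. This holds both when the algorithm is run on $(\mathbb C^N)^{\otimes n_{bos}}$ and when it is run on its symmetric subspace. -/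

import Mathlib

open MeasureTheory ProbabilityTheory Filter Topology Asymptotics
open scoped BigOperators NNReal ENNReal ComplexConjugate ComplexOrder

noncomputable section

namespace SpikedTensor

/-! ### Tensors and random ensembles -/

/-- Tensors of order `p` and dimension `N`, with entries `T μ` where `μ = (μ₁, …, μ_p)`. -/
abbrev Tensor (p N : ℕ) : Type := (Fin p → Fin N) → ℂ

/-- The symmetrization of a tensor: the average over all permutations of its indices. -/
def symmetrize {p N : ℕ} (T : Tensor p N) : Tensor p N :=
  fun μ => ((p.factorial : ℂ))⁻¹ * ∑ π : Equiv.Perm (Fin p), T (fun a => μ (π a))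

/-- The four noise ensembles: real or complex entries, symmetrized or not. -/
inductive Ensemble : Type
  | real
  | complex
  | realSymmetrized
  | complexSymmetrized

/-- Independent real standard Gaussian entries. -/
def realNoise (p N : ℕ) : Measure (Tensor p N) :=
  Measure.pi fun _ => (gaussianReal 0 1).map (fun x : ℝ => (x : ℂ))

/-- Independent complex Gaussian entries; real and imaginary parts are independent with mean zero
and variance `1/2`. -/
def complexNoise (p N : ℕ) : Measure (Tensor p N) :=
  Measure.pi fun _ =>
    ((gaussianReal 0 (1 / 2)).prod (gaussianReal 0 (1 / 2))).map
      (fun z : ℝ × ℝ => (⟨z.1, z.2⟩ : ℂ))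

/-- The law of the noise tensor `G`. -/
def noise (e : Ensemble) (p N : ℕ) : Measure (Tensor p N) :=
  match e with
  | .real => realNoise p N
  | .complex => complexNoise p N
  | .realSymmetrized => (realNoise p N).map symmetrize
  | .complexSymmetrized => (complexNoise p N).map symmetrize

/-- The rank one tensor `v^{⊗p}`. -/
def tensorPower (p : ℕ) {N : ℕ} (v : EuclideanSpace ℝ (Fin N)) : Tensor p N :=
  fun μ => ∏ a, ((v (μ a) : ℝ) : ℂ)

/-- The spiked tensor `T₀ = λ v^{⊗p} + G`. -/
def spiked {p N : ℕ} (lam : ℝ) (v : EuclideanSpace ℝ (Fin N)) (G : Tensor p N) : Tensor p N :=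
  (lam : ℂ) • tensorPower p v + G

/-! ### The Hamiltonian for even order -/

/-- Vectors of the full Hilbert space `(ℂ^N)^{⊗n}` of `n` qudits; the basis vector
`|x₁⟩ ⊗ ⋯ ⊗ |x_n⟩` is indexed by `x : Fin n → Fin N`. -/
abbrev State (N n : ℕ) : Type := EuclideanSpace ℂ (Fin n → Fin N)

/-- Operators on the full Hilbert space, as matrices in the computational basis. -/
abbrev Operator (N n : ℕ) : Type := Matrix (Fin n → Fin N) (Fin n → Fin N) ℂ

/-- The operator `|μ₁⟩_{i₁}⟨ν₁| ⊗ ⋯ ⊗ |μ_k⟩_{i_k}⟨ν_k|` acting on the distinct qudits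
`i₁, …, i_k` and as the identity on the others. -/
def transitionOp {N n k : ℕ} (i : Fin k ↪ Fin n) (μ ν : Fin k → Fin N) : Operator N n :=
  fun x y =>
    open Classical in
    if (∀ a, x (i a) = μ a) ∧ (∀ a, y (i a) = ν a) ∧ (∀ j, j ∉ Set.range i → x j = y j)
    then 1 else 0

/-- The first half `μ₁, …, μ_{p/2}` of a multi-index. -/
def firstHalf {p N : ℕ} (μ : Fin p → Fin N) : Fin (p / 2) → Fin N :=
  fun a => μ ⟨a, by omega⟩

/-- The second half `μ_{p/2+1}, …, μ_p` of a multi-index (for even `p`). -/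
def secondHalf {p N : ℕ} (μ : Fin p → Fin N) : Fin (p / 2) → Fin N :=
  fun a => μ ⟨p / 2 + a, by omega⟩

/-- The term `∑_μ T_μ |μ₁⟩_{i₁}⟨μ_{1+p/2}| ⊗ ⋯ ⊗ |μ_{p/2}⟩_{i_{p/2}}⟨μ_p|`. -/
def interaction {p N n : ℕ} (T : Tensor p N) (i : Fin (p / 2) ↪ Fin n) : Operator N n :=
  ∑ μ : Fin p → Fin N, T μ • transitionOp i (firstHalf μ) (secondHalf μ)

/-- The Hamiltonian `H(T)` on `n` qudits, for a tensor of even order `p`. -/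
def hamiltonian {p N : ℕ} (n : ℕ) (T : Tensor p N) : Operator N n :=
  (1 / 2 : ℂ) • ∑ i : Fin (p / 2) ↪ Fin n, (interaction T i + (interaction T i).conjTranspose)

/-! ### States and single particle density matrices -/

/-- A density matrix: positive semidefinite (hence Hermitian) with trace `1`. -/
def IsDensityMatrix {ι : Type} [Fintype ι] (σ : Matrix ι ι ℂ) : Prop :=
  σ.PosSemidef ∧ σ.trace = 1

/-- The projector `|Ψ⟩⟨Ψ|`. -/
def pureState {N n : ℕ} (Ψ : State N n) : Operator N n :=
  fun x y => Ψ x * conj (Ψ y)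

/-- The quantum expectation value `⟨Ψ|A|Ψ⟩`; its real part, `A` being Hermitian below. -/
def energy {N n : ℕ} (A : Operator N n) (Ψ : State N n) : ℝ :=
  (inner ℂ Ψ (Matrix.toEuclideanLin A Ψ)).re

/-- The quantum expectation value `tr(σ A)` in a mixed state. -/
def mixedEnergy {N n : ℕ} (A σ : Operator N n) : ℝ :=
  (σ * A).trace.re

/-- The reduced density matrix of qudit `i`: the partial trace over all other qudits. -/
def reducedDensity {N n : ℕ} (σ : Operator N n) (i : Fin n) : Matrix (Fin N) (Fin N) ℂ :=
  fun μ ν => ∑ x : Fin n → Fin N, if x i = μ then σ x (Function.update x i ν) else 0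

/-- The single particle density matrix `ρ₁`: the average over the qudits of the reduced density
matrices. On symmetric states it is the reduced density matrix of any one of the qudits, see
`singleParticle_eq_reducedDensity`. -/
def singleParticle {N n : ℕ} (σ : Operator N n) : Matrix (Fin N) (Fin N) ℂ :=
  ((n : ℂ))⁻¹ • ∑ i : Fin n, reducedDensity σ i

/-- The quantity `⟨v|ρ|v⟩ / N`. -/
def overlap {N : ℕ} (v : EuclideanSpace ℝ (Fin N)) (ρ : Matrix (Fin N) (Fin N) ℂ) : ℝ :=
  (∑ μ, ∑ ν, ((v μ : ℝ) : ℂ) * ρ μ ν * ((v ν : ℝ) : ℂ)).re / N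

/-- The symmetric (bosonic) subspace: invariance under permutations of the qudits. -/
def symmetricSubspace (N n : ℕ) : Submodule ℂ (State N n) where
  carrier := {Ψ | ∀ (π : Equiv.Perm (Fin n)) (x : Fin n → Fin N), Ψ (x ∘ π) = Ψ x}
  zero_mem' := by intro π x; simp
  add_mem' := by
    intro Ψ Φ hΨ hΦ π x
    simp [hΨ π x, hΦ π x]
  smul_mem' := by
    intro a Ψ hΨ π x
    simp [hΨ π x]

theorem reducedDensity_symm {N n : ℕ} {Ψ : State N n} (h : Ψ ∈ symmetricSubspace N n)
    (i j : Fin n) : reducedDensity (pureState Ψ) i = reducedDensity (pureState Ψ) j := by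
  ext μ ν
  unfold reducedDensity
  refine Fintype.sum_equiv (Equiv.arrowCongr (Equiv.swap i j) (Equiv.refl _)) _ _ ?_
  intro x
  have hx : (Equiv.arrowCongr (Equiv.swap i j) (Equiv.refl (Fin N))) x = x ∘ Equiv.swap i j := by
    ext a; simp [Equiv.arrowCongr]
  rw [hx]
  have hu : Function.update (x ∘ Equiv.swap i j) j ν
      = Function.update x i ν ∘ Equiv.swap i j := by
    ext a
    by_cases ha : a = j
    · subst ha; simp
    · have : Equiv.swap i j a ≠ i := by
        intro hh
        apply ha
        have := congrArg (Equiv.swap i j) hh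
        simpa using this
      simp [Function.update_of_ne ha, Function.update_of_ne this]
  have h1 := h (Equiv.swap i j) x
  have h2 := h (Equiv.swap i j) (Function.update x i ν)
  simp only [pureState, hu, h1, h2]
  simp

theorem singleParticle_eq_reducedDensity {N n : ℕ} {Ψ : State N n}
    (h : Ψ ∈ symmetricSubspace N n) (i : Fin n) :
    singleParticle (pureState Ψ) = reducedDensity (pureState Ψ) i := by
  have hn : (n : ℂ) ≠ 0 := by
    have := i.pos
    exact_mod_cast this.ne'
  unfold singleParticle
  rw [Finset.sum_congr rfl (fun j _ => reducedDensity_symm h j i)]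
  rw [Finset.sum_const, Finset.card_univ, Fintype.card_fin, ← Nat.cast_smul_eq_nsmul ℂ, smul_smul,
    inv_mul_cancel₀ hn, one_smul]

/-! ### Energy scales -/

/-- `E₀ = λ (p/2)! (n choose p/2) N^{p/2}`. -/
def E0 (p N n : ℕ) (lam : ℝ) : ℝ :=
  lam * ((p / 2).factorial : ℝ) * (n.choose (p / 2) : ℝ) * (N : ℝ) ^ (p / 2)

/-- `E_max = √(2 J log N) n^{p/4+1/2} N^{p/4}`. -/
def Emax (p N n : ℕ) (J : ℝ) : ℝ :=
  Real.sqrt (2 * J * Real.log N) * (n : ℝ) ^ ((p : ℝ) / 4 + 1 / 2) * (N : ℝ) ^ ((p : ℝ) / 4)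

/-- `E_cut = (E₀ + E_max) / 2`. -/
def Ecut (p N n : ℕ) (lam J : ℝ) : ℝ :=
  (E0 p N n lam + Emax p N n J) / 2

/-- The leading value of the scalar `J`: `(p/2)! (n choose p/2) / n^{p/2}` for the real ensembles
and twice that for the complex ones. -/
def leadingJ (e : Ensemble) (p n : ℕ) : ℝ :=
  (match e with
    | .real => 1
    | .complex => 2
    | .realSymmetrized => 1
    | .complexSymmetrized => 2) *
  (((p / 2).factorial : ℝ) * (n.choose (p / 2) : ℝ) / (n : ℝ) ^ (p / 2))

/-! ### Asymptotics -/

/-- The scaling assumption: `n = O(N^θ)`, `λ = Ω(N^{-θ'})`, `λ = O(N^{-p/4})`. -/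
structure ScalingAssumption (p : ℕ) (θ θ' : ℝ) (n : ℕ → ℕ) (lam : ℕ → ℝ) : Prop where
  n_upper : (fun N => (n N : ℝ)) =O[atTop] fun N : ℕ => (N : ℝ) ^ θ
  lam_lower : ∃ C : ℝ, 0 < C ∧ ∀ᶠ N : ℕ in atTop, C * (N : ℝ) ^ (-θ') ≤ lam N
  lam_upper : lam =O[atTop] fun N : ℕ => (N : ℝ) ^ (-((p : ℝ) / 4))

/-- Events that hold with high probability, that is, with probability `1 - o(1)`. -/
def WithHighProbability {Ω : ℕ → Type} [∀ N, MeasurableSpace (Ω N)] (P : ∀ N, Measure (Ω N))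
    (A : ∀ N, Set (Ω N)) : Prop :=
  Tendsto (fun N => P N (A N)ᶜ) atTop (𝓝 0)

/-- The joint law of the signal vector and of the noise, which are independent. -/
def jointLaw (e : Ensemble) (p : ℕ) (prior : ∀ N, Measure (EuclideanSpace ℝ (Fin N))) (N : ℕ) :
    Measure (EuclideanSpace ℝ (Fin N) × Tensor p N) :=
  (prior N).prod (noise e p N)

/-! ### The spectral algorithm -/

/-- The span of all eigenvectors of `A` with (real) eigenvalue at least `E`. -/
def upperEigenspace {N n : ℕ} (A : Operator N n) (E : ℝ) : Submodule ℂ (State N n) :=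
  ⨆ a : {a : ℝ // E ≤ a}, Module.End.eigenspace (Matrix.toEuclideanLin A) ((a : ℝ) : ℂ)

/-- The detection step, run on an invariant subspace `V` of the full Hilbert space: the leading
eigenvalue of the Hamiltonian on `V` exceeds the cutoff. -/
def Detects {p N n : ℕ} (V : Submodule ℂ (State N n)) (E : ℝ) (T : Tensor p N) : Prop :=
  ∃ a : ℝ, E < a ∧ ∃ Ψ ∈ V,
    Module.End.HasEigenvector (Matrix.toEuclideanLin (hamiltonian n T)) (a : ℂ) Ψ

/-- The density matrices that the spectral algorithm with energy cutoff `E`, run on the invariant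
subspace `V`, may return on input `T`: none unless the detection step succeeds, and then the single
particle density matrix of the leading eigenvector, or of any normalized vector in the eigenspace of
eigenvalue at least `E`. -/
def algorithmOutputs {p N n : ℕ} (V : Submodule ℂ (State N n)) (E : ℝ) (T : Tensor p N) :
    Set (Matrix (Fin N) (Fin N) ℂ) :=
  {ρ | Detects V E T ∧
    ∃ Ψ ∈ V, Ψ ∈ upperEigenspace (hamiltonian n T) E ∧ ‖Ψ‖ = 1 ∧ ρ = singleParticle (pureState Ψ)}

/-- An algorithm achieves recovery when, with high probability, it outputs a density matrix `ρ` with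
`⟨v|ρ|v⟩ / N = Ω(1)`; `out N T` is the set of its admissible outputs, all of which have to satisfy
the bound. -/
def AchievesRecovery (p : ℕ) (e : Ensemble) (prior : ∀ N, Measure (EuclideanSpace ℝ (Fin N)))
    (lam : ℕ → ℝ) (out : ∀ N, Tensor p N → Set (Matrix (Fin N) (Fin N) ℂ)) : Prop :=
  ∃ κ : ℝ, 0 < κ ∧ WithHighProbability (jointLaw e p prior) fun N =>
    {ω | (out N (spiked (lam N) ω.1 ω.2)).Nonempty ∧
      ∀ ρ ∈ out N (spiked (lam N) ω.1 ω.2), IsDensityMatrix ρ ∧ κ ≤ overlap ω.1 ρ}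

end SpikedTensor

end

set_option linter.unusedSectionVars false

noncomputable section

namespace SpikedTensor

/-! ### Trace inequalities for Hermitian matrices -/

section TraceInequalities

variable {X : Type*} [Fintype X]

/-! Write k = p/2 and let M = n!/(n-k)! be the number of embeddings of k sites into n. The energy
splits as λ⟨H(v^{⊗p})⟩ + ⟨H(G)⟩. For |v| = √N, H(v^{⊗p}) is the sum over embeddings of N^k times the
projection onto v on the chosen sites. Such a projection is dominated by the projection onto v on
any single chosen site. Averaging over embeddings bounds the signal energy by E₀ times the overlap
(`mixedEnergy_tensorPower_le`). If no state has noise energy above E_max, then energy ≤ E₀ · overlap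
+ E_max, and all the overlap bounds are rearrangements of this. For detection the product state v ⊗
⋯ ⊗ v is a trial vector: its energy is E₀ plus one scalar Gaussian, controlled by Chebyshev's
inequality.

The substance is therefore the bound of the top eigenvalue of H(G) by E_max. For a Gaussian series H
= ∑ g_i A_i, integration by parts in E tr H^{2m+2} and the inequality tr(A H^j A H^l) ≤ tr(A²
H^{j+l}) for j + l even give the recursion `integral_trace_pow_le`. It involves only ∑ A_i², tested
on positive matrices. If that sum is dominated by a diagonal matrix with entries at most s, then E
tr H^{2m} ≤ (2m-1)!! s^m dim, and 2m ≈ 2 log dim yields √(2 s log dim).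

For the Hamiltonian, ∑ A_i² consists of a nearly scalar return term of size M N^k and a term that
moves pairs of equal coordinates simultaneously. The plain row sums of the second term are too large
on configurations with many equal coordinates. A Schur test with the weight ∏ₐ (mₐ-1)!!, where mₐ
are the multiplicities, cancels exactly the number of possible partners. What remains is (N+n)^k M
times the fraction of coinciding coordinates (`sum_sum_pairKernel_le`). The maximum of the diagonal
bound is M N^k(1+o(1)), which corresponds exactly to E_max.

Exactness leaves no room for the o(1) errors, so a small gain is extracted. Configurations with more
than half of their coordinates coinciding are rare (`card_many_coincidences_le`), and for all others
the diagonal bound is at most 7/8 of the maximum. Running the recursion with 7/8 of the maximum for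
the first (log dim)/96 steps lowers the threshold under the square root by the fixed factor
e^{-1/1000}. This absorbs every lower order correction, including that of J. Complex and symmetrized
ensembles follow from the real one by splitting into real and imaginary parts and by a union bound
over permutations. -/

theorem pow_mul_pow_add_le {x y : ℝ} {j l : ℕ} (h : Even (j + l)) :
    x ^ j * y ^ l + y ^ j * x ^ l ≤ x ^ (j + l) + y ^ (j + l) := by
  -- The exponents have the same parity. If even, both powers increase with the absolute value; if
  -- odd, both increase with the number itself. Either way the two differences have the same sign.
  have key : 0 ≤ (x ^ j - y ^ j) * (x ^ l - y ^ l) := by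
    rcases Nat.even_or_odd j with hj | hj
    · have hl : Even l := (Nat.even_add.mp h).mp hj
      rw [← hj.pow_abs x, ← hj.pow_abs y, ← hl.pow_abs x, ← hl.pow_abs y]
      rcases le_total |x| |y| with hxy | hxy
      · exact mul_nonneg_of_nonpos_of_nonpos
          (sub_nonpos.2 (pow_le_pow_left₀ (abs_nonneg _) hxy _))
          (sub_nonpos.2 (pow_le_pow_left₀ (abs_nonneg _) hxy _))
      · exact mul_nonneg
          (sub_nonneg.2 (pow_le_pow_left₀ (abs_nonneg _) hxy _))
          (sub_nonneg.2 (pow_le_pow_left₀ (abs_nonneg _) hxy _))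
    · have hl : Odd l := by
        rcases Nat.even_or_odd l with hl | hl
        · exact absurd ((Nat.even_add.mp h).mpr hl) (Nat.not_even_iff_odd.2 hj)
        · exact hl
      rcases le_total x y with hxy | hxy
      · exact mul_nonneg_of_nonpos_of_nonpos
          (sub_nonpos.2 (hj.strictMono_pow.monotone hxy))
          (sub_nonpos.2 (hl.strictMono_pow.monotone hxy))
      · exact mul_nonneg
          (sub_nonneg.2 (hj.strictMono_pow.monotone hxy))
          (sub_nonneg.2 (hl.strictMono_pow.monotone hxy))
  rw [pow_add, pow_add]
  nlinarith [key]

/-- A weighted Schur test. -/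
theorem abs_re_trace_mul_le_of_weight {S : Matrix X X ℝ} (hS : ∀ x y, S x y = S y x)
    (hS0 : ∀ x y, 0 ≤ S x y) {f w : X → ℝ} (hf : ∀ x, 0 < f x)
    (hw : ∀ x, ∑ y, S x y * f y ≤ w x * f x) (P : Matrix X X ℂ) :
    |((S.map Complex.ofReal) * (P.conjTranspose * P)).trace.re|
      ≤ ∑ x, w x * ((P.conjTranspose * P) x x).re := by
  set Q := P.conjTranspose * P with hQ
  have hQxx (x : X) : (Q x x).re = ∑ z, Complex.normSq (P z x) := by
    rw [hQ, Matrix.mul_apply, Complex.re_sum]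
    refine Finset.sum_congr rfl fun z _ => ?_
    rw [Matrix.conjTranspose_apply, Complex.star_def, ← Complex.normSq_eq_conj_mul_self,
      Complex.ofReal_re]
  have hQxx0 (x : X) : 0 ≤ (Q x x).re := by
    rw [hQxx]
    exact Finset.sum_nonneg fun _ _ => Complex.normSq_nonneg _
  -- The entries of Q are inner products of columns of P, and the weighted AM-GM inequality is
  -- applied termwise. The gap is a square divided by f x * f y.
  have hQxy (x y : X) : 2 * |(Q y x).re| ≤ f y / f x * (Q x x).re + f x / f y * (Q y y).re := by
    have h1 : |(Q y x).re| ≤ ∑ z, ‖P z y‖ * ‖P z x‖ := by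
      refine (Complex.abs_re_le_norm _).trans ?_
      rw [hQ, Matrix.mul_apply]
      refine (norm_sum_le _ _).trans (le_of_eq ?_)
      refine Finset.sum_congr rfl fun z _ => ?_
      rw [norm_mul, Matrix.conjTranspose_apply, norm_star]
    rw [hQxx, hQxx, Finset.mul_sum, Finset.mul_sum, ← Finset.sum_add_distrib]
    refine (mul_le_mul_of_nonneg_left h1 zero_le_two).trans ?_
    rw [Finset.mul_sum]
    refine Finset.sum_le_sum fun z _ => ?_
    rw [Complex.normSq_eq_norm_sq, Complex.normSq_eq_norm_sq]
    have hx := hf x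
    have hy := hf y
    have : f y / f x * ‖P z x‖ ^ 2 + f x / f y * ‖P z y‖ ^ 2 - 2 * (‖P z y‖ * ‖P z x‖)
        = (f y * ‖P z x‖ - f x * ‖P z y‖) ^ 2 / (f x * f y) := by
      field_simp
      ring
    have h2 : 0 ≤ (f y * ‖P z x‖ - f x * ‖P z y‖) ^ 2 / (f x * f y) := by positivity
    linarith
  have h1 : |((S.map Complex.ofReal) * Q).trace.re| ≤ ∑ x, ∑ y, S x y * |(Q y x).re| := by
    rw [Matrix.trace, Complex.re_sum]
    refine (Finset.abs_sum_le_sum_abs _ _).trans (Finset.sum_le_sum fun x _ => ?_)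
    rw [Matrix.diag_apply, Matrix.mul_apply, Complex.re_sum]
    refine (Finset.abs_sum_le_sum_abs _ _).trans (Finset.sum_le_sum fun y _ => ?_)
    rw [Matrix.map_apply, Complex.re_ofReal_mul, abs_mul, abs_of_nonneg (hS0 x y)]
  have h2 : ∑ x, ∑ y, S x y * (f x / f y * (Q y y).re)
      = ∑ x, ∑ y, S x y * (f y / f x * (Q x x).re) := by
    rw [Finset.sum_comm]
    refine Finset.sum_congr rfl fun x _ => Finset.sum_congr rfl fun y _ => ?_
    rw [hS]
  have h3 : ∑ x, ∑ y, S x y * (f y / f x * (Q x x).re) ≤ ∑ x, w x * (Q x x).re := by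
    refine Finset.sum_le_sum fun x _ => ?_
    have : ∑ y, S x y * (f y / f x * (Q x x).re) = (∑ y, S x y * f y) / f x * (Q x x).re := by
      rw [Finset.sum_div, Finset.sum_mul]
      refine Finset.sum_congr rfl fun y _ => ?_
      ring
    rw [this]
    exact mul_le_mul_of_nonneg_right ((div_le_iff₀ (hf x)).2 (hw x)) (hQxx0 x)
  have h4 : 2 * ∑ x, ∑ y, S x y * |(Q y x).re|
      ≤ ∑ x, ∑ y, S x y * (f y / f x * (Q x x).re)
        + ∑ x, ∑ y, S x y * (f x / f y * (Q y y).re) := by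
    simp only [Finset.mul_sum, ← Finset.sum_add_distrib, ← mul_add]
    refine Finset.sum_le_sum fun x _ => Finset.sum_le_sum fun y _ => ?_
    have := mul_le_mul_of_nonneg_left (hQxy x y) (hS0 x y)
    linarith
  linarith

variable [DecidableEq X]

theorem exists_unitary_pow_eq {H : Matrix X X ℂ} (hH : H.IsHermitian) :
    ∃ U ∈ Matrix.unitaryGroup X ℂ, ∃ h : X → ℝ, ∀ j : ℕ,
      H ^ j = U * Matrix.diagonal (fun a => ((h a ^ j : ℝ) : ℂ)) * star U := by
  refine ⟨hH.eigenvectorUnitary, hH.eigenvectorUnitary.2, hH.eigenvalues, fun j => ?_⟩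
  conv_lhs => rw [hH.spectral_theorem]
  rw [← map_pow, Unitary.conjStarAlgAut_apply, Matrix.diagonal_pow]
  congr 3
  ext a
  simp

theorem trace_mul_diagonal_mul_diagonal (B : Matrix X X ℂ) (d e : X → ℂ) :
    (B * Matrix.diagonal d * B * Matrix.diagonal e).trace
      = ∑ a, ∑ b, B a b * d b * B b a * e a := by
  rw [Matrix.trace]
  refine Finset.sum_congr rfl fun a _ => ?_
  rw [Matrix.diag_apply, Matrix.mul_diagonal, Matrix.mul_apply, Finset.sum_mul]
  refine Finset.sum_congr rfl fun b _ => ?_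
  rw [Matrix.mul_diagonal]

/-- In an eigenbasis of H, with B the matrix of A, the sides are ∑ |B_ab|² h_b^j h_a^l and ∑ |B_ab|²
h_a^{j+l}. Since |B_ab|² is symmetric, one may symmetrize in a and b and use `pow_mul_pow_add_le`.
This brings together the two copies of A that integration by parts leaves apart. -/
theorem trace_mul_pow_mul_pow_le {A H : Matrix X X ℂ} (hA : A.IsHermitian) (hH : H.IsHermitian)
    {j l : ℕ} (hjl : Even (j + l)) :
    (A * H ^ j * A * H ^ l).trace.re ≤ (A * A * H ^ (j + l)).trace.re := by
  obtain ⟨U, hU, h, hpow⟩ := exists_unitary_pow_eq hH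
  have hUU : star U * U = 1 := Matrix.mem_unitaryGroup_iff'.1 hU
  have hUU' : U * star U = 1 := Matrix.mem_unitaryGroup_iff.1 hU
  set B := star U * A * U with hB
  have hBh : B.IsHermitian := by
    simp only [hB, Matrix.IsHermitian, ← Matrix.star_eq_conjTranspose, star_mul, star_star]
    rw [Matrix.star_eq_conjTranspose A, hA.eq, mul_assoc]
  have e1 (j l : ℕ) : (A * H ^ j * A * H ^ l).trace
      = (B * Matrix.diagonal (fun a => ((h a ^ j : ℝ) : ℂ)) * B
          * Matrix.diagonal (fun a => ((h a ^ l : ℝ) : ℂ))).trace := by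
    rw [hpow, hpow, hB]
    simp only [← mul_assoc]
    rw [Matrix.trace_mul_comm]
    simp only [← mul_assoc]
  have e2 (j l : ℕ) : (A * H ^ j * A * H ^ l).trace.re
      = ∑ a, ∑ b, Complex.normSq (B a b) * (h b ^ j * h a ^ l) := by
    rw [e1, trace_mul_diagonal_mul_diagonal, Complex.re_sum]
    refine Finset.sum_congr rfl fun a _ => ?_
    rw [Complex.re_sum]
    refine Finset.sum_congr rfl fun b _ => ?_
    have : B b a = conj (B a b) := (hBh.apply b a).symm
    rw [this]
    have : B a b * ((h b ^ j : ℝ) : ℂ) * conj (B a b) * ((h a ^ l : ℝ) : ℂ)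
        = ((Complex.normSq (B a b) * (h b ^ j * h a ^ l) : ℝ) : ℂ) := by
      push_cast
      rw [← Complex.mul_conj]
      ring
    rw [this, Complex.ofReal_re]
  have hsym (a b : X) : Complex.normSq (B b a) = Complex.normSq (B a b) := by
    rw [← hBh.apply b a]
    exact Complex.normSq_conj _
  have swap (f : X → X → ℝ) : ∑ a, ∑ b, Complex.normSq (B a b) * f a b
      = ∑ a, ∑ b, Complex.normSq (B a b) * f b a := by
    rw [Finset.sum_comm]
    simp only [hsym]
  have e3 : (A * A * H ^ (j + l)).trace.re = (A * H ^ 0 * A * H ^ (j + l)).trace.re := by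
    simp
  rw [e3, e2, e2]
  have s1 := swap (fun a b => h b ^ j * h a ^ l)
  have s2 := swap (fun a b => h b ^ 0 * h a ^ (j + l))
  have : ∑ a, ∑ b, Complex.normSq (B a b) * (h b ^ j * h a ^ l)
      + ∑ a, ∑ b, Complex.normSq (B a b) * (h a ^ j * h b ^ l)
      ≤ ∑ a, ∑ b, Complex.normSq (B a b) * (h b ^ 0 * h a ^ (j + l))
      + ∑ a, ∑ b, Complex.normSq (B a b) * (h a ^ 0 * h b ^ (j + l)) := by
    simp only [← Finset.sum_add_distrib, ← mul_add]
    refine Finset.sum_le_sum fun a _ => Finset.sum_le_sum fun b _ => ?_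
    refine mul_le_mul_of_nonneg_left ?_ (Complex.normSq_nonneg _)
    have := pow_mul_pow_add_le (x := h a) (y := h b) hjl
    simp only [pow_zero, one_mul]
    linarith
  linarith

/-- Every eigenvalue to the power 2q is at most the trace, and tr(σH) is a convex combination of
eigenvalues. A single moment event thus controls all states at once. -/
theorem trace_mul_le_of_trace_pow_le {H σ : Matrix X X ℂ} (hH : H.IsHermitian)
    (hσ : σ.PosSemidef) (hσ1 : σ.trace = 1) {B : ℝ} (hB : 0 ≤ B) {q : ℕ} (hq : q ≠ 0)
    (h : (H ^ (2 * q)).trace.re ≤ B ^ (2 * q)) : (σ * H).trace.re ≤ B := by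
  obtain ⟨U, hU, e, hpow⟩ := exists_unitary_pow_eq hH
  have hUU : star U * U = 1 := Matrix.mem_unitaryGroup_iff'.1 hU
  have hUU' : U * star U = 1 := Matrix.mem_unitaryGroup_iff.1 hU
  have htr : (H ^ (2 * q)).trace.re = ∑ a, e a ^ (2 * q) := by
    rw [hpow, Matrix.trace_mul_comm, ← mul_assoc, hUU, one_mul, Matrix.trace_diagonal,
      Complex.re_sum]
    simp only [Complex.ofReal_re]
  have hle (a : X) : e a ≤ B := by
    have h1 : e a ^ (2 * q) ≤ B ^ (2 * q) := by
      refine le_trans ?_ (htr ▸ h)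
      exact Finset.single_le_sum (f := fun a => e a ^ (2 * q))
        (fun b _ => (even_two_mul q).pow_nonneg _) (Finset.mem_univ a)
    exact (le_abs_self _).trans (by
      have := (pow_le_pow_iff_left₀ (abs_nonneg (e a)) hB (n := 2 * q) (by omega)).1
      apply this
      rwa [(even_two_mul q).pow_abs])
  set τ := star U * σ * U with hτ
  have hτp : τ.PosSemidef := by
    have := hσ.conjTranspose_mul_mul_same U
    rwa [← Matrix.star_eq_conjTranspose] at this
  have hτ1 : τ.trace = 1 := by
    rw [hτ, Matrix.trace_mul_comm, ← mul_assoc, hUU', one_mul, hσ1]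
  have hre : (σ * H).trace.re = ∑ a, (τ a a).re * e a := by
    have h1 := hpow 1
    simp only [pow_one] at h1
    rw [h1, ← mul_assoc, Matrix.trace_mul_comm, ← mul_assoc, ← mul_assoc, ← hτ, Matrix.trace,
      Complex.re_sum]
    simp [Matrix.diag, Matrix.mul_diagonal]
  have hsum : ∑ a, (τ a a).re = 1 := by
    rw [← Complex.re_sum]
    change τ.trace.re = 1
    rw [hτ1, Complex.one_re]
  rw [hre]
  calc ∑ a, (τ a a).re * e a ≤ ∑ a, (τ a a).re * B := by
        refine Finset.sum_le_sum fun a _ => mul_le_mul_of_nonneg_left (hle a) ?_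
        have := hτp.diag_nonneg (i := a)
        exact (Complex.le_def.1 this).1
    _ = B := by rw [← Finset.sum_mul, hsum, one_mul]

end TraceInequalities

end SpikedTensor


namespace SpikedTensor

/-! ### Gaussian integration by parts for polynomials -/

section GaussianPolynomials

theorem integrable_pow_gaussianReal (s : ℕ) :
    Integrable (fun x : ℝ => x ^ s) (gaussianReal 0 1) :=
  integrable_pow_of_integrable_exp_mul (X := fun x => x) one_ne_zero
    (integrable_exp_mul_gaussianReal 1) (integrable_exp_mul_gaussianReal (-1)) s

theorem integrable_pow_mul_gaussianPDFReal (s : ℕ) :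
    Integrable (fun x : ℝ => x ^ s * gaussianPDFReal 0 1 x) := by
  have h := integrable_pow_gaussianReal s
  rw [gaussianReal_of_var_ne_zero 0 one_ne_zero, integrable_withDensity_iff_integrable_smul'
    (measurable_gaussianPDF 0 1) (by simp [gaussianPDF_lt_top])] at h
  refine h.congr (Eventually.of_forall fun x => ?_)
  simp only [toReal_gaussianPDF, smul_eq_mul]
  ring

/-- Integration by parts against the density φ, with φ' = -xφ. For s = 0 the truncated exponent s -
1 is harmless, since its coefficient vanishes. -/
theorem integral_pow_succ_gaussianReal (s : ℕ) :
    ∫ x : ℝ, x ^ (s + 1) ∂(gaussianReal 0 1) = s * ∫ x : ℝ, x ^ (s - 1) ∂(gaussianReal 0 1) := by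
  rw [integral_gaussianReal_eq_integral_smul one_ne_zero,
    integral_gaussianReal_eq_integral_smul one_ne_zero]
  have hpdf (x : ℝ) : HasDerivAt (gaussianPDFReal 0 1) (-x * gaussianPDFReal 0 1 x) x := by
    simp only [gaussianPDFReal_def]
    have h1 : HasDerivAt (fun y : ℝ => -(y - 0) ^ 2 / (2 * ((1 : ℝ≥0) : ℝ))) (-x) x := by
      have := (((hasDerivAt_id x).sub_const 0).pow 2).neg.div_const (2 * ((1 : ℝ≥0) : ℝ))
      refine this.congr_deriv ?_
      simp
      ring
    exact (h1.exp.const_mul _).congr_deriv (by ring)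
  have key := integral_mul_deriv_eq_deriv_mul_of_integrable
    (u := fun x : ℝ => x ^ s) (v := gaussianPDFReal 0 1) (u' := fun x => s * x ^ (s - 1))
    (v' := fun x => -x * gaussianPDFReal 0 1 x) (fun x _ => hasDerivAt_pow s x)
    (fun x _ => hpdf x)
    ((integrable_pow_mul_gaussianPDFReal (s + 1)).neg.congr (Eventually.of_forall fun x => by
      simp only [Pi.neg_apply, Pi.mul_apply]; ring))
    (((integrable_pow_mul_gaussianPDFReal (s - 1)).const_mul (s : ℝ)).congr
      (Eventually.of_forall fun x => by simp only [Pi.mul_apply]; ring))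
    (integrable_pow_mul_gaussianPDFReal s)
  have e1 : ∫ x : ℝ, gaussianPDFReal 0 1 x • x ^ (s + 1)
      = -∫ x : ℝ, x ^ s * (-x * gaussianPDFReal 0 1 x) := by
    rw [← integral_neg]
    refine integral_congr_ae (Eventually.of_forall fun x => ?_)
    simp only [smul_eq_mul]
    ring
  rw [e1, key, neg_neg, ← integral_const_mul]
  refine integral_congr_ae (Eventually.of_forall fun x => ?_)
  simp only [smul_eq_mul]
  ring

variable {ι : Type*} [Fintype ι]

/-- The law of a family of independent real standard Gaussian variables. -/
abbrev stdGaussian (ι : Type*) [Fintype ι] : Measure (ι → ℝ) :=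
  Measure.pi fun _ => gaussianReal 0 1

/-- The evaluation of a polynomial with complex coefficients at a real point. -/
abbrev evalReal (g : ι → ℝ) : MvPolynomial ι ℂ →+* ℂ :=
  MvPolynomial.eval fun i => (g i : ℂ)

theorem evalReal_monomial (g : ι → ℝ) (u : ι →₀ ℕ) (a : ℂ) :
    evalReal g (MvPolynomial.monomial u a) = a * ∏ i, ((g i : ℂ)) ^ u i := by
  rw [evalReal, MvPolynomial.eval_monomial, Finsupp.prod_fintype _ _ (fun i => pow_zero _)]

theorem integrable_ofReal_pow_gaussianReal (s : ℕ) :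
    Integrable (fun x : ℝ => (x : ℂ) ^ s) (gaussianReal 0 1) := by
  simpa using (integrable_pow_gaussianReal s).ofReal (𝕜 := ℂ)

theorem integral_ofReal_pow_succ_gaussianReal (s : ℕ) :
    ∫ x : ℝ, (x : ℂ) ^ (s + 1) ∂(gaussianReal 0 1)
      = s * ∫ x : ℝ, (x : ℂ) ^ (s - 1) ∂(gaussianReal 0 1) := by
  have h := congrArg Complex.ofReal (integral_pow_succ_gaussianReal s)
  rw [← integral_complex_ofReal, Complex.ofReal_mul, ← integral_complex_ofReal] at h
  simpa using h

theorem integrable_evalReal (P : MvPolynomial ι ℂ) :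
    Integrable (fun g => evalReal g P) (stdGaussian ι) := by
  induction P using MvPolynomial.induction_on' with
  | monomial u a =>
    simp only [evalReal_monomial]
    exact (Integrable.fintype_prod (f := fun i (x : ℝ) => (x : ℂ) ^ u i)
      (fun i => integrable_ofReal_pow_gaussianReal _)).const_mul a
  | add p q hp hq =>
    simp only [map_add]
    exact hp.add hq

/-- By linearity it suffices to treat monomials, where the integral factorizes and only the factor
of the variable i changes, by the one-dimensional moment recursion. -/
theorem integral_mul_evalReal [DecidableEq ι] (i : ι) (P : MvPolynomial ι ℂ) :
    ∫ g, (g i : ℂ) * evalReal g P ∂(stdGaussian ι)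
      = ∫ g, evalReal g (MvPolynomial.pderiv i P) ∂(stdGaussian ι) := by
  have hX (Q : MvPolynomial ι ℂ) : (fun g : ι → ℝ => (g i : ℂ) * evalReal g Q)
      = fun g => evalReal g (MvPolynomial.X i * Q) := by
    funext g
    rw [map_mul, evalReal, MvPolynomial.eval_X]
  induction P using MvPolynomial.induction_on' with
  | monomial u a =>
    have e1 (g : ι → ℝ) : (g i : ℂ) * evalReal g (MvPolynomial.monomial u a)
        = a * ∏ j, (g j : ℂ) ^ ((if j = i then 1 else 0) + u j) := by
      rw [evalReal_monomial]
      simp only [pow_add, Finset.prod_mul_distrib]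
      have : ∏ j, (g j : ℂ) ^ (if j = i then 1 else 0) = g i := by
        rw [Finset.prod_eq_single i] <;> simp +contextual
      rw [this]
      ring
    simp only [e1]
    simp only [MvPolynomial.pderiv_monomial, evalReal_monomial]
    rw [integral_const_mul, integral_const_mul,
      integral_fintype_prod_eq_prod (fun j (x : ℝ) => (x : ℂ) ^ ((if j = i then 1 else 0) + u j)),
      integral_fintype_prod_eq_prod (fun j (x : ℝ) => (x : ℂ) ^ ((u - Finsupp.single i 1 : ι →₀ ℕ) j)),
      ← Finset.mul_prod_erase _ _ (Finset.mem_univ i), mul_assoc,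
      ← Finset.mul_prod_erase Finset.univ _ (Finset.mem_univ i)]
    have e2 : ∏ j ∈ Finset.univ.erase i,
          ∫ x : ℝ, (x : ℂ) ^ ((if j = i then 1 else 0) + u j) ∂(gaussianReal 0 1)
        = ∏ j ∈ Finset.univ.erase i,
          ∫ x : ℝ, (x : ℂ) ^ ((u - Finsupp.single i 1 : ι →₀ ℕ) j) ∂(gaussianReal 0 1) := by
      refine Finset.prod_congr rfl fun j hj => ?_
      have hji : j ≠ i := Finset.ne_of_mem_erase hj
      simp [hji]
    rw [e2, if_pos rfl, add_comm 1 (u i), integral_ofReal_pow_succ_gaussianReal]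
    simp only [Finsupp.coe_tsub, Pi.sub_apply, Finsupp.single_eq_same]
    ring
  | add p q hp hq =>
    simp only [map_add, mul_add]
    rw [integral_add, integral_add, hp, hq]
    · exact integrable_evalReal _
    · exact integrable_evalReal _
    · rw [hX]; exact integrable_evalReal _
    · rw [hX]; exact integrable_evalReal _

end GaussianPolynomials

/-! ### Moments of Gaussian matrix series -/

section MatrixSeries

variable {ι X : Type*} [Fintype ι] [Fintype X] [DecidableEq X]

/-- The matrix series `∑ i, g i • A i`. -/
def matrixSeries (A : ι → Matrix X X ℂ) (g : ι → ℝ) : Matrix X X ℂ :=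
  ∑ i, (g i : ℂ) • A i

/-- The matrix of linear polynomials `∑ i, X i • A i`. -/
def polyMatrix (A : ι → Matrix X X ℂ) : Matrix X X (MvPolynomial ι ℂ) :=
  fun x y => ∑ i, MvPolynomial.X i * MvPolynomial.C (A i x y)

theorem map_polyMatrix (A : ι → Matrix X X ℂ) (g : ι → ℝ) :
    (polyMatrix A).map (evalReal g) = matrixSeries A g := by
  ext x y
  simp [polyMatrix, matrixSeries, Matrix.sum_apply]

theorem map_polyMatrix_pow (A : ι → Matrix X X ℂ) (g : ι → ℝ) (m : ℕ) :
    (polyMatrix A ^ m).map (evalReal g) = matrixSeries A g ^ m := by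
  rw [Matrix.map_pow, map_polyMatrix]

theorem map_C_map_evalReal (B : Matrix X X ℂ) (g : ι → ℝ) :
    (B.map MvPolynomial.C).map (evalReal g) = B := by
  ext x y
  simp

theorem evalReal_trace (M : Matrix X X (MvPolynomial ι ℂ)) (g : ι → ℝ) :
    evalReal g M.trace = (M.map (evalReal g)).trace := by
  simp [Matrix.trace, map_sum]

theorem map_pderiv_mul [DecidableEq ι] (i : ι) (M L : Matrix X X (MvPolynomial ι ℂ)) :
    (M * L).map (MvPolynomial.pderiv i)
      = M.map (MvPolynomial.pderiv i) * L + M * L.map (MvPolynomial.pderiv i) := by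
  refine Matrix.ext fun x y => ?_
  simp only [Matrix.map_apply, Matrix.mul_apply, map_sum, Matrix.add_apply,
    ← Finset.sum_add_distrib, MvPolynomial.pderiv_mul]

theorem map_pderiv_C [DecidableEq ι] (i : ι) (B : Matrix X X ℂ) :
    (B.map MvPolynomial.C).map (MvPolynomial.pderiv i) = 0 := by
  refine Matrix.ext fun x y => ?_
  simp

theorem map_pderiv_polyMatrix [DecidableEq ι] (i : ι) (A : ι → Matrix X X ℂ) :
    (polyMatrix A).map (MvPolynomial.pderiv i) = (A i).map MvPolynomial.C := by
  refine Matrix.ext fun x y => ?_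
  simp only [Matrix.map_apply, polyMatrix, map_sum, MvPolynomial.pderiv_mul, MvPolynomial.pderiv_X,
    MvPolynomial.pderiv_C, mul_zero, add_zero, Pi.single_apply]
  simp

theorem map_pderiv_polyMatrix_pow [DecidableEq ι] (i : ι) (A : ι → Matrix X X ℂ) (m : ℕ) :
    (polyMatrix A ^ m).map (MvPolynomial.pderiv i)
      = ∑ j ∈ Finset.range m,
          polyMatrix A ^ j * (A i).map MvPolynomial.C * polyMatrix A ^ (m - 1 - j) := by
  induction m with
  | zero =>
    refine Matrix.ext fun x y => ?_
    by_cases h : x = y <;> simp [h]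
  | succ m ih =>
    have hlast : m + 1 - 1 - m = 0 := by omega
    rw [pow_succ, map_pderiv_mul, ih, map_pderiv_polyMatrix, Finset.sum_range_succ, Finset.sum_mul,
      hlast, pow_zero, Matrix.mul_one]
    refine congrArg₂ (· + ·) ?_ rfl
    · refine Finset.sum_congr rfl fun j hj => ?_
      have hj' := Finset.mem_range.1 hj
      rw [Matrix.mul_assoc _ _ (polyMatrix A), ← pow_succ,
        show m - 1 - j + 1 = m + 1 - 1 - j by omega]

/-- The Leibniz rule inserts A i at each of the m positions of the power. Carrying this out over a
polynomial ring makes both the derivative and the integrability purely algebraic. -/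
theorem integral_trace_mul_pow [DecidableEq ι] (A : ι → Matrix X X ℂ) (i : ι) (m : ℕ) :
    ∫ g, (g i : ℂ) * (A i * matrixSeries A g ^ m).trace ∂(stdGaussian ι)
      = ∫ g, ∑ j ∈ Finset.range m,
          (A i * matrixSeries A g ^ j * A i * matrixSeries A g ^ (m - 1 - j)).trace
            ∂(stdGaussian ι) := by
  have h := integral_mul_evalReal i ((A i).map MvPolynomial.C * polyMatrix A ^ m).trace
  have h1 : MvPolynomial.pderiv i ((A i).map MvPolynomial.C * polyMatrix A ^ m).trace
      = (((A i).map MvPolynomial.C * polyMatrix A ^ m).map (MvPolynomial.pderiv i)).trace := by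
    simp [Matrix.trace, map_sum]
  rw [h1, map_pderiv_mul, map_pderiv_C, zero_mul, zero_add, map_pderiv_polyMatrix_pow] at h
  simpa only [evalReal_trace, Matrix.map_mul, map_polyMatrix_pow, map_C_map_evalReal,
    Finset.mul_sum, Matrix.trace_sum, map_sum, ← mul_assoc] using h

theorem isHermitian_matrixSeries {A : ι → Matrix X X ℂ} (hA : ∀ i, (A i).IsHermitian)
    (g : ι → ℝ) : (matrixSeries A g).IsHermitian := by
  rw [Matrix.IsHermitian, matrixSeries, Matrix.conjTranspose_sum]
  refine Finset.sum_congr rfl fun i _ => ?_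
  rw [Matrix.conjTranspose_smul, (hA i).eq, Complex.star_def, Complex.conj_ofReal]

theorem integrable_entry_pow (A : ι → Matrix X X ℂ) (m : ℕ) (x y : X) :
    Integrable (fun g => (matrixSeries A g ^ m) x y) (stdGaussian ι) := by
  have := integrable_evalReal ((polyMatrix A ^ m) x y)
  refine this.congr (Eventually.of_forall fun g => ?_)
  simp only [← map_polyMatrix_pow, Matrix.map_apply]

theorem integrable_re_entry_pow (A : ι → Matrix X X ℂ) (m : ℕ) (x y : X) :
    Integrable (fun g => ((matrixSeries A g ^ m) x y).re) (stdGaussian ι) :=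
  (integrable_entry_pow A m x y).re

theorem integrable_re_trace_pow (A : ι → Matrix X X ℂ) (m : ℕ) :
    Integrable (fun g => (matrixSeries A g ^ m).trace.re) (stdGaussian ι) := by
  simp only [Matrix.trace, Matrix.diag_apply, Complex.re_sum]
  exact integrable_finsetSum _ fun x _ => integrable_re_entry_pow A m x x

theorem pow_two_mul_eq {H : Matrix X X ℂ} (hH : H.IsHermitian) (m : ℕ) :
    H ^ (2 * m) = (H ^ m).conjTranspose * H ^ m := by
  rw [(hH.pow m).eq, two_mul, pow_add]

/-- The basic recursion for the moments of a Gaussian matrix series. -/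
theorem integral_trace_pow_le {A : ι → Matrix X X ℂ} (hA : ∀ i, (A i).IsHermitian) {w : X → ℝ}
    (hw : ∀ P : Matrix X X ℂ, ∑ i, (A i * A i * (P.conjTranspose * P)).trace.re
      ≤ ∑ x, w x * ((P.conjTranspose * P) x x).re) (m : ℕ) :
    ∫ g, (matrixSeries A g ^ (2 * (m + 1))).trace.re ∂(stdGaussian ι)
      ≤ (2 * m + 1) * ∑ x, w x * ∫ g, ((matrixSeries A g ^ (2 * m)) x x).re ∂(stdGaussian ι) := by
  classical
  have intg (B C : Matrix X X ℂ) (j l : ℕ) : Integrable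
      (fun g => (B * matrixSeries A g ^ j * C * matrixSeries A g ^ l).trace) (stdGaussian ι) := by
    have := integrable_evalReal
      (B.map MvPolynomial.C * polyMatrix A ^ j * C.map MvPolynomial.C * polyMatrix A ^ l).trace
    refine this.congr (Eventually.of_forall fun g => ?_)
    simp only [evalReal_trace, Matrix.map_mul, map_polyMatrix_pow, map_C_map_evalReal]
  have intg' (i : ι) (m : ℕ) : Integrable
      (fun g => (g i : ℂ) * (A i * matrixSeries A g ^ m).trace) (stdGaussian ι) := by
    have := integrable_evalReal
      (MvPolynomial.X i * ((A i).map MvPolynomial.C * polyMatrix A ^ m).trace)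
    refine this.congr (Eventually.of_forall fun g => ?_)
    simp only [map_mul, evalReal_trace, Matrix.map_mul, map_polyMatrix_pow, map_C_map_evalReal]
    simp
  -- One factor of the power is expanded as ∑ g i • A i and integrated by parts. The derivative
  -- falls on one of the 2m + 1 remaining factors.
  have e1 : ∫ g, (matrixSeries A g ^ (2 * (m + 1))).trace ∂(stdGaussian ι)
      = ∑ i, ∑ j ∈ Finset.range (2 * m + 1), ∫ g, (A i * matrixSeries A g ^ j * A i *
          matrixSeries A g ^ (2 * m - j)).trace ∂(stdGaussian ι) := by
    have : ∀ g : ι → ℝ, (matrixSeries A g ^ (2 * (m + 1))).trace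
        = ∑ i, (g i : ℂ) * (A i * matrixSeries A g ^ (2 * m + 1)).trace := by
      intro g
      rw [show 2 * (m + 1) = 2 * m + 1 + 1 by ring, pow_succ']
      conv_lhs => enter [1, 1]; rw [matrixSeries]
      rw [Finset.sum_mul, Matrix.trace_sum]
      refine Finset.sum_congr rfl fun i _ => ?_
      rw [Matrix.smul_mul, Matrix.trace_smul, smul_eq_mul]
    simp only [this]
    rw [integral_finsetSum _ (fun i _ => intg' i _)]
    refine Finset.sum_congr rfl fun i _ => ?_
    rw [integral_trace_mul_pow, integral_finsetSum _ (fun j _ => intg _ _ _ _)]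
    rfl
  have re_int (F : (ι → ℝ) → ℂ) (hF : Integrable F (stdGaussian ι)) :
      ∫ g, (F g).re ∂(stdGaussian ι) = (∫ g, F g ∂(stdGaussian ι)).re := by
    exact integral_re hF
  have htr : Integrable (fun g => (matrixSeries A g ^ (2 * (m + 1))).trace) (stdGaussian ι) := by
    simpa using intg 1 1 (2 * (m + 1)) 0
  have intg2 (i : ι) : Integrable
      (fun g => (A i * A i * matrixSeries A g ^ (2 * m)).trace.re) (stdGaussian ι) := by
    simpa using (intg (A i * A i) 1 0 (2 * m)).re
  rw [re_int _ htr, e1]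
  simp only [Complex.re_sum]
  calc ∑ i, ∑ j ∈ Finset.range (2 * m + 1), (∫ g, (A i * matrixSeries A g ^ j * A i *
          matrixSeries A g ^ (2 * m - j)).trace ∂(stdGaussian ι)).re
      ≤ ∑ i, ∑ j ∈ Finset.range (2 * m + 1),
          ∫ g, (A i * A i * matrixSeries A g ^ (2 * m)).trace.re ∂(stdGaussian ι) := by
        refine Finset.sum_le_sum fun i _ => Finset.sum_le_sum fun j hj => ?_
        rw [← re_int _ (intg _ _ _ _)]
        have hj' := Finset.mem_range.1 hj
        refine integral_mono (intg _ _ _ _).re (intg2 i) fun g => ?_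
        -- The exponents add up to the even number 2m, so all 2m + 1 terms have the same upper
        -- bound.
        have h := trace_mul_pow_mul_pow_le (hA i) (isHermitian_matrixSeries hA g)
          (j := j) (l := 2 * m - j) (by rw [show j + (2 * m - j) = 2 * m by omega]; simp)
        rwa [show j + (2 * m - j) = 2 * m by omega] at h
    _ = (2 * m + 1) * ∫ g, ∑ i, (A i * A i * matrixSeries A g ^ (2 * m)).trace.re
          ∂(stdGaussian ι) := by
        rw [integral_finsetSum _ (fun i _ => intg2 i), Finset.mul_sum]
        refine Finset.sum_congr rfl fun i _ => ?_
        rw [Finset.sum_const, Finset.card_range, nsmul_eq_mul]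
        push_cast
        ring
    _ ≤ _ := by
        refine mul_le_mul_of_nonneg_left ?_ (by positivity)
        simp only [← integral_const_mul]
        rw [← integral_finsetSum _ (fun x _ => (integrable_re_entry_pow A _ x x).const_mul _)]
        refine integral_mono (integrable_finsetSum _ (fun i _ => intg2 i))
          (integrable_finsetSum _ (fun x _ => (integrable_re_entry_pow A _ x x).const_mul _))
          fun g => ?_
        have := hw (matrixSeries A g ^ m)
        rwa [← pow_two_mul_eq (isHermitian_matrixSeries hA g)] at this

end MatrixSeries

end SpikedTensor

namespace SpikedTensor

/-! ### Iteration of the moment recursion, with a gain when large weights are rare -/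

section MomentBounds

variable {ι X : Type*} [Fintype ι] [Fintype X] [DecidableEq X]

/-- The double factorial `(2m-1)!!`, as a real number. -/
def oddFactorial (m : ℕ) : ℝ := ∏ j ∈ Finset.range m, (2 * (j : ℝ) + 1)

theorem oddFactorial_succ (m : ℕ) : oddFactorial (m + 1) = (2 * m + 1) * oddFactorial m := by
  rw [oddFactorial, Finset.prod_range_succ, mul_comm, oddFactorial]

theorem oddFactorial_pos (m : ℕ) : 0 < oddFactorial m :=
  Finset.prod_pos fun _ _ => by positivity

/-- Induction from (4m+1)(4m+3) ≤ 4(2m+1)². It is the price of doubling the moment in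
`sum_integral_re_pow_le`. -/
theorem oddFactorial_two_mul_le (m : ℕ) :
    oddFactorial (2 * m) ≤ 4 ^ m * oddFactorial m ^ 2 := by
  induction m with
  | zero => simp [oddFactorial]
  | succ m ih =>
    rw [show 2 * (m + 1) = 2 * m + 1 + 1 by ring, oddFactorial_succ, oddFactorial_succ,
      oddFactorial_succ]
    push_cast
    have h1 : (2 * (2 * (m : ℝ) + 1) + 1) * (2 * (2 * m) + 1) ≤ 4 * (2 * m + 1) ^ 2 := by
      nlinarith
    calc (2 * (2 * (m : ℝ) + 1) + 1) * ((2 * (2 * m) + 1) * oddFactorial (2 * m))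
        = ((2 * (2 * (m : ℝ) + 1) + 1) * (2 * (2 * m) + 1)) * oddFactorial (2 * m) := by ring
      _ ≤ (4 * (2 * m + 1) ^ 2) * (4 ^ m * oddFactorial m ^ 2) :=
        mul_le_mul h1 ih (oddFactorial_pos _).le (by positivity)
      _ = _ := by ring

theorem oddFactorial_le (m : ℕ) : oddFactorial m ≤ 2 ^ m * m.factorial := by
  induction m with
  | zero => simp [oddFactorial]
  | succ m ih =>
    rw [oddFactorial_succ, Nat.factorial_succ]
    push_cast
    calc (2 * (m : ℝ) + 1) * oddFactorial m ≤ (2 * (m + 1)) * (2 ^ m * m.factorial) :=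
          mul_le_mul (by linarith) ih (oddFactorial_pos _).le (by positivity)
      _ = _ := by ring

/-- The expectation of the trace of the `2m`-th power of a Gaussian matrix series. -/
def traceMoment (A : ι → Matrix X X ℂ) (m : ℕ) : ℝ :=
  ∫ g, (matrixSeries A g ^ (2 * m)).trace.re ∂(stdGaussian ι)

theorem re_conjTranspose_mul_self_apply (P : Matrix X X ℂ) (x : X) :
    ((P.conjTranspose * P) x x).re = ∑ z, Complex.normSq (P z x) := by
  rw [Matrix.mul_apply, Complex.re_sum]
  refine Finset.sum_congr rfl fun z _ => ?_
  rw [Matrix.conjTranspose_apply, Complex.star_def, ← Complex.normSq_eq_conj_mul_self,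
    Complex.ofReal_re]

theorem re_pow_two_mul_nonneg {H : Matrix X X ℂ} (hH : H.IsHermitian) (m : ℕ) (x : X) :
    0 ≤ ((H ^ (2 * m)) x x).re := by
  rw [pow_two_mul_eq hH, re_conjTranspose_mul_self_apply]
  exact Finset.sum_nonneg fun _ _ => Complex.normSq_nonneg _

/-- The right side is the squared norm of a column of the power, and the diagonal entry is one of
its components. -/
theorem sq_re_pow_two_mul_le {H : Matrix X X ℂ} (hH : H.IsHermitian) (m : ℕ) (x : X) :
    ((H ^ (2 * m)) x x).re ^ 2 ≤ ((H ^ (2 * (2 * m))) x x).re := by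
  rw [pow_two_mul_eq hH (2 * m), re_conjTranspose_mul_self_apply]
  refine le_trans ?_ (Finset.single_le_sum (f := fun z => Complex.normSq ((H ^ (2 * m)) z x))
    (fun _ _ => Complex.normSq_nonneg _) (Finset.mem_univ x))
  rw [Complex.normSq_apply]
  nlinarith [mul_self_nonneg ((H ^ (2 * m)) x x).im]

theorem re_trace_pow_two_mul_nonneg {H : Matrix X X ℂ} (hH : H.IsHermitian) (m : ℕ) :
    0 ≤ (H ^ (2 * m)).trace.re := by
  rw [Matrix.trace, Complex.re_sum]
  exact Finset.sum_nonneg fun x _ => re_pow_two_mul_nonneg hH m x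

theorem traceMoment_eq_sum (A : ι → Matrix X X ℂ) (m : ℕ) :
    traceMoment A m = ∑ x, ∫ g, ((matrixSeries A g ^ (2 * m)) x x).re ∂(stdGaussian ι) := by
  rw [traceMoment, ← integral_finsetSum _ (fun x _ => integrable_re_entry_pow A _ x x)]
  simp only [Matrix.trace, Matrix.diag_apply, Complex.re_sum]

theorem traceMoment_zero (A : ι → Matrix X X ℂ) : traceMoment A 0 = Fintype.card X := by
  simp [traceMoment]

/-- The square of the matrix coefficients `A i` is dominated by the diagonal matrix with entries
`w`, when tested on positive semidefinite matrices. -/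
structure DiagonallyBounded (A : ι → Matrix X X ℂ) (w : X → ℝ) : Prop where
  isHermitian : ∀ i, (A i).IsHermitian
  bound : ∀ P : Matrix X X ℂ, ∑ i, (A i * A i * (P.conjTranspose * P)).trace.re
      ≤ ∑ x, w x * ((P.conjTranspose * P) x x).re

namespace DiagonallyBounded

variable {A : ι → Matrix X X ℂ} {w : X → ℝ} {s₁ s₂ β : ℝ}

theorem integral_re_pow_nonneg (h : DiagonallyBounded A w) (m : ℕ) (x : X) :
    0 ≤ ∫ g, ((matrixSeries A g ^ (2 * m)) x x).re ∂(stdGaussian ι) :=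
  integral_nonneg fun g => re_pow_two_mul_nonneg (isHermitian_matrixSeries h.isHermitian g) m x

theorem traceMoment_succ_le (h : DiagonallyBounded A w) (hs : ∀ x, w x ≤ s₂) (m : ℕ) :
    traceMoment A (m + 1) ≤ (2 * m + 1) * (s₂ * traceMoment A m) := by
  refine (integral_trace_pow_le h.isHermitian h.bound m).trans ?_
  refine mul_le_mul_of_nonneg_left ?_ (by positivity)
  rw [traceMoment_eq_sum, Finset.mul_sum]
  exact Finset.sum_le_sum fun x _ =>
    mul_le_mul_of_nonneg_right (hs x) (h.integral_re_pow_nonneg m x)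

/-- The recursion may start at any moment m, so that an improvement c obtained at low moments
survives to the high moments that are needed. -/
theorem traceMoment_add_le (h : DiagonallyBounded A w) (hs : ∀ x, w x ≤ s₂) (h0 : 0 ≤ s₂)
    {m : ℕ} {c : ℝ} (hm : traceMoment A m ≤ oddFactorial m * c) (r : ℕ) :
    traceMoment A (m + r) ≤ oddFactorial (m + r) * (s₂ ^ r * c) := by
  induction r with
  | zero => simpa using hm
  | succ r ih =>
    rw [← add_assoc, oddFactorial_succ]
    refine (h.traceMoment_succ_le hs _).trans ?_
    have : s₂ * traceMoment A (m + r) ≤ s₂ * (oddFactorial (m + r) * (s₂ ^ r * c)) :=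
      mul_le_mul_of_nonneg_left ih h0
    calc (2 * ((m + r : ℕ) : ℝ) + 1) * (s₂ * traceMoment A (m + r))
        ≤ (2 * ((m + r : ℕ) : ℝ) + 1) * (s₂ * (oddFactorial (m + r) * (s₂ ^ r * c))) :=
          mul_le_mul_of_nonneg_left this (by positivity)
      _ = _ := by ring

theorem traceMoment_le (h : DiagonallyBounded A w) (hs : ∀ x, w x ≤ s₂) (h0 : 0 ≤ s₂) (m : ℕ) :
    traceMoment A m ≤ oddFactorial m * (s₂ ^ m * Fintype.card X) := by
  have := h.traceMoment_add_le hs h0 (m := 0) (c := Fintype.card X)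
    (by simp [traceMoment_zero, oddFactorial]) m
  simpa using this

/-- The part of the trace that comes from a small set of diagonal entries is small. -/
theorem sum_integral_re_pow_le (h : DiagonallyBounded A w) (hs : ∀ x, w x ≤ s₂) (h0 : 0 < s₂)
    {S : Finset X} (hβ : 0 < β) (hS : (S.card : ℝ) * β ^ 2 ≤ Fintype.card X) (m : ℕ) :
    ∑ x ∈ S, ∫ g, ((matrixSeries A g ^ (2 * m)) x x).re ∂(stdGaussian ι)
      ≤ oddFactorial m * ((2 * s₂) ^ m * (Fintype.card X / β)) := by
  -- From a ≤ α/2 + a²/(2α), the constant terms on S and the moments of order 4m give two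
  -- contributions. This α makes their bounds equal.
  set α : ℝ := 2 ^ m * oddFactorial m * s₂ ^ m * β with hα
  have hα0 : 0 < α := by
    have := oddFactorial_pos m
    positivity
  have h1 (x : X) : ∫ g, ((matrixSeries A g ^ (2 * m)) x x).re ∂(stdGaussian ι)
      ≤ α / 2 + (1 / (2 * α)) *
        ∫ g, ((matrixSeries A g ^ (2 * (2 * m))) x x).re ∂(stdGaussian ι) := by
    have hi := (integrable_re_entry_pow A (2 * (2 * m)) x x).const_mul (1 / (2 * α))
    have : α / 2 = ∫ _, α / 2 ∂(stdGaussian ι) := by simp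
    rw [this, ← integral_const_mul, ← integral_add (integrable_const _) hi]
    refine integral_mono (integrable_re_entry_pow A _ x x) ((integrable_const _).add hi) fun g => ?_
    have hsq := sq_re_pow_two_mul_le (isHermitian_matrixSeries h.isHermitian g) m x
    set a := ((matrixSeries A g ^ (2 * m)) x x).re
    set b := ((matrixSeries A g ^ (2 * (2 * m))) x x).re
    have : α / 2 + 1 / (2 * α) * b - a = ((a - α) ^ 2 + (b - a ^ 2)) / (2 * α) := by
      field_simp
      ring
    have h2 : 0 ≤ ((a - α) ^ 2 + (b - a ^ 2)) / (2 * α) :=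
      div_nonneg (add_nonneg (sq_nonneg _) (by linarith)) (by positivity)
    linarith
  have h2 : ∑ x ∈ S, ∫ g, ((matrixSeries A g ^ (2 * (2 * m))) x x).re ∂(stdGaussian ι)
      ≤ 4 ^ m * oddFactorial m ^ 2 * (s₂ ^ (2 * m) * Fintype.card X) := by
    calc _ ≤ traceMoment A (2 * m) := by
          rw [traceMoment_eq_sum]
          exact Finset.sum_le_univ_sum_of_nonneg fun x => h.integral_re_pow_nonneg _ x
      _ ≤ _ := h.traceMoment_le hs h0.le _
      _ ≤ _ := mul_le_mul_of_nonneg_right (oddFactorial_two_mul_le m) (by positivity)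
  calc ∑ x ∈ S, ∫ g, ((matrixSeries A g ^ (2 * m)) x x).re ∂(stdGaussian ι)
      ≤ ∑ x ∈ S, (α / 2 + (1 / (2 * α)) *
        ∫ g, ((matrixSeries A g ^ (2 * (2 * m))) x x).re ∂(stdGaussian ι)) :=
        Finset.sum_le_sum fun x _ => h1 x
    _ = S.card * (α / 2) + (1 / (2 * α)) *
        ∑ x ∈ S, ∫ g, ((matrixSeries A g ^ (2 * (2 * m))) x x).re ∂(stdGaussian ι) := by
        rw [Finset.sum_add_distrib, Finset.sum_const, nsmul_eq_mul, Finset.mul_sum]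
    _ ≤ Fintype.card X / β ^ 2 * (α / 2) + (1 / (2 * α)) *
        (4 ^ m * oddFactorial m ^ 2 * (s₂ ^ (2 * m) * Fintype.card X)) := by
        refine add_le_add (mul_le_mul_of_nonneg_right ?_ (by positivity))
          (mul_le_mul_of_nonneg_left h2 (by positivity))
        rwa [le_div_iff₀ (by positivity)]
    _ = _ := by
        have hd := (oddFactorial_pos m).ne'
        have h4 : (4 : ℝ) ^ m = 2 ^ m * 2 ^ m := by rw [← mul_pow]; norm_num
        rw [hα, h4, mul_pow, two_mul m, pow_add]
        field_simp
        ring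

/-- Outside S the recursion multiplies by at most s₁. The excess s₂ - s₁ ≤ s₁ is charged only to the
diagonal entries in S, whose share is smaller by β up to the factor 4^m. So s₁ is the effective
weight as long as m 4^m is small compared with β. -/
theorem traceMoment_le_of_card_le (h : DiagonallyBounded A w) (hs : ∀ x, w x ≤ s₂) {S : Finset X}
    (hs1 : ∀ x ∉ S, w x ≤ s₁) (h0 : 0 < s₁) (h12 : s₁ ≤ s₂) (h21 : s₂ ≤ 2 * s₁)
    (hβ : 0 < β) (hS : (S.card : ℝ) * β ^ 2 ≤ Fintype.card X) (m : ℕ) :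
    traceMoment A m ≤ oddFactorial m * (s₁ ^ m * (Fintype.card X * (1 + m * 4 ^ m / β))) := by
  induction m with
  | zero => simp [traceMoment_zero, oddFactorial]
  | succ m ih =>
    have hd := oddFactorial_pos m
    have h1 : ∑ x, w x * ∫ g, ((matrixSeries A g ^ (2 * m)) x x).re ∂(stdGaussian ι)
        ≤ s₁ * traceMoment A m + (s₂ - s₁) *
          ∑ x ∈ S, ∫ g, ((matrixSeries A g ^ (2 * m)) x x).re ∂(stdGaussian ι) := by
      rw [traceMoment_eq_sum, Finset.mul_sum, Finset.mul_sum,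
        ← Finset.sum_filter_add_sum_filter_not Finset.univ (· ∈ S),
        ← Finset.sum_filter_add_sum_filter_not Finset.univ (· ∈ S)
          (fun x => s₁ * ∫ g, ((matrixSeries A g ^ (2 * m)) x x).re ∂(stdGaussian ι))]
      have hf : Finset.univ.filter (· ∈ S) = S := by ext; simp
      have e1 : ∑ x ∈ S, w x * ∫ g, ((matrixSeries A g ^ (2 * m)) x x).re ∂(stdGaussian ι)
          ≤ ∑ x ∈ S, s₁ * ∫ g, ((matrixSeries A g ^ (2 * m)) x x).re ∂(stdGaussian ι)
            + ∑ x ∈ S, (s₂ - s₁) *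
              ∫ g, ((matrixSeries A g ^ (2 * m)) x x).re ∂(stdGaussian ι) := by
        rw [← Finset.sum_add_distrib]
        refine Finset.sum_le_sum fun x _ => ?_
        rw [← add_mul, add_sub_cancel]
        exact mul_le_mul_of_nonneg_right (hs x) (h.integral_re_pow_nonneg m x)
      have e2 : ∑ x with x ∉ S, w x * ∫ g, ((matrixSeries A g ^ (2 * m)) x x).re ∂(stdGaussian ι)
          ≤ ∑ x with x ∉ S, s₁ * ∫ g, ((matrixSeries A g ^ (2 * m)) x x).re ∂(stdGaussian ι) :=
        Finset.sum_le_sum fun x hx => mul_le_mul_of_nonneg_right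
          (hs1 x (Finset.mem_filter.1 hx).2) (h.integral_re_pow_nonneg m x)
      rw [hf]
      linarith
    have h2 := h.sum_integral_re_pow_le hs (h0.trans_le h12) hβ hS m
    have h3 : (s₂ - s₁) * ∑ x ∈ S, ∫ g, ((matrixSeries A g ^ (2 * m)) x x).re ∂(stdGaussian ι)
        ≤ s₁ * (oddFactorial m * ((4 * s₁) ^ m * (Fintype.card X / β))) := by
      refine (mul_le_mul_of_nonneg_left h2 (by linarith)).trans ?_
      have : (2 * s₂) ^ m ≤ (4 * s₁) ^ m := pow_le_pow_left₀ (by linarith) (by linarith) _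
      exact mul_le_mul (by linarith) (mul_le_mul_of_nonneg_left
        (mul_le_mul_of_nonneg_right this (by positivity)) hd.le)
        (mul_nonneg hd.le (mul_nonneg (pow_nonneg (by linarith) _) (by positivity))) h0.le
    have h4 := mul_le_mul_of_nonneg_left ih h0.le
    have h5 : (m : ℝ) * 4 ^ m + 4 ^ m ≤ (m + 1) * 4 ^ (m + 1) := by
      have : (0 : ℝ) < 4 ^ m := by positivity
      have hm : (0 : ℝ) ≤ m := Nat.cast_nonneg m
      rw [pow_succ]
      nlinarith
    calc traceMoment A (m + 1) ≤ _ := integral_trace_pow_le h.isHermitian h.bound m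
      _ ≤ (2 * m + 1) * (s₁ * (oddFactorial m * (s₁ ^ m * (Fintype.card X * (1 + m * 4 ^ m / β))))
          + s₁ * (oddFactorial m * ((4 * s₁) ^ m * (Fintype.card X / β)))) :=
        mul_le_mul_of_nonneg_left (by linarith) (by positivity)
      _ = oddFactorial (m + 1) * (s₁ ^ (m + 1) *
          (Fintype.card X * (1 + (m * 4 ^ m + 4 ^ m) / β))) := by
        rw [oddFactorial_succ, mul_pow]
        ring
      _ ≤ _ := by
        push_cast
        have := oddFactorial_pos (m + 1)
        gcongr

theorem measure_trace_pow_ge (h : DiagonallyBounded A w) {B : ℝ} (hB : 0 < B) (q : ℕ) :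
    (stdGaussian ι) {g | B ^ (2 * q) ≤ (matrixSeries A g ^ (2 * q)).trace.re}
      ≤ ENNReal.ofReal (traceMoment A q / B ^ (2 * q)) := by
  have h1 := mul_meas_ge_le_integral_of_nonneg (μ := stdGaussian ι)
    (f := fun g => (matrixSeries A g ^ (2 * q)).trace.re)
    (Eventually.of_forall fun g =>
      re_trace_pow_two_mul_nonneg (isHermitian_matrixSeries h.isHermitian g) q)
    (integrable_re_trace_pow A (2 * q)) (B ^ (2 * q))
  rw [← ofReal_measureReal]
  refine ENNReal.ofReal_le_ofReal ?_
  rw [le_div_iff₀ (by positivity), mul_comm]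
  exact h1

end DiagonallyBounded

end MomentBounds

end SpikedTensor

namespace SpikedTensor

/-! ### The tail bound for Gaussian matrix series -/

section TailBound

open Real

theorem factorial_le_stirling {q : ℕ} (hq : q ≠ 0) :
    (q.factorial : ℝ) ≤ exp 1 * sqrt q * (q / exp 1) ^ q := by
  obtain ⟨m, rfl⟩ := Nat.exists_eq_succ_of_ne_zero hq
  have h := Stirling.stirlingSeq'_antitone (Nat.zero_le m)
  simp only [Function.comp_apply, Nat.succ_eq_add_one, zero_add, Stirling.stirlingSeq_one] at h
  rw [Stirling.stirlingSeq, div_le_div_iff₀ (by positivity) (by positivity)] at h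
  have h2 : sqrt (2 * (m + 1 : ℕ)) = sqrt 2 * sqrt (m + 1 : ℕ) := by
    rw [Real.sqrt_mul (by norm_num)]
  rw [h2] at h
  have hs : 0 < sqrt 2 := by positivity
  refine le_of_mul_le_mul_right ?_ hs
  calc _ ≤ _ := h
    _ = _ := by rw [Nat.succ_eq_add_one]; ring

/-- The bound for the probability that a Gaussian matrix series is large; `L` is the logarithm of
the dimension. -/
def tailBound (L : ℝ) : ℝ := 2 * exp 4 * sqrt (L + 1) * exp (-(L / 4000))

theorem tendsto_tailBound : Tendsto tailBound atTop (𝓝 0) := by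
  have h1 : Tendsto (fun L : ℝ => (L + 1) * exp (-(1 / 4000) * L)) atTop (𝓝 0) := by
    have a := (isLittleO_pow_exp_pos_mul_atTop 1 (b := 1 / 4000) (by norm_num)).tendsto_div_nhds_zero
    have b := (isLittleO_pow_exp_pos_mul_atTop 0 (b := 1 / 4000) (by norm_num)).tendsto_div_nhds_zero
    have c := a.add b
    rw [add_zero] at c
    refine c.congr fun L => ?_
    rw [pow_one, pow_zero, ← add_div, neg_mul, exp_neg, div_eq_mul_inv]
  have h2 := h1.const_mul (2 * exp 4)
  rw [mul_zero] at h2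
  refine squeeze_zero' (Eventually.of_forall fun L => by unfold tailBound; positivity) ?_ h2
  filter_upwards [eventually_ge_atTop 0] with L hL
  rw [tailBound, mul_assoc, show -(L / 4000) = -(1 / 4000) * L by ring]
  have : sqrt (L + 1) ≤ L + 1 := by
    rw [Real.sqrt_le_left (by linarith)]
    nlinarith
  gcongr

/-- By Stirling, (2q-1)!! is about (2L/e)^q, and at q = ⌈L⌉ the factor e^{-q} cancels the dimension
e^L. The m factors 7/8 gain e^{-L/768} up to a constant. The lowered threshold spends e^{-q/1000} of
this, and 1/768 - 1/1000 > 1/4000 leaves the decay. -/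
theorem moment_bound_le_tailBound {L s₂ : ℝ} (hL : 1 ≤ L) (hs : 0 < s₂) {m q : ℕ}
    (hm : m = ⌊L / 96⌋₊) (hq : q = ⌈L⌉₊) :
    oddFactorial q * (s₂ ^ (q - m) * ((7 / 8 * s₂) ^ m * (exp L * 2)))
      / sqrt (2 * s₂ * L * exp (-(1 / 1000))) ^ (2 * q) ≤ tailBound L := by
  have hqL : L ≤ q := hq ▸ Nat.le_ceil L
  have hqL' : (q : ℝ) ≤ L + 1 := hq ▸ (Nat.ceil_lt_add_one (by linarith)).le
  have hmL : L / 96 - 1 ≤ m := by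
    have := Nat.lt_floor_add_one (L / 96)
    rw [hm]
    linarith
  have hmL' : (m : ℝ) ≤ L / 96 := hm ▸ Nat.floor_le (by positivity)
  have hmq : m ≤ q := by
    have : (m : ℝ) ≤ q := by linarith
    exact_mod_cast this
  have hq0 : q ≠ 0 := by
    rintro rfl
    norm_num at hqL
    linarith
  have hpow : sqrt (2 * s₂ * L * exp (-(1 / 1000))) ^ (2 * q)
      = 2 ^ q * s₂ ^ q * L ^ q * exp (-(q / 1000)) := by
    rw [pow_mul, Real.sq_sqrt (by positivity), mul_pow, mul_pow, mul_pow, ← Real.exp_nat_mul]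
    congr 2
    ring
  have hs2 : s₂ ^ (q - m) * ((7 / 8 * s₂) ^ m) = (7 / 8) ^ m * s₂ ^ q := by
    rw [mul_pow, ← Nat.sub_add_cancel hmq, pow_add]
    simp only [Nat.add_sub_cancel]
    ring
  have h78 : ((7 : ℝ) / 8) ^ m ≤ exp (1 / 8 - L / 768) := by
    have : (7 : ℝ) / 8 ≤ exp (-(1 / 8)) := by
      have := Real.add_one_le_exp (-(1 / 8) : ℝ)
      linarith
    calc ((7 : ℝ) / 8) ^ m ≤ exp (-(1 / 8)) ^ m := by gcongr
      _ = exp (m * -(1 / 8)) := by rw [← Real.exp_nat_mul]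
      _ ≤ _ := Real.exp_le_exp.2 (by linarith)
  have hfac : oddFactorial q ≤ 2 ^ q * (exp 1 * sqrt (L + 1) * (L ^ q * exp 2) * exp (-L)) := by
    refine (oddFactorial_le q).trans (mul_le_mul_of_nonneg_left ?_ (by positivity))
    refine (factorial_le_stirling hq0).trans ?_
    have h1 : (q / exp 1) ^ q ≤ L ^ q * exp 2 * exp (-L) := by
      rw [div_pow, ← Real.exp_nat_mul, mul_one, div_eq_mul_inv, ← Real.exp_neg]
      -- Rounding L up to q costs a constant: q ≤ L + 1 ≤ L e^{1/L} and q ≤ 2L.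
      have h2 : (q : ℝ) ^ q ≤ L ^ q * exp 2 := by
        have h3 : (q : ℝ) ≤ L * exp (1 / L) := by
          have := Real.add_one_le_exp (1 / L)
          have h4 : L * (1 / L + 1) ≤ L * exp (1 / L) := by gcongr
          have h5 : L * (1 / L + 1) = 1 + L := by field_simp
          linarith
        calc (q : ℝ) ^ q ≤ (L * exp (1 / L)) ^ q := by gcongr
          _ = L ^ q * exp (q * (1 / L)) := by rw [mul_pow, Real.exp_nat_mul]
          _ ≤ L ^ q * exp 2 := by
            gcongr
            rw [mul_one_div, div_le_iff₀ (by linarith)]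
            linarith
      gcongr
    calc exp 1 * sqrt q * (q / exp 1) ^ q
        ≤ exp 1 * sqrt (L + 1) * (L ^ q * exp 2 * exp (-L)) := by gcongr
      _ = _ := by ring
  rw [hpow, div_le_iff₀ (by positivity)]
  calc oddFactorial q * (s₂ ^ (q - m) * ((7 / 8 * s₂) ^ m * (exp L * 2)))
      = oddFactorial q * ((7 / 8) ^ m * s₂ ^ q * (exp L * 2)) := by rw [← hs2]; ring
    _ ≤ 2 ^ q * (exp 1 * sqrt (L + 1) * (L ^ q * exp 2) * exp (-L)) *
        (exp (1 / 8 - L / 768) * s₂ ^ q * (exp L * 2)) := by gcongr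
    _ = 2 * exp 3 * sqrt (L + 1) * exp (1 / 8 - L / 768) * (2 ^ q * s₂ ^ q * L ^ q) := by
        have : exp 3 = exp 1 * exp 2 * (exp (-L) * exp L) := by
          rw [← Real.exp_add, ← Real.exp_add, ← Real.exp_add]
          norm_num
        rw [this]
        ring
    _ ≤ 2 * exp 4 * sqrt (L + 1) * exp (-(L / 4000)) *
          exp (-(q / 1000)) * (2 ^ q * s₂ ^ q * L ^ q) := by
        have : exp 3 * exp (1 / 8 - L / 768)
            ≤ exp 4 * exp (-(L / 4000)) * exp (-(q / 1000)) := by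
          rw [← Real.exp_add, ← Real.exp_add, ← Real.exp_add]
          exact Real.exp_le_exp.2 (by linarith)
        calc _ = 2 * sqrt (L + 1) * (exp 3 * exp (1 / 8 - L / 768)) * (2 ^ q * s₂ ^ q * L ^ q) := by
              ring
          _ ≤ 2 * sqrt (L + 1) * (exp 4 * exp (-(L / 4000)) * exp (-(q / 1000)))
              * (2 ^ q * s₂ ^ q * L ^ q) := by gcongr
          _ = _ := by ring
    _ = _ := by rw [tailBound]; ring

variable {ι X : Type*} [Fintype ι] [Fintype X] [DecidableEq X]

/-- Two regimes: up to the moment ⌊L/96⌋ the set S is negligible and the recursion runs with 7/8 s₂;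
from there to ⌈L⌉ it runs with s₂. Markov's inequality concludes. -/
theorem DiagonallyBounded.measure_trace_pow_ge_le_tailBound {A : ι → Matrix X X ℂ} {w : X → ℝ}
    {s₂ L : ℝ} (h : DiagonallyBounded A w) (hs : ∀ x, w x ≤ s₂) {S : Finset X}
    (hs1 : ∀ x ∉ S, w x ≤ 7 / 8 * s₂) (h0 : 0 < s₂) (hL : 1 ≤ L) (hX : (Fintype.card X : ℝ) = exp L)
    (hS : (S.card : ℝ) ≤ exp (L - L / 16)) :
    (stdGaussian ι) {g | sqrt (2 * s₂ * L * exp (-(1 / 1000))) ^ (2 * ⌈L⌉₊)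
        ≤ (matrixSeries A g ^ (2 * ⌈L⌉₊)).trace.re} ≤ ENNReal.ofReal (tailBound L) := by
  refine (h.measure_trace_pow_ge (by positivity) _).trans (ENNReal.ofReal_le_ofReal ?_)
  refine le_trans ?_ (moment_bound_le_tailBound hL h0 rfl rfl)
  refine div_le_div_of_nonneg_right ?_ (by positivity)
  set m := ⌊L / 96⌋₊ with hm
  have hmL' : (m : ℝ) ≤ L / 96 := Nat.floor_le (by positivity)
  have hmq : m ≤ ⌈L⌉₊ := by
    have : (m : ℝ) ≤ ⌈L⌉₊ := by
      have := Nat.le_ceil L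
      linarith
    exact_mod_cast this
  have h1 : traceMoment A m ≤ oddFactorial m * ((7 / 8 * s₂) ^ m * (exp L * 2)) := by
    -- This β is the largest with |S| β² ≤ |X| under the assumed bound on |S|. The range m ≤ L/96 is
    -- what makes m 4^m ≤ 8^m ≤ e^{3m} ≤ β.
    have h2 := h.traceMoment_le_of_card_le (β := exp (L / 32)) hs hs1 (by positivity) (by linarith)
      (by linarith) (exp_pos _) (by
        rw [hX, ← Real.exp_nat_mul]
        calc (S.card : ℝ) * exp ((2 : ℕ) * (L / 32))
            ≤ exp (L - L / 16) * exp ((2 : ℕ) * (L / 32)) := by gcongr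
          _ = exp L := by
            rw [← Real.exp_add]
            congr 1
            push_cast
            ring) m
    refine h2.trans ?_
    rw [hX]
    have h3 : (m : ℝ) * 4 ^ m / exp (L / 32) ≤ 1 := by
      rw [div_le_one (exp_pos _)]
      have h4 : (m : ℝ) ≤ 2 ^ m := by exact_mod_cast (Nat.lt_two_pow_self (n := m)).le
      calc (m : ℝ) * 4 ^ m ≤ 2 ^ m * 4 ^ m := by gcongr
        _ = 8 ^ m := by rw [← mul_pow]; norm_num
        _ ≤ exp 3 ^ m := by
          gcongr
          have h5 : (2 : ℝ) ≤ exp 1 := by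
            have := Real.add_one_le_exp (1 : ℝ)
            linarith
          calc (8 : ℝ) = 2 ^ 3 := by norm_num
            _ ≤ exp 1 ^ 3 := by gcongr
            _ = exp 3 := by rw [← Real.exp_nat_mul]; norm_num
        _ = exp (m * 3) := by rw [Real.exp_nat_mul]
        _ ≤ _ := Real.exp_le_exp.2 (by linarith)
    have := oddFactorial_pos m
    gcongr
    linarith
  have h6 := h.traceMoment_add_le hs h0.le h1 (⌈L⌉₊ - m)
  rwa [Nat.add_sub_cancel' hmq] at h6

theorem DiagonallyBounded.measure_exists_trace_mul_le_tailBound {A : ι → Matrix X X ℂ} {w : X → ℝ}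
    {s₂ L : ℝ} (h : DiagonallyBounded A w) (hs : ∀ x, w x ≤ s₂) {S : Finset X}
    (hs1 : ∀ x ∉ S, w x ≤ 7 / 8 * s₂) (h0 : 0 < s₂) (hL : 1 ≤ L) (hX : (Fintype.card X : ℝ) = exp L)
    (hS : (S.card : ℝ) ≤ exp (L - L / 16)) :
    (stdGaussian ι) {g | ∃ σ : Matrix X X ℂ, σ.PosSemidef ∧ σ.trace = 1 ∧
        sqrt (2 * s₂ * L * exp (-(1 / 1000))) < (σ * matrixSeries A g).trace.re}
      ≤ ENNReal.ofReal (tailBound L) := by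
  refine le_trans (measure_mono ?_) (h.measure_trace_pow_ge_le_tailBound hs hs1 h0 hL hX hS)
  rintro g ⟨σ, hσ, hσ1, hlt⟩
  by_contra hg
  simp only [Set.mem_ofPred_eq, not_le] at hg
  refine absurd hlt (not_lt.2 ?_)
  have hq : ⌈L⌉₊ ≠ 0 := (Nat.ceil_pos.2 (by linarith)).ne'
  exact trace_mul_le_of_trace_pow_le (isHermitian_matrixSeries h.isHermitian g) hσ hσ1
    (Real.sqrt_nonneg _) hq hg.le

end TailBound

end SpikedTensor

namespace SpikedTensor

/-! ### Coincidences and weights -/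

section Weights

variable {N n k : ℕ}

/-- The number of coordinates of `x` that are equal to `a`. -/
def multiplicity (x : Fin n → Fin N) (a : Fin N) : ℕ := (Finset.univ.filter fun s => x s = a).card

theorem sum_multiplicity (x : Fin n → Fin N) : ∑ a, multiplicity x a = n := by
  have := Finset.card_eq_sum_card_fiberwise (f := x) (s := Finset.univ) (t := Finset.univ)
    (fun _ _ => Finset.mem_coe.2 (Finset.mem_univ _))
  simpa [multiplicity] using this.symm

/-- The sequence `(m-1)!!`. -/
def pairingNumber : ℕ → ℕ
  | 0 => 1
  | 1 => 1
  | m + 2 => (m + 1) * pairingNumber m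

theorem pairingNumber_pos : ∀ m, 0 < pairingNumber m
  | 0 => one_pos
  | 1 => one_pos
  | m + 2 => Nat.mul_pos (Nat.succ_pos _) (pairingNumber_pos m)

/-- The weight `∏ₐ (mₐ-1)!!`, where `mₐ` is the multiplicity of `a`. -/
def pairingWeight (x : Fin n → Fin N) : ℝ := ∏ a, (pairingNumber (multiplicity x a) : ℝ)

theorem pairingWeight_pos (x : Fin n → Fin N) : 0 < pairingWeight x :=
  Finset.prod_pos fun _ _ => Nat.cast_pos.2 (pairingNumber_pos _)

/-- `z` arises from `x` by a simultaneous change of the equal coordinates `s` and `t`. -/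
def PairMove (s t : Fin n) (x z : Fin n → Fin N) : Prop :=
  x s = x t ∧ z s = z t ∧ ∀ r, r ≠ s → r ≠ t → x r = z r

theorem PairMove.symm {s t : Fin n} {x z : Fin n → Fin N} (h : PairMove s t x z) :
    PairMove s t z x := ⟨h.2.1, h.1, fun r hs ht => (h.2.2 r hs ht).symm⟩

theorem PairMove.multiplicity_eq {s t : Fin n} {x z : Fin n → Fin N} (hst : s ≠ t)
    (h : PairMove s t x z) (hne : x s ≠ z s) :
    multiplicity x (x s) = multiplicity z (x s) + 2 := by
  have h1 : (Finset.univ.filter fun r => x r = x s)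
      = insert s (insert t (Finset.univ.filter fun r => z r = x s)) := by
    ext r
    simp only [Finset.mem_filter, Finset.mem_univ, true_and, Finset.mem_insert]
    by_cases hrs : r = s
    · simp [hrs]
    by_cases hrt : r = t
    · simp [hrt, h.1]
    · simp [hrs, hrt, h.2.2 r hrs hrt]
  rw [multiplicity, h1, Finset.card_insert_of_notMem, Finset.card_insert_of_notMem, multiplicity]
  · simp [← h.2.1, Ne.symm hne]
  · simp [hst, Ne.symm hne]

theorem PairMove.multiplicity_eq_of_ne {s t : Fin n} {x z : Fin n → Fin N}
    (h : PairMove s t x z) {a : Fin N} (hx : a ≠ x s) (hz : a ≠ z s) :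
    multiplicity x a = multiplicity z a := by
  unfold multiplicity
  congr 1
  ext r
  simp only [Finset.mem_filter, Finset.mem_univ, true_and]
  by_cases hrs : r = s
  · simp [hrs, hx.symm, hz.symm]
  by_cases hrt : r = t
  · simp [hrt, ← h.1, ← h.2.1, hx.symm, hz.symm]
  · rw [h.2.2 r hrs hrt]

/-- A move between values of multiplicities m and l turns (m-1)!! (l-1)!! into (m-3)!! (l+1)!!, so
the weight changes by the ratio (l+1)/(m-1) and equality holds. Only the trivial move x = z is
strict. -/
theorem PairMove.pairingWeight_le {s t : Fin n} {x z : Fin n → Fin N} (hst : s ≠ t)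
    (h : PairMove s t x z) :
    ((multiplicity x (x s) : ℝ) - 1) * pairingWeight z
      ≤ (multiplicity x (z s) + 1) * pairingWeight x := by
  by_cases hne : x s = z s
  · have hxz : x = z := by
      funext r
      by_cases hrs : r = s
      · rw [hrs, hne]
      by_cases hrt : r = t
      · rw [hrt, ← h.1, ← h.2.1, hne]
      · exact h.2.2 r hrs hrt
    rw [← hxz]
    have := pairingWeight_pos x
    nlinarith
  · have h1 := h.multiplicity_eq hst hne
    have h2 := h.symm.multiplicity_eq hst (Ne.symm hne)
    have hmem : x s ∈ Finset.univ.erase (z s) := Finset.mem_erase.2 ⟨hne, Finset.mem_univ _⟩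
    rw [pairingWeight, pairingWeight, ← Finset.mul_prod_erase _ _ (Finset.mem_univ (z s)),
      ← Finset.mul_prod_erase _ _ hmem,
      ← Finset.mul_prod_erase _ (fun a => (pairingNumber (multiplicity x a) : ℝ))
        (Finset.mem_univ (z s)),
      ← Finset.mul_prod_erase _ (fun a => (pairingNumber (multiplicity x a) : ℝ)) hmem]
    have h3 : ∏ a ∈ (Finset.univ.erase (z s)).erase (x s), (pairingNumber (multiplicity x a) : ℝ)
        = ∏ a ∈ (Finset.univ.erase (z s)).erase (x s), (pairingNumber (multiplicity z a) : ℝ) := by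
      refine Finset.prod_congr rfl fun a ha => ?_
      rw [Finset.mem_erase, Finset.mem_erase] at ha
      rw [h.multiplicity_eq_of_ne ha.1 ha.2.1]
    rw [h1, h2, h3, pairingNumber, pairingNumber]
    push_cast
    exact le_of_eq (by ring)

/-- The coordinate `s` of `x` is equal to another coordinate. -/
def Coincides (x : Fin n → Fin N) (s : Fin n) : Prop := ∃ t, t ≠ s ∧ x t = x s

open Classical in
-- The site s has m - 1 partners, where m is the multiplicity of its value. This number cancels the
-- denominator in the ratio of weights. Summing l + 1 over all new values gives N + n; unweighted,
-- the sum would grow like (m-1)N. Without a partner there is no move.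
theorem sum_pairMove_le (x : Fin n → Fin N) (s : Fin n) :
    ∑ t ∈ Finset.univ.erase s, ∑ z : Fin n → Fin N,
        (if PairMove s t x z then pairingWeight z else 0)
      ≤ ((N : ℝ) + n) * (if Coincides x s then pairingWeight x else 0) := by
  set m := multiplicity x (x s) with hm
  set T := (Finset.univ.erase s).filter fun t => x t = x s with hT
  have hTm : (T.card : ℝ) = m - 1 := by
    have : (Finset.univ.filter fun r => x r = x s) = insert s T := by
      ext r
      by_cases hr : r = s <;> simp [hT, hr]
    rw [hm, multiplicity, this, Finset.card_insert_of_notMem (by simp [hT])]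
    simp
  have hzero (t : Fin n) (ht : t ∉ T) (hts : t ∈ Finset.univ.erase s) :
      ∑ z : Fin n → Fin N, (if PairMove s t x z then pairingWeight z else 0) = 0 := by
    refine Finset.sum_eq_zero fun z _ => if_neg fun h => ht ?_
    exact Finset.mem_filter.2 ⟨hts, h.1.symm⟩
  have hle (t : Fin n) (ht : t ∈ T) : ((m : ℝ) - 1) *
      ∑ z : Fin n → Fin N, (if PairMove s t x z then pairingWeight z else 0)
        ≤ ((N : ℝ) + n) * pairingWeight x := by
    have hst : s ≠ t := (Finset.ne_of_mem_erase (Finset.mem_filter.1 ht).1).symm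
    rw [← Finset.sum_filter, Finset.mul_sum]
    calc ∑ z with PairMove s t x z, ((m : ℝ) - 1) * pairingWeight z
        ≤ ∑ z with PairMove s t x z, (multiplicity x (z s) + 1 : ℝ) * pairingWeight x :=
          Finset.sum_le_sum fun z hz => (Finset.mem_filter.1 hz).2.pairingWeight_le hst
      _ = ∑ a ∈ (Finset.univ.filter fun z => PairMove s t x z).image fun z => z s,
            (multiplicity x a + 1 : ℝ) * pairingWeight x := by
          rw [Finset.sum_image]
          intro z hz z' hz' hzz
          have h1 := (Finset.mem_filter.1 hz).2
          have h2 := (Finset.mem_filter.1 hz').2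
          funext r
          by_cases hrs : r = s
          · rw [hrs]; exact hzz
          by_cases hrt : r = t
          · rw [hrt, ← h1.2.1, ← h2.2.1]; exact hzz
          · rw [← h1.2.2 r hrs hrt, ← h2.2.2 r hrs hrt]
      _ ≤ ∑ a, (multiplicity x a + 1 : ℝ) * pairingWeight x :=
          Finset.sum_le_univ_sum_of_nonneg fun a =>
            mul_nonneg (by positivity) (pairingWeight_pos x).le
      _ = _ := by
          rw [← Finset.sum_mul, Finset.sum_add_distrib, ← Nat.cast_sum, sum_multiplicity]
          simp only [Finset.sum_const, Finset.card_univ, Fintype.card_fin, nsmul_eq_mul, mul_one]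
          rw [add_comm]
  have hrest : ∑ t ∈ (Finset.univ.erase s).filter (fun t => ¬ x t = x s), ∑ z : Fin n → Fin N,
      (if PairMove s t x z then pairingWeight z else 0) = 0 :=
    Finset.sum_eq_zero fun t ht => hzero t
      (fun h => (Finset.mem_filter.1 ht).2 (Finset.mem_filter.1 h).2) (Finset.mem_filter.1 ht).1
  rw [← Finset.sum_filter_add_sum_filter_not _ (fun t => x t = x s), ← hT, hrest, add_zero]
  by_cases hne : T.Nonempty
  · have hco : Coincides x s := by
      obtain ⟨t, ht⟩ := hne
      exact ⟨t, Finset.ne_of_mem_erase (Finset.mem_filter.1 ht).1, (Finset.mem_filter.1 ht).2⟩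
    have hpos : (0 : ℝ) < m - 1 := by
      rw [← hTm]
      exact_mod_cast hne.card_pos
    rw [if_pos hco]
    refine le_of_mul_le_mul_left ?_ hpos
    rw [Finset.mul_sum]
    refine (Finset.sum_le_sum hle).trans (le_of_eq ?_)
    rw [Finset.sum_const, nsmul_eq_mul, hTm]
  · rw [Finset.not_nonempty_iff_eq_empty.1 hne, Finset.sum_empty]
    have := pairingWeight_pos x
    split_ifs <;> positivity

/-- `y` arises from `x` by simultaneous changes of the pairs of equal coordinates `(i a, j a)`. -/
def PairMoves (i j : Fin k → Fin n) (x y : Fin n → Fin N) : Prop :=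
  (∀ a, x (i a) = x (j a)) ∧ (∀ a, y (i a) = y (j a)) ∧
    ∀ r, (∀ a, r ≠ i a) → (∀ a, r ≠ j a) → x r = y r

/-- The sites `i a` and `j a` are pairwise distinct. -/
def PairwiseDistinct (i j : Fin k → Fin n) : Prop :=
  Function.Injective i ∧ Function.Injective j ∧ ∀ a b, i a ≠ j b

/-- The intermediate configuration changes the first pair only; distinctness of the sites keeps the
other pairs untouched. -/
theorem PairMoves.exists_pairMove {i j : Fin (k + 1) → Fin n} {x y : Fin n → Fin N}
    (hd : PairwiseDistinct i j) (h : PairMoves i j x y) :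
    ∃ z, PairMove (i 0) (j 0) x z ∧ PairMoves (Fin.tail i) (Fin.tail j) z y := by
  refine ⟨fun r => if r = i 0 ∨ r = j 0 then y (i 0) else x r, ⟨h.1 0, by simp, ?_⟩, ?_, ?_, ?_⟩
  · intro r hs ht
    simp [hs, ht]
  · intro a
    have h1 : i a.succ ≠ i 0 := hd.1.ne (Fin.succ_ne_zero a)
    have h2 : j a.succ ≠ j 0 := hd.2.1.ne (Fin.succ_ne_zero a)
    simp [Fin.tail, h1, h2, hd.2.2, (hd.2.2 0 a.succ).symm, h.1]
  · intro a
    exact h.2.1 a.succ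
  · intro r hr hr'
    by_cases hri : r = i 0
    · simp [hri]
    by_cases hrj : r = j 0
    · simp [hrj, h.2.1 0]
    · simp only [hri, hrj, or_self, if_false]
      refine h.2.2 r (fun a => ?_) (fun a => ?_)
      · refine Fin.cases hri (fun a => hr a) a
      · refine Fin.cases hrj (fun a => hr' a) a

open Classical in
/-- The sum of the weights of all configurations reached from `x` by a change of the coordinates `i`
and of partners of them. -/
def pairMovesSum (i : Fin k → Fin n) (x : Fin n → Fin N) : ℝ :=
  ∑ j : Fin k → Fin n, if PairwiseDistinct i j then
    ∑ y : Fin n → Fin N, (if PairMoves i j x y then pairingWeight y else 0) else 0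

open Classical in
-- The first pair is moved first and the others afterwards. The right side drops the condition that
-- the partners t and j' avoid each other's pairs, which only adds nonnegative terms.
theorem pairMovesSum_succ_le (i : Fin (k + 1) → Fin n) (x : Fin n → Fin N) :
    pairMovesSum i x ≤ ∑ t ∈ Finset.univ.erase (i 0), ∑ z : Fin n → Fin N,
      (if PairMove (i 0) t x z then pairMovesSum (Fin.tail i) z else 0) := by
  have hw (y : Fin n → Fin N) := (pairingWeight_pos y).le
  have hR : ∑ t ∈ Finset.univ.erase (i 0), ∑ z : Fin n → Fin N,
      (if PairMove (i 0) t x z then pairMovesSum (Fin.tail i) z else 0)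
      = ∑ t, ∑ j' : Fin k → Fin n, if t ≠ i 0 ∧ PairwiseDistinct (Fin.tail i) j' then
        ∑ z : Fin n → Fin N, ∑ y : Fin n → Fin N, (if PairMove (i 0) t x z ∧
          PairMoves (Fin.tail i) j' z y then pairingWeight y else 0) else 0 := by
    rw [← Finset.sum_subset (Finset.subset_univ (Finset.univ.erase (i 0)))]
    · refine Finset.sum_congr rfl fun t ht => ?_
      have ht' := Finset.ne_of_mem_erase ht
      simp only [ne_eq, ht', not_false_eq_true, true_and, pairMovesSum]
      have : ∀ z : Fin n → Fin N, (if PairMove (i 0) t x z then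
          ∑ j : Fin k → Fin n, if PairwiseDistinct (Fin.tail i) j then
            ∑ y : Fin n → Fin N, (if PairMoves (Fin.tail i) j z y then pairingWeight y else 0)
            else 0 else 0)
          = ∑ j : Fin k → Fin n, if PairwiseDistinct (Fin.tail i) j then
            ∑ y : Fin n → Fin N, (if PairMove (i 0) t x z ∧ PairMoves (Fin.tail i) j z y then
              pairingWeight y else 0) else 0 := by
        intro z
        by_cases hz : PairMove (i 0) t x z <;> simp [hz]
      simp only [this]
      rw [Finset.sum_comm]
      refine Finset.sum_congr rfl fun j _ => ?_
      split_ifs <;> simp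
    · intro t _ ht
      have : t = i 0 := by simpa using ht
      simp [this]
  rw [hR, pairMovesSum, ← (Fin.consEquiv fun _ : Fin (k + 1) => Fin n).sum_comp,
    Fintype.sum_prod_type]
  refine Finset.sum_le_sum fun t _ => Finset.sum_le_sum fun j' _ => ?_
  rw [show (Fin.consEquiv fun _ : Fin (k + 1) => Fin n) (t, j') = Fin.cons t j' from rfl]
  by_cases hd : PairwiseDistinct i (Fin.cons t j' : Fin (k + 1) → Fin n)
  · have hd' : t ≠ i 0 ∧ PairwiseDistinct (Fin.tail i) j' := by
      refine ⟨fun h => hd.2.2 0 0 (by simpa using h.symm), ?_, ?_, ?_⟩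
      · exact fun a b hab => Fin.succ_injective _ (hd.1 hab)
      · exact fun a b hab => Fin.succ_injective _ (hd.2.1 (by simpa using hab))
      · intro a b
        have := hd.2.2 a.succ b.succ
        simpa [Fin.tail] using this
    rw [if_pos hd, if_pos hd', Finset.sum_comm]
    refine Finset.sum_le_sum fun y _ => ?_
    split_ifs with hxy
    · obtain ⟨z, hz⟩ := hxy.exists_pairMove hd
      refine le_trans (le_of_eq ?_) (Finset.single_le_sum
        (f := fun z => if PairMove (i 0) t x z ∧ PairMoves (Fin.tail i) j' z y then
          pairingWeight y else 0) (fun z _ => by split_ifs <;> simp [hw]) (Finset.mem_univ z))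
      simp only [Fin.cons_zero, Fin.tail_cons] at hz
      rw [if_pos hz]
    · exact Finset.sum_nonneg fun z _ => by split_ifs <;> simp [hw]
  · rw [if_neg hd]
    split_ifs
    · exact Finset.sum_nonneg fun z _ => Finset.sum_nonneg fun y _ => by split_ifs <;> simp [hw]
    · exact le_rfl

open Classical in
theorem pairMovesSum_succ_le' (i : Fin (k + 1) → Fin n) (x : Fin n → Fin N) {c : ℝ} (hc : 0 ≤ c)
    (h : ∀ z : Fin n → Fin N, pairMovesSum (Fin.tail i) z ≤ c * pairingWeight z) :
    pairMovesSum i x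
      ≤ c * (((N : ℝ) + n) * if Coincides x (i 0) then pairingWeight x else 0) := by
  refine (pairMovesSum_succ_le i x).trans ?_
  refine le_trans ?_ (mul_le_mul_of_nonneg_left (sum_pairMove_le x (i 0)) hc)
  rw [Finset.mul_sum]
  refine Finset.sum_le_sum fun t _ => ?_
  rw [Finset.mul_sum]
  refine Finset.sum_le_sum fun z _ => ?_
  split_ifs
  · exact h z
  · simp

theorem pairMovesSum_le (i : Fin k → Fin n) (x : Fin n → Fin N) :
    pairMovesSum i x ≤ ((N : ℝ) + n) ^ k * pairingWeight x := by
  classical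
  induction k generalizing x with
  | zero =>
    rw [pairMovesSum, Fintype.sum_unique, if_pos ⟨fun a => a.elim0, fun a => a.elim0,
      fun a => a.elim0⟩, pow_zero, one_mul]
    have (y : Fin n → Fin N) : PairMoves i default x y ↔ x = y := by
      refine ⟨fun h => funext fun r => h.2.2 r (fun a => a.elim0) (fun a => a.elim0), ?_⟩
      rintro rfl
      exact ⟨fun a => a.elim0, fun a => a.elim0, fun _ _ _ => rfl⟩
    simp [this]
  | succ k ih =>
    refine (pairMovesSum_succ_le' i x (by positivity) (ih (Fin.tail i))).trans ?_
    rw [pow_succ, mul_assoc]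
    have := pairingWeight_pos x
    gcongr
    split_ifs <;> linarith

open Classical in
-- The indicator of coincidence is kept for the first site only. Averaging over embeddings later
-- turns this single indicator into the fraction of coinciding coordinates.
theorem pairMovesSum_le_of_coincides (i : Fin (k + 1) → Fin n) (x : Fin n → Fin N) :
    pairMovesSum i x
      ≤ ((N : ℝ) + n) ^ (k + 1) * if Coincides x (i 0) then pairingWeight x else 0 := by
  refine (pairMovesSum_succ_le' i x (by positivity) (pairMovesSum_le (Fin.tail i))).trans ?_
  rw [pow_succ, mul_assoc]

end Weights

end SpikedTensor

namespace SpikedTensor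

/-! ### The second moment of the Hamiltonian -/

section SecondMoment

variable {N n k : ℕ}

theorem sum_ite_le_of_unique {α : Type*} [Fintype α] {P : α → Prop} [DecidablePred P] {Q : Prop}
    [Decidable Q]
    (hP : ∀ a b, P a → P b → a = b) (hQ : ∀ a, P a → Q) :
    ∑ a, (if P a then (1 : ℝ) else 0) ≤ if Q then 1 else 0 := by
  rw [← Finset.sum_filter, Finset.sum_const, nsmul_one]
  have h1 : (Finset.univ.filter P).card ≤ 1 := Finset.card_le_one.2 fun a ha b hb =>
    hP a b (Finset.mem_filter.1 ha).2 (Finset.mem_filter.1 hb).2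
  by_cases h : (Finset.univ.filter P).Nonempty
  · obtain ⟨a, ha⟩ := h
    rw [if_pos (hQ a (Finset.mem_filter.1 ha).2)]
    exact_mod_cast h1
  · rw [Finset.not_nonempty_iff_eq_empty.1 h]
    split_ifs <;> simp

/-- The operator `|μ⟩_i⟨ν|` has a nonzero matrix entry at `(x, y)`. -/
def IsTransition (i : Fin k ↪ Fin n) (μ ν : Fin k → Fin N) (x y : Fin n → Fin N) : Prop :=
  (∀ a, x (i a) = μ a) ∧ (∀ a, y (i a) = ν a) ∧ ∀ r, r ∉ Set.range i → x r = y r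

open Classical in
/-- The real matrix of the operator `|μ⟩_i⟨ν|`. -/
def transition (i : Fin k ↪ Fin n) (μ ν : Fin k → Fin N) :
    Matrix (Fin n → Fin N) (Fin n → Fin N) ℝ :=
  fun x y => if IsTransition i μ ν x y then 1 else 0

theorem transitionOp_eq_map (i : Fin k ↪ Fin n) (μ ν : Fin k → Fin N) :
    transitionOp i μ ν = (transition i μ ν).map Complex.ofReal := by
  ext x y
  simp only [transitionOp, Matrix.map_apply, transition, apply_ite Complex.ofReal,
    Complex.ofReal_one, Complex.ofReal_zero]
  by_cases h : IsTransition i μ ν x y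
  · exact (if_pos h).trans (if_pos h).symm
  · exact (if_neg h).trans (if_neg h).symm

theorem transition_nonneg (i : Fin k ↪ Fin n) (μ ν : Fin k → Fin N) (x y : Fin n → Fin N) :
    0 ≤ transition i μ ν x y := by
  unfold transition
  split_ifs <;> simp

theorem transition_comm (i : Fin k ↪ Fin n) (μ ν : Fin k → Fin N) (x y : Fin n → Fin N) :
    transition i μ ν x y = transition i ν μ y x := by
  unfold transition IsTransition
  congr 1
  refine propext ⟨fun h => ⟨h.2.1, h.1, fun r hr => (h.2.2 r hr).symm⟩,
    fun h => ⟨h.2.1, h.1, fun r hr => (h.2.2 r hr).symm⟩⟩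

theorem transpose_transition (i : Fin k ↪ Fin n) (μ ν : Fin k → Fin N) :
    (transition i μ ν).transpose = transition i ν μ := by
  ext x y
  exact transition_comm i μ ν y x

open Classical in
theorem sum_transition_le (i : Fin k ↪ Fin n) (μ ν : Fin k → Fin N) (x : Fin n → Fin N) :
    ∑ y, transition i μ ν x y ≤ if ∀ a, x (i a) = μ a then 1 else 0 := by
  refine sum_ite_le_of_unique (P := IsTransition i μ ν x)
    (fun y z hy hz => funext fun r => ?_) fun y hy => hy.1
  by_cases hr : r ∈ Set.range i
  · obtain ⟨a, rfl⟩ := hr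
    rw [hy.2.1, hz.2.1]
  · rw [← hy.2.2 r hr, ← hz.2.2 r hr]

/-- The sum over `μ` and `ν` of `|μ⟩_i⟨ν| |μ'⟩_j⟨ν'|`, with `(μ', ν')` a function of `(μ, ν)`. -/
def transitionKernel (u v : (Fin k → Fin N) → (Fin k → Fin N) → Fin k → Fin N)
    (i j : Fin k ↪ Fin n) : Matrix (Fin n → Fin N) (Fin n → Fin N) ℝ :=
  ∑ μ, ∑ ν, transition i μ ν * transition j (u μ ν) (v μ ν)

theorem transitionKernel_nonneg (u v : (Fin k → Fin N) → (Fin k → Fin N) → Fin k → Fin N)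
    (i j : Fin k ↪ Fin n) (x y : Fin n → Fin N) : 0 ≤ transitionKernel u v i j x y := by
  simp only [transitionKernel, Matrix.sum_apply, Matrix.mul_apply]
  exact Finset.sum_nonneg fun μ _ => Finset.sum_nonneg fun ν _ => Finset.sum_nonneg fun z _ =>
    mul_nonneg (transition_nonneg _ _ _ _ _) (transition_nonneg _ _ _ _ _)

open Classical in
-- The kernel sums over paths x → z → y. The labels are read off from x and z, and then y is
-- determined, so the row sum is at most the number of admissible intermediate z.
theorem sum_transitionKernel_le (u v : (Fin k → Fin N) → (Fin k → Fin N) → Fin k → Fin N)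
    (i j : Fin k ↪ Fin n) (x : Fin n → Fin N) :
    ∑ y, transitionKernel u v i j x y ≤ (Finset.univ.filter fun z : Fin n → Fin N =>
      (∀ r, r ∉ Set.range i → x r = z r) ∧ ∀ a, z (j a) = u (x ∘ i) (z ∘ i) a).card := by
  have e1 : ∑ y, transitionKernel u v i j x y
      = ∑ z, ∑ q : (Fin k → Fin N) × (Fin k → Fin N), transition i q.1 q.2 x z *
        ∑ y, transition j (u q.1 q.2) (v q.1 q.2) z y := by
    simp only [transitionKernel, Matrix.sum_apply, Matrix.mul_apply, Finset.mul_sum,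
      Fintype.sum_prod_type]
    rw [Finset.sum_comm]
    simp only [Finset.sum_comm (s := (Finset.univ : Finset (Fin n → Fin N)))
      (t := (Finset.univ : Finset (Fin k → Fin N)))]
    refine Finset.sum_congr rfl fun μ _ => Finset.sum_congr rfl fun ν _ => ?_
    exact Finset.sum_comm
  rw [e1, Finset.card_filter, Nat.cast_sum]
  refine Finset.sum_le_sum fun z _ => ?_
  calc ∑ q : (Fin k → Fin N) × (Fin k → Fin N), transition i q.1 q.2 x z *
        ∑ y, transition j (u q.1 q.2) (v q.1 q.2) z y
      ≤ ∑ q : (Fin k → Fin N) × (Fin k → Fin N),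
          if IsTransition i q.1 q.2 x z ∧ ∀ a, z (j a) = u q.1 q.2 a then (1 : ℝ) else 0 := by
        refine Finset.sum_le_sum fun q _ => ?_
        refine (mul_le_mul_of_nonneg_left (sum_transition_le _ _ _ _)
          (transition_nonneg _ _ _ _ _)).trans (le_of_eq ?_)
        unfold transition
        split_ifs <;> simp_all
    _ ≤ if (∀ r, r ∉ Set.range i → x r = z r) ∧ ∀ a, z (j a) = u (x ∘ i) (z ∘ i) a
          then (1 : ℝ) else 0 := by
        refine sum_ite_le_of_unique ?_ ?_
        · rintro ⟨μ, ν⟩ ⟨μ', ν'⟩ ⟨h, -⟩ ⟨h', -⟩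
          refine Prod.ext (funext fun a => ?_) (funext fun a => ?_)
          · exact (h.1 a).symm.trans (h'.1 a)
          · exact (h.2.1 a).symm.trans (h'.2.1 a)
        · rintro ⟨μ, ν⟩ ⟨h, h'⟩
          refine ⟨h.2.2, fun a => ?_⟩
          rw [h' a, show x ∘ i = μ from funext h.1, show z ∘ i = ν from funext h.2.1]
    _ = _ := by push_cast; rfl

theorem card_eq_off_range_le (i : Fin k ↪ Fin n) (x : Fin n → Fin N)
    (P : (Fin n → Fin N) → Prop)
    [DecidablePred fun z : Fin n → Fin N => (∀ r, r ∉ Set.range i → x r = z r) ∧ P z] :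
    (Finset.univ.filter fun z : Fin n → Fin N =>
      (∀ r, r ∉ Set.range i → x r = z r) ∧ P z).card ≤ N ^ k := by
  have : Fintype.card (Fin k → Fin N) = N ^ k := by simp
  rw [← this, ← Finset.card_univ]
  refine Finset.card_le_card_of_injOn (fun z => z ∘ i) (fun _ _ => Finset.mem_coe.2
    (Finset.mem_univ _)) fun z hz z' hz' h => funext fun r => ?_
  have h1 := (Finset.mem_filter.1 (Finset.mem_coe.1 hz)).2.1
  have h2 := (Finset.mem_filter.1 (Finset.mem_coe.1 hz')).2.1
  by_cases hr : r ∈ Set.range i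
  · obtain ⟨a, rfl⟩ := hr
    exact congrFun h a
  · rw [← h1 r hr, ← h2 r hr]

/-- One of the k free coordinates is a function of the others, which saves one factor N. -/
theorem card_eq_off_range_le_of_determined (i : Fin k ↪ Fin n) (x : Fin n → Fin N)
    (P : (Fin n → Fin N) → Prop)
    [DecidablePred fun z : Fin n → Fin N => (∀ r, r ∉ Set.range i → x r = z r) ∧ P z] (a : Fin k)
    (h : ∀ z z' : Fin n → Fin N, P z → P z' → (∀ r, r ≠ i a → z r = z' r) → z (i a) = z' (i a)) :
    (Finset.univ.filter fun z : Fin n → Fin N =>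
      (∀ r, r ∉ Set.range i → x r = z r) ∧ P z).card ≤ N ^ (k - 1) := by
  have : Fintype.card ({b : Fin k // b ≠ a} → Fin N) = N ^ (k - 1) := by
    rw [Fintype.card_fun, Fintype.card_fin, Fintype.card_subtype_compl]
    simp
  rw [← this, ← Finset.card_univ]
  refine Finset.card_le_card_of_injOn (fun z b => z (i b)) (fun _ _ => Finset.mem_coe.2
    (Finset.mem_univ _)) fun z hz z' hz' hzz => ?_
  have h1 := (Finset.mem_filter.1 (Finset.mem_coe.1 hz)).2
  have h2 := (Finset.mem_filter.1 (Finset.mem_coe.1 hz')).2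
  have hoff : ∀ r, r ≠ i a → z r = z' r := by
    intro r hra
    by_cases hr : r ∈ Set.range i
    · obtain ⟨b, rfl⟩ := hr
      exact congrFun hzz ⟨b, fun hb => hra (by rw [hb])⟩
    · rw [← h1.1 r hr, ← h2.1 r hr]
  funext r
  by_cases hra : r = i a
  · rw [hra]
    exact h z z' h1.2 h2.2 hoff
  · exact hoff r hra

/-- The kernel `∑ |μ⟩_i⟨ν| |ν⟩_j⟨μ|`. -/
def returnKernel (N : ℕ) (i j : Fin k ↪ Fin n) : Matrix (Fin n → Fin N) (Fin n → Fin N) ℝ :=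
  transitionKernel (fun _ ν => ν) (fun μ _ => μ) i j

/-- The kernel `∑ |μ⟩_i⟨ν| |μ⟩_j⟨ν|`. -/
def pairKernel (N : ℕ) (i j : Fin k ↪ Fin n) : Matrix (Fin n → Fin N) (Fin n → Fin N) ℝ :=
  transitionKernel (fun μ _ => μ) (fun _ ν => ν) i j

theorem sum_returnKernel_self_le (i : Fin k ↪ Fin n) (x : Fin n → Fin N) :
    ∑ y, returnKernel N i i x y ≤ (N : ℝ) ^ k := by
  classical
  refine (sum_transitionKernel_le _ _ _ _ _).trans ?_
  exact (Nat.cast_le.2 (card_eq_off_range_le i x _)).trans (by rw [Nat.cast_pow])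

/-- At an index a where the embeddings differ, the path condition forces z (i a) = z (j a), which
determines a free coordinate. These terms, up to M² in number, carry one power of N less and are
negligible when M is small compared with N. -/
theorem sum_returnKernel_le {i j : Fin k ↪ Fin n} (hij : i ≠ j) (x : Fin n → Fin N) :
    ∑ y, returnKernel N i j x y ≤ (N : ℝ) ^ (k - 1) := by
  classical
  obtain ⟨a, ha⟩ : ∃ a, i a ≠ j a := by
    by_contra! h
    exact hij (DFunLike.ext _ _ h)
  refine (sum_transitionKernel_le _ _ _ _ _).trans ?_
  refine (Nat.cast_le.2 (card_eq_off_range_le_of_determined i x _ a ?_)).trans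
    (by rw [Nat.cast_pow])
  intro z z' hz hz' h
  have h1 := hz a
  have h2 := hz' a
  simp only [Function.comp_apply] at h1 h2
  rw [← h1, ← h2]
  exact h _ ha.symm

theorem sum_pairKernel_le {i j : Fin k ↪ Fin n} (hij : ¬ ∀ a b, i a ≠ j b) (x : Fin n → Fin N) :
    ∑ y, pairKernel N i j x y ≤ (N : ℝ) ^ (k - 1) := by
  classical
  push Not at hij
  obtain ⟨a, b, hab⟩ := hij
  refine (sum_transitionKernel_le _ _ _ _ _).trans ?_
  refine (Nat.cast_le.2 (card_eq_off_range_le_of_determined i x _ a ?_)).trans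
    (by rw [Nat.cast_pow])
  intro z z' hz hz' _
  -- At a common site i a = j b the second transition prescribes the value x (i b), so this
  -- coordinate of z is fixed by x.
  rw [hab, hz b, hz' b]

open Classical in
-- On disjoint sites the two transitions do not interfere: x carries μ on both sets of sites and y
-- carries ν on both. Hence the end points determine the labels and the intermediate configuration,
-- and at most one path exists.
theorem pairKernel_le {i j : Fin k ↪ Fin n} (hij : ∀ a b, i a ≠ j b) (x y : Fin n → Fin N) :
    pairKernel N i j x y ≤ if PairMoves i j x y then 1 else 0 := by
  have e1 : pairKernel N i j x y
      = ∑ q : ((Fin k → Fin N) × (Fin k → Fin N)) × (Fin n → Fin N),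
        if IsTransition i q.1.1 q.1.2 x q.2 ∧ IsTransition j q.1.1 q.1.2 q.2 y
          then (1 : ℝ) else 0 := by
    simp only [pairKernel, transitionKernel, Matrix.sum_apply, Matrix.mul_apply,
      Fintype.sum_prod_type, transition]
    refine Finset.sum_congr rfl fun μ _ => Finset.sum_congr rfl fun ν _ =>
      Finset.sum_congr rfl fun z _ => ?_
    split_ifs <;> simp_all
  rw [e1]
  have hj (b : Fin k) : j b ∉ Set.range i := by
    rintro ⟨a, ha⟩
    exact hij a b ha
  have hi (a : Fin k) : i a ∉ Set.range j := by
    rintro ⟨b, hb⟩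
    exact hij a b hb.symm
  refine sum_ite_le_of_unique ?_ ?_
  · rintro ⟨⟨μ, ν⟩, z⟩ ⟨⟨μ', ν'⟩, z'⟩ ⟨h1, h2⟩ ⟨h1', h2'⟩
    have hμ : μ = μ' := funext fun a => (h1.1 a).symm.trans (h1'.1 a)
    have hν : ν = ν' := funext fun a => (h2.2.1 a).symm.trans (h2'.2.1 a)
    refine Prod.ext (Prod.ext hμ hν) (funext fun r => ?_)
    by_cases hr : r ∈ Set.range i
    · obtain ⟨a, rfl⟩ := hr
      exact (h1.2.1 a).trans ((congrFun hν a).trans (h1'.2.1 a).symm)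
    · exact (h1.2.2 r hr).symm.trans (h1'.2.2 r hr)
  · rintro ⟨⟨μ, ν⟩, z⟩ ⟨h1, h2⟩
    refine ⟨fun a => ?_, fun a => ?_, fun r hr hr' => ?_⟩
    · exact (h1.1 a).trans ((h2.1 a).symm.trans (h1.2.2 _ (hj a)).symm)
    · exact (h2.2.2 _ (hi a)).symm.trans ((h1.2.1 a).trans (h2.2.1 a).symm)
    · refine (h1.2.2 r ?_).trans (h2.2.2 r ?_)
      · rintro ⟨a, rfl⟩; exact hr a rfl
      · rintro ⟨a, rfl⟩; exact hr' a rfl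

/-- Cyclic shifts of the sites permute the embeddings, so a fixed entry of a uniform embedding is
uniformly distributed. -/
theorem sum_embedding_apply (φ : Fin n → ℝ) (a : Fin k) :
    (n : ℝ) * ∑ i : Fin k ↪ Fin n, φ (i a) = Fintype.card (Fin k ↪ Fin n) * ∑ s, φ s := by
  rcases Nat.eq_zero_or_pos n with rfl | hn
  · simp
  have : NeZero n := ⟨hn.ne'⟩
  have h (c : Fin n) : ∑ i : Fin k ↪ Fin n, φ (i a) = ∑ i : Fin k ↪ Fin n, φ (i a + c) := by
    refine (Fintype.sum_equiv ((Equiv.refl (Fin k)).embeddingCongr (Equiv.addRight c)) _ _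
      fun i => ?_).symm
    simp
  have h2 : (n : ℝ) * ∑ i : Fin k ↪ Fin n, φ (i a) = ∑ c : Fin n, ∑ i : Fin k ↪ Fin n, φ (i a + c) := by
    rw [← Finset.sum_congr rfl fun c _ => h c]
    simp
  rw [h2, Finset.sum_comm]
  have h3 (i : Fin k ↪ Fin n) : ∑ c, φ (i a + c) = ∑ s, φ s :=
    Fintype.sum_equiv (Equiv.addLeft (i a)) _ _ fun c => rfl
  simp [h3]

open Classical in
/-- The number of coordinates of `x` that coincide with another coordinate. -/
def coincidences (x : Fin n → Fin N) : ℕ := (Finset.univ.filter fun s => Coincides x s).card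

theorem coincidences_le (x : Fin n → Fin N) : coincidences x ≤ n := by
  refine (Finset.card_le_univ _).trans ?_
  simp

open Classical in
-- This is the row bound for the Schur test with the pairing weight. For each i the sum over j is at
-- most `pairMovesSum`; its indicator on the first site, summed over i, gives M times the fraction
-- of coinciding coordinates.
theorem sum_sum_pairKernel_le (hk : 0 < k) (hn : 0 < n) (x : Fin n → Fin N) :
    ∑ y, (∑ i : Fin k ↪ Fin n, ∑ j : Fin k ↪ Fin n,
        if ∀ a b, i a ≠ j b then pairKernel N i j x y else 0) * pairingWeight y
      ≤ ((N : ℝ) + n) ^ k * (Fintype.card (Fin k ↪ Fin n) / n * coincidences x)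
        * pairingWeight x := by
  have hw (y : Fin n → Fin N) := (pairingWeight_pos y).le
  have h1 (i : Fin k ↪ Fin n) : ∑ j : Fin k ↪ Fin n, ∑ y,
      (if ∀ a b, i a ≠ j b then pairKernel N i j x y else 0) * pairingWeight y
      ≤ pairMovesSum i x := by
    set F : (Fin k → Fin n) → ℝ := fun j => if PairwiseDistinct i j then
      ∑ y : Fin n → Fin N, (if PairMoves i j x y then pairingWeight y else 0) else 0 with hF
    have hF0 (j : Fin k → Fin n) : 0 ≤ F j := by
      simp only [hF]
      split_ifs
      · exact Finset.sum_nonneg fun y _ => by split_ifs <;> simp [hw]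
      · exact le_rfl
    calc _ ≤ ∑ j : Fin k ↪ Fin n, F j := by
          refine Finset.sum_le_sum fun j _ => ?_
          simp only [hF]
          by_cases hij : ∀ a b, i a ≠ j b
          · have hd : PairwiseDistinct i j := ⟨i.injective, j.injective, hij⟩
            rw [if_pos hd]
            refine Finset.sum_le_sum fun y _ => ?_
            rw [if_pos hij]
            refine (mul_le_mul_of_nonneg_right (pairKernel_le hij x y) (hw y)).trans ?_
            split_ifs <;> simp
          · simp only [if_neg hij, zero_mul, Finset.sum_const_zero]
            exact hF0 j
      _ = ∑ j ∈ Finset.univ.image (fun j : Fin k ↪ Fin n => (j : Fin k → Fin n)), F j := by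
          rw [Finset.sum_image]
          intro j _ j' _ h
          exact DFunLike.coe_injective h
      _ ≤ _ := Finset.sum_le_univ_sum_of_nonneg hF0
  have h2 (i : Fin k ↪ Fin n) : pairMovesSum i x
      ≤ ((N : ℝ) + n) ^ k * ((if Coincides x (i ⟨0, hk⟩) then 1 else 0) * pairingWeight x) := by
    obtain ⟨k, rfl⟩ := Nat.exists_eq_succ_of_ne_zero hk.ne'
    have := pairMovesSum_le_of_coincides (k := k) i x
    rw [ite_mul, one_mul, zero_mul]
    exact this
  have h3 := sum_embedding_apply (k := k) (fun s => if Coincides x s then (1 : ℝ) else 0) ⟨0, hk⟩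
  have h4 : ∑ s, (if Coincides x s then (1 : ℝ) else 0) = coincidences x := by
    simp [coincidences]
  have hn' : (n : ℝ) ≠ 0 := by positivity
  have h5 : ∑ i : Fin k ↪ Fin n, (if Coincides x (i ⟨0, hk⟩) then (1 : ℝ) else 0)
      = Fintype.card (Fin k ↪ Fin n) / n * coincidences x := by
    rw [h4] at h3
    field_simp
    rw [← h3, mul_comm]
  calc _ = ∑ i : Fin k ↪ Fin n, ∑ j : Fin k ↪ Fin n, ∑ y,
      (if ∀ a b, i a ≠ j b then pairKernel N i j x y else 0) * pairingWeight y := by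
        simp only [Finset.sum_mul]
        rw [Finset.sum_comm]
        refine Finset.sum_congr rfl fun i _ => Finset.sum_comm
    _ ≤ ∑ i : Fin k ↪ Fin n, ((N : ℝ) + n) ^ k *
          ((if Coincides x (i ⟨0, hk⟩) then 1 else 0) * pairingWeight x) :=
        Finset.sum_le_sum fun i _ => (h1 i).trans (h2 i)
    _ = _ := by
        rw [← Finset.mul_sum, ← Finset.sum_mul, h5]
        ring

end SecondMoment

end SpikedTensor

namespace SpikedTensor

/-! ### The diagonal bound for the sum of squared coefficients of the Hamiltonian -/

section HamiltonianBound

variable {N n k p : ℕ}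

/-- The real matrix of the sum over all embeddings `i` of `|μ⟩_i⟨ν|`. -/
def transitionSum (n : ℕ) (μ ν : Fin k → Fin N) : Matrix (Fin n → Fin N) (Fin n → Fin N) ℝ :=
  ∑ i : Fin k ↪ Fin n, transition i μ ν

theorem transpose_returnKernel (i j : Fin k ↪ Fin n) :
    (returnKernel N i j).transpose = returnKernel N j i := by
  simp only [returnKernel, transitionKernel, Matrix.transpose_sum, Matrix.transpose_mul,
    transpose_transition]

theorem transpose_pairKernel (i j : Fin k ↪ Fin n) :
    (pairKernel N i j).transpose = pairKernel N j i := by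
  simp only [pairKernel, transitionKernel, Matrix.transpose_sum, Matrix.transpose_mul,
    transpose_transition]
  exact Finset.sum_comm

/-- The operator `∑ X_{μν} X_{νμ}` with `X = transitionSum`. -/
def returnSum (N n k : ℕ) : Matrix (Fin n → Fin N) (Fin n → Fin N) ℝ :=
  ∑ μ : Fin k → Fin N, ∑ ν, transitionSum n μ ν * transitionSum n ν μ

/-- The operator `∑ X_{μν} X_{μν}` with `X = transitionSum`. -/
def pairSum (N n k : ℕ) : Matrix (Fin n → Fin N) (Fin n → Fin N) ℝ :=
  ∑ μ : Fin k → Fin N, ∑ ν, transitionSum n μ ν * transitionSum n μ ν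

theorem sum_transitionSum_mul (u v : (Fin k → Fin N) → (Fin k → Fin N) → Fin k → Fin N) :
    ∑ μ, ∑ ν, transitionSum n μ ν * transitionSum n (u μ ν) (v μ ν)
      = ∑ i : Fin k ↪ Fin n, ∑ j : Fin k ↪ Fin n, transitionKernel u v i j := by
  simp only [transitionSum, transitionKernel, Finset.sum_mul, Finset.mul_sum]
  simp only [Finset.sum_comm (s := (Finset.univ : Finset (Fin k → Fin N)))
    (t := (Finset.univ : Finset (Fin k ↪ Fin n)))]
  exact Finset.sum_comm

theorem returnSum_eq : returnSum N n k
    = ∑ i : Fin k ↪ Fin n, ∑ j : Fin k ↪ Fin n, returnKernel N i j :=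
  sum_transitionSum_mul (fun _ ν => ν) (fun μ _ => μ)

theorem pairSum_eq : pairSum N n k
    = ∑ i : Fin k ↪ Fin n, ∑ j : Fin k ↪ Fin n, pairKernel N i j :=
  sum_transitionSum_mul (fun μ _ => μ) (fun _ ν => ν)

variable (n k) in
/-- The number of embeddings of `k` sites into `n` sites. -/
def numEmbeddings : ℝ := Fintype.card (Fin k ↪ Fin n)

theorem sum_returnSum_le (x : Fin n → Fin N) : ∑ y, returnSum N n k x y
    ≤ numEmbeddings n k * (N : ℝ) ^ k + numEmbeddings n k ^ 2 * (N : ℝ) ^ (k - 1) := by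
  classical
  have h (i : Fin k ↪ Fin n) : ∑ j : Fin k ↪ Fin n, ∑ y, returnKernel N i j x y
      ≤ (N : ℝ) ^ k + numEmbeddings n k * (N : ℝ) ^ (k - 1) := by
    rw [← Finset.add_sum_erase _ _ (Finset.mem_univ i)]
    refine add_le_add (sum_returnKernel_self_le i x) ?_
    calc _ ≤ ∑ j ∈ Finset.univ.erase i, (N : ℝ) ^ (k - 1) :=
          Finset.sum_le_sum fun j hj => sum_returnKernel_le (Finset.ne_of_mem_erase hj).symm x
      _ ≤ ∑ j : Fin k ↪ Fin n, (N : ℝ) ^ (k - 1) :=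
          Finset.sum_le_univ_sum_of_nonneg fun _ => by positivity
      _ = _ := by simp [numEmbeddings]
  calc ∑ y, returnSum N n k x y = ∑ i : Fin k ↪ Fin n, ∑ j : Fin k ↪ Fin n,
        ∑ y, returnKernel N i j x y := by
        simp only [returnSum_eq, Matrix.sum_apply]
        rw [Finset.sum_comm]
        exact Finset.sum_congr rfl fun i _ => Finset.sum_comm
    _ ≤ ∑ i : Fin k ↪ Fin n, ((N : ℝ) ^ k + numEmbeddings n k * (N : ℝ) ^ (k - 1)) :=
        Finset.sum_le_sum fun i _ => h i
    _ = _ := by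
        rw [Finset.sum_const, Finset.card_univ, nsmul_eq_mul, numEmbeddings]
        ring

open Classical in
/-- The part of `pairSum` that comes from disjoint sets of sites. -/
def disjointPairSum (N n k : ℕ) : Matrix (Fin n → Fin N) (Fin n → Fin N) ℝ :=
  fun x y => ∑ i : Fin k ↪ Fin n, ∑ j : Fin k ↪ Fin n,
    if ∀ a b, i a ≠ j b then pairKernel N i j x y else 0

open Classical in
/-- The part of `pairSum` that comes from overlapping sets of sites. -/
def overlappingPairSum (N n k : ℕ) : Matrix (Fin n → Fin N) (Fin n → Fin N) ℝ :=
  fun x y => ∑ i : Fin k ↪ Fin n, ∑ j : Fin k ↪ Fin n,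
    if ∀ a b, i a ≠ j b then 0 else pairKernel N i j x y

theorem pairSum_eq_add : pairSum N n k = disjointPairSum N n k + overlappingPairSum N n k := by
  classical
  ext x y
  simp only [pairSum_eq, Matrix.sum_apply, Matrix.add_apply, disjointPairSum, overlappingPairSum,
    ← Finset.sum_add_distrib]
  refine Finset.sum_congr rfl fun i _ => Finset.sum_congr rfl fun j _ => ?_
  split_ifs <;> simp

theorem pairKernel_comm (i j : Fin k ↪ Fin n) (x y : Fin n → Fin N) :
    pairKernel N i j x y = pairKernel N j i y x := by
  rw [← transpose_pairKernel i j, Matrix.transpose_apply]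

theorem disjointPairSum_comm (x y : Fin n → Fin N) :
    disjointPairSum N n k x y = disjointPairSum N n k y x := by
  classical
  unfold disjointPairSum
  rw [Finset.sum_comm]
  refine Finset.sum_congr rfl fun i _ => Finset.sum_congr rfl fun j _ => ?_
  rw [pairKernel_comm]
  exact if_congr ⟨fun h a b => (h b a).symm, fun h a b => (h b a).symm⟩ rfl rfl

theorem overlappingPairSum_comm (x y : Fin n → Fin N) :
    overlappingPairSum N n k x y = overlappingPairSum N n k y x := by
  classical
  unfold overlappingPairSum
  rw [Finset.sum_comm]
  refine Finset.sum_congr rfl fun i _ => Finset.sum_congr rfl fun j _ => ?_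
  rw [pairKernel_comm]
  exact if_congr ⟨fun h a b => (h b a).symm, fun h a b => (h b a).symm⟩ rfl rfl

theorem returnSum_comm (x y : Fin n → Fin N) : returnSum N n k x y = returnSum N n k y x := by
  simp only [returnSum_eq, Matrix.sum_apply]
  rw [Finset.sum_comm]
  refine Finset.sum_congr rfl fun i _ => Finset.sum_congr rfl fun j _ => ?_
  rw [← transpose_returnKernel i j, Matrix.transpose_apply]

theorem returnSum_nonneg (x y : Fin n → Fin N) : 0 ≤ returnSum N n k x y := by
  simp only [returnSum_eq, Matrix.sum_apply]
  exact Finset.sum_nonneg fun i _ => Finset.sum_nonneg fun j _ => transitionKernel_nonneg _ _ _ _ _ _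

theorem disjointPairSum_nonneg (x y : Fin n → Fin N) : 0 ≤ disjointPairSum N n k x y := by
  refine Finset.sum_nonneg fun i _ => Finset.sum_nonneg fun j _ => ?_
  split_ifs
  · exact transitionKernel_nonneg _ _ _ _ _ _
  · exact le_rfl

theorem overlappingPairSum_nonneg (x y : Fin n → Fin N) : 0 ≤ overlappingPairSum N n k x y := by
  refine Finset.sum_nonneg fun i _ => Finset.sum_nonneg fun j _ => ?_
  split_ifs
  · exact le_rfl
  · exact transitionKernel_nonneg _ _ _ _ _ _

theorem sum_overlappingPairSum_le (x : Fin n → Fin N) : ∑ y, overlappingPairSum N n k x y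
    ≤ numEmbeddings n k ^ 2 * (N : ℝ) ^ (k - 1) := by
  classical
  calc ∑ y, overlappingPairSum N n k x y = ∑ i : Fin k ↪ Fin n, ∑ j : Fin k ↪ Fin n,
        ∑ y, (if ∀ a b, i a ≠ j b then 0 else pairKernel N i j x y) := by
        simp only [overlappingPairSum]
        rw [Finset.sum_comm]
        exact Finset.sum_congr rfl fun i _ => Finset.sum_comm
    _ ≤ ∑ i : Fin k ↪ Fin n, ∑ j : Fin k ↪ Fin n, (N : ℝ) ^ (k - 1) := by
        refine Finset.sum_le_sum fun i _ => Finset.sum_le_sum fun j _ => ?_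
        split_ifs with h
        · simp
        · exact sum_pairKernel_le h x
    _ = _ := by
        simp only [Finset.sum_const, Finset.card_univ, nsmul_eq_mul, numEmbeddings]
        ring

/-- The diagonal bound for the second moment of the Hamiltonian. -/
def diagonalWeight (n k : ℕ) (x : Fin n → Fin N) : ℝ :=
  1 / 2 * (numEmbeddings n k * (N : ℝ) ^ k + 2 * numEmbeddings n k ^ 2 * (N : ℝ) ^ (k - 1)
    + ((N : ℝ) + n) ^ k * (numEmbeddings n k / n * coincidences x))

/-- Three Schur tests: constant weights for the return term and for overlapping pairs, the pairing
weight for disjoint pairs. As the pair term is bounded in absolute value, its sign, which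
distinguishes real from imaginary noise, does not matter. -/
theorem re_trace_returnSum_add_pairSum_le (hk : 0 < k) (hn : 0 < n) {ε : ℝ} (hε : |ε| = 1)
    (P : Matrix (Fin n → Fin N) (Fin n → Fin N) ℂ) :
    1 / 2 * (((returnSum N n k).map Complex.ofReal * (P.conjTranspose * P)).trace.re
      + ε * ((pairSum N n k).map Complex.ofReal * (P.conjTranspose * P)).trace.re)
      ≤ ∑ x, diagonalWeight n k x * ((P.conjTranspose * P) x x).re := by
  have h1 := abs_re_trace_mul_le_of_weight (S := returnSum N n k) returnSum_comm returnSum_nonneg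
    (f := fun _ => 1) (fun _ => one_pos) (fun x => by simpa using sum_returnSum_le x) P
  have h2 := abs_re_trace_mul_le_of_weight (S := overlappingPairSum N n k) overlappingPairSum_comm
    overlappingPairSum_nonneg (f := fun _ => 1) (fun _ => one_pos)
    (fun x => by simpa using sum_overlappingPairSum_le x) P
  have h3 := abs_re_trace_mul_le_of_weight (S := disjointPairSum N n k) disjointPairSum_comm
    disjointPairSum_nonneg pairingWeight_pos (sum_sum_pairKernel_le hk hn) P
  set Q := P.conjTranspose * P
  have h4 : ((pairSum N n k).map Complex.ofReal * Q).trace.re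
      = ((disjointPairSum N n k).map Complex.ofReal * Q).trace.re
        + ((overlappingPairSum N n k).map Complex.ofReal * Q).trace.re := by
    rw [pairSum_eq_add, Matrix.map_add _ Complex.ofReal_add, Matrix.add_mul, Matrix.trace_add,
      Complex.add_re]
  have h5 : ε * ((pairSum N n k).map Complex.ofReal * Q).trace.re
      ≤ |((disjointPairSum N n k).map Complex.ofReal * Q).trace.re|
        + |((overlappingPairSum N n k).map Complex.ofReal * Q).trace.re| := by
    refine (le_abs_self _).trans ?_
    rw [abs_mul, hε, one_mul, h4]
    exact abs_add_le _ _
  have h6 := le_abs_self ((returnSum N n k).map Complex.ofReal * Q).trace.re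
  have h7 : ∑ x, diagonalWeight n k x * (Q x x).re = 1 / 2 *
      (∑ x, (numEmbeddings n k * (N : ℝ) ^ k + numEmbeddings n k ^ 2 * (N : ℝ) ^ (k - 1))
          * (Q x x).re
        + ∑ x, numEmbeddings n k ^ 2 * (N : ℝ) ^ (k - 1) * (Q x x).re
        + ∑ x, ((N : ℝ) + n) ^ k * (Fintype.card (Fin k ↪ Fin n) / n * coincidences x)
          * (Q x x).re) := by
    rw [← Finset.sum_add_distrib, ← Finset.sum_add_distrib, Finset.mul_sum]
    refine Finset.sum_congr rfl fun x _ => ?_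
    rw [diagonalWeight, numEmbeddings]
    ring
  rw [h7]
  linarith

/-- The splitting of a multi-index into its two halves. -/
def halvesEquiv (N : ℕ) (hp : Even p) :
    (Fin p → Fin N) ≃ (Fin (p / 2) → Fin N) × (Fin (p / 2) → Fin N) where
  toFun μ := (firstHalf μ, secondHalf μ)
  invFun q a := if h : (a : ℕ) < p / 2 then q.1 ⟨a, h⟩ else q.2 ⟨a - p / 2, by
    obtain ⟨m, rfl⟩ := hp
    omega⟩
  left_inv μ := by
    funext a
    simp only [firstHalf, secondHalf]
    split_ifs with h
    · rfl
    · congr 1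
      ext
      simp only
      omega
  right_inv q := by
    ext a <;> simp [firstHalf, secondHalf]

theorem interaction_single (μ : Fin p → Fin N) (ω : ℂ) (i : Fin (p / 2) ↪ Fin n) :
    interaction (Pi.single μ ω) i = ω • transitionOp i (firstHalf μ) (secondHalf μ) := by
  rw [interaction, Finset.sum_eq_single μ]
  · rw [Pi.single_eq_same]
  · intro ν _ hν
    rw [Pi.single_eq_of_ne hν, zero_smul]
  · simp

theorem conjTranspose_transitionOp (i : Fin k ↪ Fin n) (μ ν : Fin k → Fin N) :
    (transitionOp i μ ν).conjTranspose = transitionOp i ν μ := by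
  ext x y
  rw [Matrix.conjTranspose_apply, transitionOp_eq_map, transitionOp_eq_map, Matrix.map_apply,
    Matrix.map_apply, Complex.star_def, Complex.conj_ofReal, transition_comm]

theorem map_transitionSum (μ ν : Fin k → Fin N) :
    (transitionSum n μ ν).map Complex.ofReal = ∑ i : Fin k ↪ Fin n, transitionOp i μ ν := by
  ext x y
  simp only [transitionSum, Matrix.map_apply, Matrix.sum_apply, Complex.ofReal_sum,
    transitionOp_eq_map]

theorem hamiltonian_single (μ : Fin p → Fin N) (ω : ℂ) :
    hamiltonian n (Pi.single μ ω) = (1 / 2 : ℂ) •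
      (ω • (transitionSum n (firstHalf μ) (secondHalf μ)).map Complex.ofReal
        + conj ω • (transitionSum n (secondHalf μ) (firstHalf μ)).map Complex.ofReal) := by
  rw [hamiltonian]
  congr 1
  rw [map_transitionSum, map_transitionSum, Finset.smul_sum, Finset.smul_sum,
    ← Finset.sum_add_distrib]
  refine Finset.sum_congr rfl fun i _ => ?_
  rw [interaction_single, Matrix.conjTranspose_smul, conjTranspose_transitionOp, Complex.star_def]

theorem isHermitian_hamiltonian (T : Tensor p N) : (hamiltonian n T).IsHermitian := by
  rw [Matrix.IsHermitian, hamiltonian, Matrix.conjTranspose_smul, Matrix.conjTranspose_sum]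
  congr 1
  · simp
  · refine Finset.sum_congr rfl fun i _ => ?_
    rw [Matrix.conjTranspose_add, Matrix.conjTranspose_conjTranspose, add_comm]

/-- Each coefficient is (ω X_{μν} + ω̄ X_{νμ})/2. In the sum of the squares the products with ω² =
ω̄² = ε form the pair term and those with |ω|² = 1 the return term. The cases used are ω = 1 and ω =
i. -/
theorem diagonallyBounded_hamiltonian (hp : Even p) (hp0 : 0 < p) (hn : 0 < n) {ω : ℂ} {ε : ℝ}
    (hε : |ε| = 1) (hω : ω * ω = ε) (hω1 : ω * conj ω = 1) :
    DiagonallyBounded (fun μ : Fin p → Fin N => hamiltonian n (Pi.single μ ω))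
      (diagonalWeight n (p / 2)) where
  isHermitian μ := isHermitian_hamiltonian _
  bound P := by
    have hk : 0 < p / 2 := by
      obtain ⟨m, rfl⟩ := hp
      omega
    refine le_trans (le_of_eq ?_) (re_trace_returnSum_add_pairSum_le hk hn hε P)
    set Q := P.conjTranspose * P
    have hω' : conj ω * conj ω = (ε : ℂ) := by
      rw [← map_mul, hω, Complex.conj_ofReal]
    set X : (Fin (p / 2) → Fin N) → (Fin (p / 2) → Fin N) →
      Matrix (Fin n → Fin N) (Fin n → Fin N) ℂ :=
      fun μ ν => (transitionSum n μ ν).map Complex.ofReal with hX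
    have e1 (μ : Fin p → Fin N) : hamiltonian n (Pi.single μ ω) * hamiltonian n (Pi.single μ ω) * Q
        = (1 / 4 : ℂ) • ((ε : ℂ) • (X (firstHalf μ) (secondHalf μ) * X (firstHalf μ) (secondHalf μ)
            + X (secondHalf μ) (firstHalf μ) * X (secondHalf μ) (firstHalf μ))
          + (X (firstHalf μ) (secondHalf μ) * X (secondHalf μ) (firstHalf μ)
            + X (secondHalf μ) (firstHalf μ) * X (firstHalf μ) (secondHalf μ))) * Q := by
      congr 1
      rw [hamiltonian_single]
      simp only [Matrix.smul_mul, Matrix.mul_smul, Matrix.add_mul, Matrix.mul_add, smul_add,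
        smul_smul]
      have a1 : 1 / 2 * ω * (1 / 2 * ω) = 1 / 4 * (ε : ℂ) := by rw [← hω]; ring
      have a2 : 1 / 2 * conj ω * (1 / 2 * conj ω) = 1 / 4 * (ε : ℂ) := by rw [← hω']; ring
      have a3 : 1 / 2 * ω * (1 / 2 * conj ω) = (1 / 4 : ℂ) := by linear_combination hω1 / 4
      have a4 : 1 / 2 * conj ω * (1 / 2 * ω) = (1 / 4 : ℂ) := by linear_combination hω1 / 4
      rw [a1, a2, a3, a4]
      simp only [hX]
      abel
    have e2 : ∑ μ : Fin p → Fin N, hamiltonian n (Pi.single μ ω) * hamiltonian n (Pi.single μ ω) * Q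
        = (1 / 2 : ℂ) • ((returnSum N n (p / 2)).map Complex.ofReal * Q
          + (ε : ℂ) • ((pairSum N n (p / 2)).map Complex.ofReal * Q)) := by
      have hr : (returnSum N n (p / 2)).map Complex.ofReal = ∑ μ, ∑ ν, X μ ν * X ν μ := by
        ext x y
        simp [returnSum, Matrix.sum_apply, Matrix.mul_apply, hX]
      have hpp : (pairSum N n (p / 2)).map Complex.ofReal = ∑ μ, ∑ ν, X μ ν * X μ ν := by
        ext x y
        simp [pairSum, Matrix.sum_apply, Matrix.mul_apply, hX]
      have hr' : ∑ μ, ∑ ν, X ν μ * X μ ν = ∑ μ, ∑ ν, X μ ν * X ν μ := Finset.sum_comm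
      have hpp' : ∑ μ, ∑ ν, X ν μ * X ν μ = ∑ μ, ∑ ν, X μ ν * X μ ν := Finset.sum_comm
      simp only [e1]
      refine ((halvesEquiv N hp).sum_comp (fun q => (1 / 4 : ℂ) • ((ε : ℂ) • (X q.1 q.2 * X q.1 q.2
            + X q.2 q.1 * X q.2 q.1) + (X q.1 q.2 * X q.2 q.1 + X q.2 q.1 * X q.1 q.2)) * Q)).trans ?_
      rw [Fintype.sum_prod_type]
      simp only [← Finset.sum_mul, ← Finset.smul_sum, Finset.sum_add_distrib]
      rw [hr', hpp', ← hr, ← hpp]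
      simp only [Matrix.smul_mul, Matrix.add_mul, smul_add, smul_smul]
      module
    have e3 : ∑ μ : Fin p → Fin N,
        (hamiltonian n (Pi.single μ ω) * hamiltonian n (Pi.single μ ω) * Q).trace.re
        = (∑ μ : Fin p → Fin N,
          hamiltonian n (Pi.single μ ω) * hamiltonian n (Pi.single μ ω) * Q).trace.re := by
      rw [Matrix.trace_sum, Complex.re_sum]
    rw [e3, e2, Matrix.trace_smul, Matrix.trace_add, Matrix.trace_smul]
    have : (1 / 2 : ℂ) = ((1 / 2 : ℝ) : ℂ) := by norm_num
    rw [this, smul_eq_mul, smul_eq_mul, Complex.re_ofReal_mul, Complex.add_re,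
      Complex.re_ofReal_mul]

end HamiltonianBound

end SpikedTensor

namespace SpikedTensor

/-! ### The number of configurations with many coincidences -/

section Counting

variable {N n : ℕ}

/-- The number of distinct coordinates. -/
def numDistinct (x : Fin n → Fin N) : ℕ := (Finset.univ.image x).card

theorem numDistinct_le (x : Fin n → Fin N) : numDistinct x ≤ n :=
  Finset.card_image_le.trans (by simp)

/-- A value of multiplicity m accounts for m coincidences if m ≥ 2 and for none if m = 1, in either
case for at most 2m - 2. -/
theorem coincidences_add_le (x : Fin n → Fin N) : coincidences x + 2 * numDistinct x ≤ 2 * n := by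
  classical
  have h1 : coincidences x = ∑ a ∈ Finset.univ.image x,
      (Finset.univ.filter fun s => Coincides x s ∧ x s = a).card := by
    rw [coincidences, Finset.card_eq_sum_card_fiberwise (f := x) (t := Finset.univ.image x)]
    · refine Finset.sum_congr rfl fun a _ => ?_
      rw [Finset.filter_filter]
    · intro s _
      simp
  have h2 : n = ∑ a ∈ Finset.univ.image x, (Finset.univ.filter fun s => x s = a).card := by
    have := Finset.card_eq_sum_card_fiberwise (f := x) (s := Finset.univ)
      (t := Finset.univ.image x) (fun s _ => by simp)
    simpa using this
  have h3 : ∀ a ∈ Finset.univ.image x, (Finset.univ.filter fun s => Coincides x s ∧ x s = a).card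
      + 2 ≤ 2 * (Finset.univ.filter fun s => x s = a).card := by
    intro a ha
    obtain ⟨s, -, rfl⟩ := Finset.mem_image.1 ha
    have hle : (Finset.univ.filter fun r => Coincides x r ∧ x r = x s).card
        ≤ (Finset.univ.filter fun r => x r = x s).card :=
      Finset.card_le_card fun r hr => by
        simp only [Finset.mem_filter, Finset.mem_univ, true_and] at hr ⊢
        exact hr.2
    have hpos : 0 < (Finset.univ.filter fun r => x r = x s).card :=
      Finset.card_pos.2 ⟨s, by simp⟩
    by_cases h : (Finset.univ.filter fun r => Coincides x r ∧ x r = x s).Nonempty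
    · obtain ⟨r, hr⟩ := h
      simp only [Finset.mem_filter, Finset.mem_univ, true_and] at hr
      obtain ⟨⟨t, htr, ht⟩, hrs⟩ := hr
      have : 1 < (Finset.univ.filter fun r => x r = x s).card :=
        Finset.one_lt_card.2 ⟨t, by simp [ht, hrs], r, by simp [hrs], htr⟩
      omega
    · rw [Finset.not_nonempty_iff_eq_empty.1 h, Finset.card_empty]
      omega
  have h4 := Finset.sum_le_sum h3
  rw [Finset.sum_add_distrib, ← h1, ← Finset.mul_sum, ← h2, Finset.sum_const, smul_eq_mul] at h4
  rw [numDistinct]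
  omega

theorem numDistinct_cons (a : Fin N) (x : Fin n → Fin N) :
    numDistinct (Fin.cons a x : Fin (n + 1) → Fin N)
      = numDistinct x + if a ∈ Finset.univ.image x then 0 else 1 := by
  have : Finset.univ.image (Fin.cons a x : Fin (n + 1) → Fin N)
      = insert a (Finset.univ.image x) := by
    ext b
    simp only [Finset.mem_image, Finset.mem_univ, true_and, Finset.mem_insert, Fin.exists_fin_succ,
      Fin.cons_zero, Fin.cons_succ, eq_comm]
  rw [numDistinct, this, Finset.card_insert_eq_ite, numDistinct]
  split_ifs <;> rfl

/-- Coordinates are added one at a time: a new one either takes a fresh value, at weight 1, or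
repeats one of the at most n values already present, at weight t. -/
theorem sum_pow_numDistinct_le {t : ℝ} (ht : 1 ≤ t) :
    ∑ x : Fin n → Fin N, t ^ (n - numDistinct x) ≤ ∏ i ∈ Finset.range n, ((N : ℝ) + t * i) := by
  induction n with
  | zero => simp [numDistinct]
  | succ n ih =>
    rw [← (Fin.consEquiv fun _ : Fin (n + 1) => Fin N).sum_comp, Fintype.sum_prod_type,
      Finset.sum_comm, Finset.prod_range_succ, mul_comm]
    refine le_trans ?_ (mul_le_mul_of_nonneg_left ih (by positivity))
    rw [Finset.mul_sum]
    refine Finset.sum_le_sum fun x _ => ?_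
    have hx := numDistinct_le x
    have h1 (a : Fin N) : t ^ (n + 1 - numDistinct (Fin.cons a x : Fin (n + 1) → Fin N))
        = (if a ∈ Finset.univ.image x then t else 1) * t ^ (n - numDistinct x) := by
      rw [numDistinct_cons]
      split_ifs
      · rw [add_zero, Nat.sub_add_comm hx, pow_succ, mul_comm]
      · rw [Nat.add_sub_add_right, one_mul]
    have h2 : ∑ a : Fin N, (if a ∈ Finset.univ.image x then t else 1) ≤ (N : ℝ) + t * n := by
      calc ∑ a : Fin N, (if a ∈ Finset.univ.image x then t else 1)
          ≤ ∑ a : Fin N, (1 + if a ∈ Finset.univ.image x then t else 0) := by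
            refine Finset.sum_le_sum fun a _ => ?_
            split_ifs <;> linarith
        _ = (N : ℝ) + t * numDistinct x := by
            rw [Finset.sum_add_distrib, ← Finset.sum_filter, Finset.sum_const, Finset.sum_const,
              Finset.filter_mem_eq_inter, Finset.univ_inter, numDistinct]
            simp [mul_comm]
        _ ≤ _ := by
            have : (numDistinct x : ℝ) ≤ n := by exact_mod_cast hx
            gcongr
    calc _ = ∑ a : Fin N, (if a ∈ Finset.univ.image x then t else 1) * t ^ (n - numDistinct x) :=
          Finset.sum_congr rfl fun a _ => h1 a
      _ ≤ _ := by
          rw [← Finset.sum_mul]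
          gcongr

open Real in
-- An exponential Markov inequality with t = √N. More than n/2 coincidences force n - `numDistinct
-- x` ≥ n/4, hence a weight of at least N^{n/8}, while n ≤ √N bounds the total weight by (2N)^n. The
-- factor 2^n costs at most N^{n/16}.
theorem card_many_coincidences_le (hN : 1 ≤ N) (hn : (n : ℝ) ≤ sqrt N)
    (hlog : log 2 ≤ log N / 16) :
    ((Finset.univ.filter fun x : Fin n → Fin N => n < 2 * coincidences x).card : ℝ)
      ≤ exp (n * log N - n * log N / 16) := by
  have hN0 : (0 : ℝ) < N := by exact_mod_cast hN
  have hN1 : (1 : ℝ) ≤ N := by exact_mod_cast hN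
  have hs1 : 1 ≤ sqrt N := by rwa [Real.one_le_sqrt]
  have hlogN : 0 ≤ log N := Real.log_nonneg hN1
  have hsexp : sqrt N = exp (log N / 2) := by
    rw [Real.exp_half, Real.exp_log hN0]
  have h1 : ∏ i ∈ Finset.range n, ((N : ℝ) + sqrt N * i) ≤ (2 * N) ^ n := by
    calc ∏ i ∈ Finset.range n, ((N : ℝ) + sqrt N * i) ≤ ∏ i ∈ Finset.range n, (2 * (N : ℝ)) := by
          refine Finset.prod_le_prod (fun i _ => by positivity) fun i hi => ?_
          have hin : (i : ℝ) ≤ sqrt N := by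
            have : (i : ℝ) ≤ n := by exact_mod_cast (Finset.mem_range.1 hi).le
            linarith
          have := mul_le_mul_of_nonneg_left hin (Real.sqrt_nonneg N)
          rw [Real.mul_self_sqrt hN0.le] at this
          linarith
      _ = _ := by simp
  have h2 := (sum_pow_numDistinct_le (N := N) (n := n) hs1).trans h1
  have h3 : ((Finset.univ.filter fun x : Fin n → Fin N => n < 2 * coincidences x).card : ℝ)
      * exp (n * log N / 8) ≤ ∑ x : Fin n → Fin N, sqrt N ^ (n - numDistinct x) := by
    calc _ = ∑ x ∈ Finset.univ.filter fun x : Fin n → Fin N => n < 2 * coincidences x,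
            exp (n * log N / 8) := by
          rw [Finset.sum_const, nsmul_eq_mul]
      _ ≤ ∑ x ∈ Finset.univ.filter fun x : Fin n → Fin N => n < 2 * coincidences x,
            sqrt N ^ (n - numDistinct x) := by
          refine Finset.sum_le_sum fun x hx => ?_
          have hx' := (Finset.mem_filter.1 hx).2
          have h4 := coincidences_add_le x
          have h5 : (n : ℝ) / 4 ≤ (n - numDistinct x : ℕ) := by
            rw [div_le_iff₀ (by norm_num)]
            have : n ≤ (n - numDistinct x) * 4 := by omega
            exact_mod_cast this
          rw [hsexp, ← Real.exp_nat_mul]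
          refine Real.exp_le_exp.2 ?_
          have := mul_le_mul_of_nonneg_right h5 hlogN
          linarith
      _ ≤ _ := Finset.sum_le_univ_sum_of_nonneg fun x => by positivity
  have h6 : (2 * (N : ℝ)) ^ n ≤ exp (n * log N - n * log N / 16) * exp (n * log N / 8) := by
    have : (2 * (N : ℝ)) = exp (log 2 + log N) := by
      rw [Real.exp_add, Real.exp_log two_pos, Real.exp_log hN0]
    rw [this, ← Real.exp_nat_mul, ← Real.exp_add]
    refine Real.exp_le_exp.2 ?_
    have : (n : ℝ) * log 2 ≤ n * (log N / 16) := by gcongr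
    linarith
  exact le_of_mul_le_mul_right ((h3.trans h2).trans h6) (Real.exp_pos _)

end Counting

end SpikedTensor

namespace SpikedTensor

/-! ### Product operators and the energy of the signal -/

section ProductOperators

variable {N n p : ℕ}

/-- The tensor product of one-site operators. -/
def productOp (B : Fin n → Matrix (Fin N) (Fin N) ℂ) : Operator N n :=
  fun x y => ∏ s, B s (x s) (y s)

theorem productOp_mul (B C : Fin n → Matrix (Fin N) (Fin N) ℂ) :
    productOp B * productOp C = productOp fun s => B s * C s := by
  ext x y
  simp only [productOp, Matrix.mul_apply, ← Finset.prod_mul_distrib, Finset.prod_univ_sum,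
    Fintype.piFinset_univ]

theorem conjTranspose_productOp (B : Fin n → Matrix (Fin N) (Fin N) ℂ) :
    (productOp B).conjTranspose = productOp fun s => (B s).conjTranspose := by
  ext x y
  simp only [productOp, Matrix.conjTranspose_apply, star_prod]

theorem trace_productOp (B : Fin n → Matrix (Fin N) (Fin N) ℂ) :
    (productOp B).trace = ∏ s, (B s).trace := by
  simp only [productOp, Matrix.trace, Matrix.diag_apply, Finset.prod_univ_sum,
    Fintype.piFinset_univ]

theorem productOp_smul (c : Fin n → ℂ) (B : Fin n → Matrix (Fin N) (Fin N) ℂ) :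
    (productOp fun s => c s • B s) = (∏ s, c s) • productOp B := by
  ext x y
  simp only [productOp, Matrix.smul_apply, smul_eq_mul, Finset.prod_mul_distrib]

variable (v : EuclideanSpace ℝ (Fin N))

/-- The one-site operator `|v⟩⟨v|`. -/
def signalOp : Matrix (Fin N) (Fin N) ℂ := fun a b => ((v a : ℝ) : ℂ) * ((v b : ℝ) : ℂ)

theorem conjTranspose_signalOp : (signalOp v).conjTranspose = signalOp v := by
  ext a b
  simp [signalOp, mul_comm]

variable {v}

theorem sum_mul_self_eq (hv : ‖v‖ = Real.sqrt N) : ∑ a, ((v a : ℝ) : ℂ) * ((v a : ℝ) : ℂ) = N := by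
  have h : ∑ a, v a * v a = N := by
    have h1 := EuclideanSpace.real_norm_sq_eq v
    rw [hv, Real.sq_sqrt (Nat.cast_nonneg N)] at h1
    rw [h1]
    exact Finset.sum_congr rfl fun a _ => by ring
  exact_mod_cast congrArg Complex.ofReal h

theorem trace_signalOp (hv : ‖v‖ = Real.sqrt N) : (signalOp v).trace = N := sum_mul_self_eq hv

theorem signalOp_mul_self (hv : ‖v‖ = Real.sqrt N) :
    signalOp v * signalOp v = (N : ℂ) • signalOp v := by
  ext a b
  rw [Matrix.mul_apply, Matrix.smul_apply, smul_eq_mul, ← sum_mul_self_eq hv, Finset.sum_mul]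
  refine Finset.sum_congr rfl fun c _ => ?_
  simp only [signalOp]
  ring

variable (v) in
/-- The operator `|v⟩⟨v|` on all sites in `S`. -/
def signalOn (S : Finset (Fin n)) : Operator N n :=
  productOp fun s => if s ∈ S then signalOp v else 1

variable (v) in
theorem conjTranspose_signalOn (S : Finset (Fin n)) :
    (signalOn v S).conjTranspose = signalOn v S := by
  rw [signalOn, conjTranspose_productOp]
  congr 1
  funext s
  split_ifs
  · exact conjTranspose_signalOp v
  · exact Matrix.conjTranspose_one

theorem signalOn_mul (hv : ‖v‖ = Real.sqrt N) (S T : Finset (Fin n)) :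
    signalOn v S * signalOn v T = ((N : ℂ) ^ (S ∩ T).card) • signalOn v (S ∪ T) := by
  have h1 : ∏ s, (if s ∈ S ∩ T then (N : ℂ) else 1) = (N : ℂ) ^ (S ∩ T).card := by
    rw [Finset.prod_ite_mem, Finset.univ_inter, Finset.prod_const]
  rw [signalOn, signalOn, productOp_mul, ← h1, signalOn, ← productOp_smul]
  congr 1
  funext s
  by_cases hS : s ∈ S <;> by_cases hT : s ∈ T <;> simp [hS, hT, signalOp_mul_self hv]

/-- The hypotheses say that R = R*R/c, so R is positive semidefinite. -/
theorem re_trace_mul_nonneg_of_sq {X : Type*} [Fintype X] {σ R : Matrix X X ℂ}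
    (hσ : σ.PosSemidef) (hR : R.conjTranspose = R) {c : ℝ} (hc : 0 < c)
    (h : R * R = (c : ℂ) • R) : 0 ≤ (σ * R).trace.re := by
  have h1 : 0 ≤ (R.conjTranspose * σ * R).trace.re :=
    (Complex.le_def.1 (hσ.conjTranspose_mul_mul_same R).trace_nonneg).1
  rw [hR, mul_assoc, Matrix.trace_mul_comm, mul_assoc, h, Matrix.mul_smul, Matrix.trace_smul,
    smul_eq_mul, Complex.re_ofReal_mul] at h1
  exact nonneg_of_mul_nonneg_right h1 hc

/-- In terms of the projections P_S and P_s onto v on the sites S and on s, the difference of the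
two operators is N^{|S|}(P_s - P_S). Since P_S ≤ P_s, this is a multiple of a projection. -/
theorem re_trace_mul_signalOn_le (hv : ‖v‖ = Real.sqrt N) (hN : 0 < N) {σ : Operator N n}
    (hσ : σ.PosSemidef) {S : Finset (Fin n)} {s : Fin n} (hs : s ∈ S) :
    (σ * signalOn v S).trace.re ≤ (N : ℝ) ^ (S.card - 1) * (σ * signalOn v {s}).trace.re := by
  have hS : 0 < S.card := Finset.card_pos.2 ⟨s, hs⟩
  have hsub : {s} ⊆ S := Finset.singleton_subset_iff.2 hs
  have h1 := re_trace_mul_nonneg_of_sq hσ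
    (R := ((N : ℂ) ^ (S.card - 1)) • signalOn v {s} - signalOn v S) (c := (N : ℝ) ^ S.card)
    (by
      rw [Matrix.conjTranspose_sub, Matrix.conjTranspose_smul, conjTranspose_signalOn,
        conjTranspose_signalOn]
      simp) (by positivity) (by
      rw [Matrix.sub_mul, Matrix.mul_sub, Matrix.mul_sub]
      simp only [Matrix.smul_mul, Matrix.mul_smul, signalOn_mul hv, Finset.inter_self,
        Finset.union_self, Finset.inter_eq_left.2 hsub, Finset.inter_eq_right.2 hsub,
        Finset.union_eq_left.2 hsub, Finset.union_eq_right.2 hsub, Finset.card_singleton, smul_smul,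
        smul_sub]
      obtain ⟨m, hm⟩ := Nat.exists_eq_succ_of_ne_zero hS.ne'
      rw [hm]
      push_cast
      simp only [Nat.succ_eq_add_one, pow_succ]
      module)
  rw [Matrix.mul_sub, Matrix.mul_smul, Matrix.trace_sub, Matrix.trace_smul, Complex.sub_re,
    smul_eq_mul] at h1
  have h2 : ((N : ℂ) ^ (S.card - 1)) = (((N : ℝ) ^ (S.card - 1) : ℝ) : ℂ) := by push_cast; rfl
  rw [h2, Complex.re_ofReal_mul] at h1
  linarith

/-- The sites of an embedding. -/
def sites {k : ℕ} (i : Fin k ↪ Fin n) : Finset (Fin n) := Finset.univ.map i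

theorem mem_sites {k : ℕ} {i : Fin k ↪ Fin n} {s : Fin n} : s ∈ sites i ↔ s ∈ Set.range i := by
  simp [sites]

theorem prod_eq_prod_sites {k : ℕ} (i : Fin k ↪ Fin n) (F : Fin n → ℂ) :
    ∏ s, F s = (∏ a, F (i a)) * ∏ s ∈ (sites i)ᶜ, F s := by
  rw [← Finset.prod_mul_prod_compl (sites i), sites, Finset.prod_map]

theorem card_compl_sites {k : ℕ} (i : Fin k ↪ Fin n) : (sites i)ᶜ.card = n - k := by
  rw [Finset.card_compl, sites, Finset.card_map]
  simp

/-- The one-site factors of `transitionOp`. -/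
def transitionFactor {k : ℕ} (i : Fin k ↪ Fin n) (μ ν : Fin k → Fin N) (s : Fin n) :
    Matrix (Fin N) (Fin N) ℂ :=
  fun c d => open Classical in
    if (∀ a, s = i a → c = μ a ∧ d = ν a) ∧ (s ∉ Set.range i → c = d) then 1 else 0

theorem transitionOp_eq_productOp {k : ℕ} (i : Fin k ↪ Fin n) (μ ν : Fin k → Fin N) :
    transitionOp i μ ν = productOp (transitionFactor i μ ν) := by
  classical
  ext x y
  simp only [transitionOp, productOp, transitionFactor, Finset.prod_ite_zero, Finset.prod_const_one]
  refine if_congr ⟨fun h s _ => ⟨?_, h.2.2 s⟩, fun h => ⟨fun a => ?_, fun a => ?_, fun s => ?_⟩⟩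
    rfl rfl
  · rintro a rfl
    exact ⟨h.1 a, h.2.1 a⟩
  · exact ((h (i a) (Finset.mem_univ _)).1 a rfl).1
  · exact ((h (i a) (Finset.mem_univ _)).1 a rfl).2
  · exact (h s (Finset.mem_univ _)).2

theorem trace_signalOp_mul_transitionFactor {k : ℕ} (i : Fin k ↪ Fin n) (μ ν : Fin k → Fin N)
    (a : Fin k) : (signalOp v * transitionFactor i μ ν (i a)).trace = v (μ a) * v (ν a) := by
  classical
  have h (c d : Fin N) : transitionFactor i μ ν (i a) c d = if c = μ a ∧ d = ν a then 1 else 0 := by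
    simp only [transitionFactor]
    refine if_congr ⟨fun h => h.1 a rfl, fun h => ⟨fun b hb => ?_, fun hr => ?_⟩⟩ rfl rfl
    · rwa [← i.injective hb]
    · exact absurd ⟨a, rfl⟩ hr
  simp only [Matrix.trace, Matrix.diag_apply, Matrix.mul_apply, h, ite_and, mul_ite, mul_one,
    mul_zero, Finset.sum_ite_eq', Finset.mem_univ, if_true, signalOp]
  rw [mul_comm]

theorem transitionFactor_of_notMem {k : ℕ} (i : Fin k ↪ Fin n) (μ ν : Fin k → Fin N) {s : Fin n}
    (hs : s ∉ Set.range i) : transitionFactor i μ ν s = 1 := by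
  classical
  ext c d
  rw [Matrix.one_apply]
  refine if_congr ⟨fun h => h.2 hs, fun h => ⟨fun a ha => ?_, fun _ => h⟩⟩ rfl rfl
  exact absurd ⟨a, ha.symm⟩ hs

theorem prod_halves (hp : Even p) (μ : Fin p → Fin N) (F : Fin N → ℂ) :
    ∏ a, F (μ a) = (∏ a, F (firstHalf μ a)) * ∏ a, F (secondHalf μ a) := by
  have hpp : p / 2 + p / 2 = p := by
    obtain ⟨m, rfl⟩ := hp
    omega
  rw [← (finSumFinEquiv.trans (finCongr hpp)).prod_comp, Fintype.prod_sum_type]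
  rfl

theorem mixedEnergy_hamiltonian (T : Tensor p N) {σ : Operator N n} (hσ : σ.IsHermitian) :
    mixedEnergy (hamiltonian n T) σ
      = ∑ i : Fin (p / 2) ↪ Fin n, (σ * interaction T i).trace.re := by
  have h (A : Operator N n) : (σ * A.conjTranspose).trace.re = (σ * A).trace.re := by
    have : (σ * A.conjTranspose).trace = conj (σ * A).trace := by
      rw [← Complex.star_def, ← Matrix.trace_conjTranspose, Matrix.conjTranspose_mul, hσ.eq,
        Matrix.trace_mul_comm]
    rw [this, Complex.conj_re]
  rw [mixedEnergy, hamiltonian, Matrix.mul_smul, Matrix.trace_smul, smul_eq_mul,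
    show (1 / 2 : ℂ) = ((1 / 2 : ℝ) : ℂ) by norm_num, Complex.re_ofReal_mul, Finset.mul_sum,
    Matrix.trace_sum, Complex.re_sum, Finset.mul_sum]
  refine Finset.sum_congr rfl fun i _ => ?_
  rw [Matrix.mul_add, Matrix.trace_add, Complex.add_re, h]
  ring

theorem interaction_tensorPower (hp : Even p) (v : EuclideanSpace ℝ (Fin N))
    (i : Fin (p / 2) ↪ Fin n) : interaction (tensorPower p v) i = signalOn v (sites i) := by
  classical
  ext x y
  have h1 : interaction (tensorPower p v) i x y
      = ∑ q : (Fin (p / 2) → Fin N) × (Fin (p / 2) → Fin N),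
        ((∏ a, ((v (q.1 a) : ℝ) : ℂ)) * ∏ a, ((v (q.2 a) : ℝ) : ℂ)) * transitionOp i q.1 q.2 x y := by
    rw [← (halvesEquiv N hp).sum_comp, interaction, Matrix.sum_apply]
    refine Finset.sum_congr rfl fun μ _ => ?_
    rw [Matrix.smul_apply, smul_eq_mul, tensorPower, prod_halves hp μ (fun a => ((v a : ℝ) : ℂ))]
    rfl
  rw [h1, Finset.sum_eq_single (x ∘ i, y ∘ i)]
  · have h2 : signalOn v (sites i) x y = (∏ a, signalOp v (x (i a)) (y (i a))) *
        ∏ s ∈ (sites i)ᶜ, (1 : Matrix (Fin N) (Fin N) ℂ) (x s) (y s) := by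
      rw [signalOn, productOp, prod_eq_prod_sites i]
      congr 1
      · refine Finset.prod_congr rfl fun a _ => ?_
        rw [if_pos (mem_sites.2 ⟨a, rfl⟩)]
      · refine Finset.prod_congr rfl fun s hs => ?_
        rw [if_neg (Finset.mem_compl.1 hs)]
    rw [h2]
    simp only [signalOp, Finset.prod_mul_distrib, Function.comp_apply]
    congr 1
    simp only [Matrix.one_apply, Finset.prod_ite_zero, Finset.prod_const_one, transitionOp,
      Function.comp_apply, implies_true, true_and]
    refine if_congr ⟨fun h s hs => h s ?_, fun h s hs => h s ?_⟩ rfl rfl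
    · rwa [← mem_sites, ← Finset.mem_compl]
    · rwa [Finset.mem_compl, mem_sites]
  · rintro ⟨μ, ν⟩ - hne
    rw [transitionOp, if_neg, mul_zero]
    rintro ⟨ha, hb, -⟩
    exact hne (Prod.ext (funext fun a => (ha a).symm) (funext fun a => (hb a).symm))
  · simp

theorem trace_mul_signalOn_singleton (v : EuclideanSpace ℝ (Fin N)) (σ : Operator N n) (s : Fin n) :
    (σ * signalOn v {s}).trace
      = ∑ a, ∑ b, ((v a : ℝ) : ℂ) * reducedDensity σ s a b * ((v b : ℝ) : ℂ) := by
  classical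
  have h1 (x : Fin n → Fin N) : ∑ y, σ x y * signalOn v {s} y x
      = ∑ b, σ x (Function.update x s b) * (v b * v (x s)) := by
    have hinj : Function.Injective fun b => Function.update x s b := Function.update_injective x s
    rw [← Finset.sum_subset (Finset.subset_univ (Finset.univ.image fun b => Function.update x s b)),
      Finset.sum_image (fun b _ c _ h => hinj h)]
    · refine Finset.sum_congr rfl fun b _ => ?_
      congr 1
      rw [signalOn, productOp, ← Finset.mul_prod_erase _ _ (Finset.mem_univ s)]
      have : ∏ r ∈ Finset.univ.erase s, (if r ∈ ({s} : Finset (Fin n)) then signalOp v else 1)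
          (Function.update x s b r) (x r) = 1 := by
        refine Finset.prod_eq_one fun r hr => ?_
        have hrs := Finset.ne_of_mem_erase hr
        rw [if_neg (fun h => hrs (Finset.mem_singleton.1 h)), Function.update_of_ne hrs, Matrix.one_apply_eq]
      rw [this]
      simp [signalOp]
    · intro y _ hy
      have : ∃ r, r ≠ s ∧ y r ≠ x r := by
        by_contra! h
        refine hy (Finset.mem_image.2 ⟨y s, Finset.mem_univ _, ?_⟩)
        funext r
        by_cases hrs : r = s
        · subst hrs; simp
        · rw [Function.update_of_ne hrs, h r hrs]
      obtain ⟨r, hrs, hr⟩ := this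
      rw [signalOn, productOp, Finset.prod_eq_zero (Finset.mem_univ r), mul_zero]
      rw [if_neg (fun h => hrs (Finset.mem_singleton.1 h)), Matrix.one_apply_ne hr]
  have h2 (x : Fin n → Fin N) : ∑ b, σ x (Function.update x s b) * (v b * v (x s))
      = ∑ a, ∑ b, ((v a : ℝ) : ℂ) *
        (if x s = a then σ x (Function.update x s b) else 0) * ((v b : ℝ) : ℂ) := by
    symm
    rw [Finset.sum_eq_single (x s)]
    · refine Finset.sum_congr rfl fun b _ => ?_
      rw [if_pos rfl]
      ring
    · intro a _ ha
      simp [Ne.symm ha]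
    · simp
  calc (σ * signalOn v {s}).trace = ∑ x, ∑ y, σ x y * signalOn v {s} y x := rfl
    _ = ∑ x : Fin n → Fin N, ∑ a, ∑ b, ((v a : ℝ) : ℂ) *
        (if x s = a then σ x (Function.update x s b) else 0) * ((v b : ℝ) : ℂ) := by
        simp only [h1, h2]
    _ = _ := by
        rw [Finset.sum_comm]
        refine Finset.sum_congr rfl fun a _ => ?_
        rw [Finset.sum_comm]
        refine Finset.sum_congr rfl fun b _ => ?_
        rw [reducedDensity, Finset.mul_sum, Finset.sum_mul]

theorem overlap_singleParticle (v : EuclideanSpace ℝ (Fin N)) (σ : Operator N n) :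
    overlap v (singleParticle σ)
      = (n : ℝ)⁻¹ * (∑ s, (σ * signalOn v {s}).trace.re) / N := by
  have h : ∑ a, ∑ b, ((v a : ℝ) : ℂ) * singleParticle σ a b * ((v b : ℝ) : ℂ)
      = ((n : ℝ)⁻¹ : ℝ) * ∑ s, (σ * signalOn v {s}).trace := by
    simp only [trace_mul_signalOn_singleton, singleParticle, Matrix.smul_apply, Matrix.sum_apply,
      smul_eq_mul, Finset.mul_sum, Finset.sum_mul]
    rw [Finset.sum_comm]
    simp only [Finset.sum_comm (s := (Finset.univ : Finset (Fin N)))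
      (t := (Finset.univ : Finset (Fin n)))]
    refine Finset.sum_congr rfl fun s _ => ?_
    rw [Finset.sum_comm]
    refine Finset.sum_congr rfl fun a _ => Finset.sum_congr rfl fun b _ => ?_
    push_cast
    ring
  rw [overlap, h, Complex.re_ofReal_mul, Complex.re_sum]

/-- The energy of the signal is bounded by the overlap. -/
theorem mixedEnergy_tensorPower_le (hp : Even p) (hp0 : 0 < p) (hn : 0 < n) (hN : 0 < N)
    (hv : ‖v‖ = Real.sqrt N) {σ : Operator N n} (hσ : σ.PosSemidef) :
    mixedEnergy (hamiltonian n (tensorPower p v)) σ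
      ≤ numEmbeddings n (p / 2) * (N : ℝ) ^ (p / 2) * overlap v (singleParticle σ) := by
  have hk : 0 < p / 2 := by
    obtain ⟨m, rfl⟩ := hp
    omega
  rw [mixedEnergy_hamiltonian _ hσ.isHermitian]
  have hcard (i : Fin (p / 2) ↪ Fin n) : (sites i).card = p / 2 := by simp [sites]
  have hn' : (n : ℝ) ≠ 0 := by positivity
  have hN' : (N : ℝ) ≠ 0 := by positivity
  -- Only the first site of every embedding is kept. The sum over embeddings then becomes an average
  -- over all sites, which is the single particle density matrix.
  calc ∑ i : Fin (p / 2) ↪ Fin n, (σ * interaction (tensorPower p v) i).trace.re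
      ≤ ∑ i : Fin (p / 2) ↪ Fin n,
        (N : ℝ) ^ (p / 2 - 1) * (σ * signalOn v {i ⟨0, hk⟩}).trace.re := by
        refine Finset.sum_le_sum fun i _ => ?_
        rw [interaction_tensorPower hp]
        have := re_trace_mul_signalOn_le hv hN hσ (S := sites i) (s := i ⟨0, hk⟩)
          (mem_sites.2 ⟨_, rfl⟩)
        rwa [hcard] at this
    _ = (N : ℝ) ^ (p / 2 - 1) * (numEmbeddings n (p / 2) / n *
          ∑ s, (σ * signalOn v {s}).trace.re) := by
        rw [← Finset.mul_sum]
        congr 1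
        have := sum_embedding_apply (k := p / 2) (fun s => (σ * signalOn v {s}).trace.re) ⟨0, hk⟩
        rw [numEmbeddings, div_mul_eq_mul_div, ← this]
        field_simp
    _ = _ := by
        rw [overlap_singleParticle]
        obtain ⟨m, hm⟩ := Nat.exists_eq_succ_of_ne_zero hk.ne'
        rw [hm, Nat.succ_eq_add_one, Nat.add_sub_cancel, pow_succ]
        field_simp

end ProductOperators

end SpikedTensor

namespace SpikedTensor

/-! ### States -/

section States

variable {N n p : ℕ}

theorem posSemidef_pureState (Ψ : State N n) : (pureState Ψ).PosSemidef :=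
  Matrix.posSemidef_vecMulVec_self_star (fun x => Ψ x)

theorem trace_pureState (Ψ : State N n) : (pureState Ψ).trace = (‖Ψ‖ ^ 2 : ℝ) := by
  rw [EuclideanSpace.norm_sq_eq, Matrix.trace]
  push_cast
  refine Finset.sum_congr rfl fun x _ => ?_
  rw [Matrix.diag_apply, pureState, Complex.mul_conj, Complex.normSq_eq_norm_sq]
  push_cast
  rfl

theorem isDensityMatrix_pureState {Ψ : State N n} (h : ‖Ψ‖ = 1) :
    IsDensityMatrix (pureState Ψ) :=
  ⟨posSemidef_pureState Ψ, by rw [trace_pureState, h]; simp⟩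

theorem energy_eq_mixedEnergy (A : Operator N n) (Ψ : State N n) :
    energy A Ψ = mixedEnergy A (pureState Ψ) := by
  rw [energy, mixedEnergy]
  congr 1
  simp only [PiLp.inner_apply, Matrix.toLpLin_apply, Matrix.mulVec, dotProduct, Matrix.trace,
    Matrix.diag_apply, Matrix.mul_apply, pureState]
  rw [Finset.sum_comm]
  refine Finset.sum_congr rfl fun x _ => ?_
  rw [RCLike.inner_apply, Finset.sum_mul]
  refine Finset.sum_congr rfl fun y _ => ?_
  ring

theorem reducedDensity_pureState (Ψ : State N n) (s : Fin n) :
    reducedDensity (pureState Ψ) s = ∑ w : {r // r ≠ s} → Fin N,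
      Matrix.vecMulVec (fun a => Ψ ((Equiv.funSplitAt s (Fin N)).symm (a, w)))
        (star fun a => Ψ ((Equiv.funSplitAt s (Fin N)).symm (a, w))) := by
  ext a b
  rw [reducedDensity, ← (Equiv.funSplitAt s (Fin N)).symm.sum_comp, Fintype.sum_prod_type,
    Finset.sum_eq_single a, Matrix.sum_apply]
  · refine Finset.sum_congr rfl fun w _ => ?_
    have h1 : (Equiv.funSplitAt s (Fin N)).symm (a, w) s = a := by simp [Equiv.funSplitAt]
    have h2 : Function.update ((Equiv.funSplitAt s (Fin N)).symm (a, w)) s b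
        = (Equiv.funSplitAt s (Fin N)).symm (b, w) := by
      funext r
      by_cases hr : r = s
      · subst hr; simp [Equiv.funSplitAt]
      · simp [Equiv.funSplitAt, hr]
    rw [if_pos h1, h2, pureState, Matrix.vecMulVec_apply]
    rfl
  · intro c _ hc
    refine Finset.sum_eq_zero fun w _ => if_neg ?_
    simpa [Equiv.funSplitAt] using hc
  · simp

theorem isDensityMatrix_singleParticle {Ψ : State N n} (hn : 0 < n) (h : ‖Ψ‖ = 1) :
    IsDensityMatrix (singleParticle (pureState Ψ)) := by
  have hn' : (n : ℂ) ≠ 0 := by exact_mod_cast hn.ne'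
  constructor
  · refine Matrix.PosSemidef.smul (Matrix.posSemidef_sum _ fun s _ => ?_) ?_
    · rw [reducedDensity_pureState]
      exact Matrix.posSemidef_sum _ fun w _ => Matrix.posSemidef_vecMulVec_self_star _
    · rw [inv_nonneg]
      exact_mod_cast hn.le
  · have h1 (s : Fin n) : (reducedDensity (pureState Ψ) s).trace = 1 := by
      rw [← (isDensityMatrix_pureState h).2, reducedDensity_pureState, Matrix.trace_sum,
        Matrix.trace, ← (Equiv.funSplitAt s (Fin N)).symm.sum_comp, Fintype.sum_prod_type,
        Finset.sum_comm]
      rfl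
    rw [singleParticle, Matrix.trace_smul, Matrix.trace_sum, Finset.sum_congr rfl fun s _ => h1 s]
    simp [hn']

/-! ### Linearity of the Hamiltonian and the product state -/

theorem interaction_add (T S : Tensor p N) (i : Fin (p / 2) ↪ Fin n) :
    interaction (T + S) i = interaction T i + interaction S i := by
  simp only [interaction, Pi.add_apply, add_smul, Finset.sum_add_distrib]

theorem interaction_smul (c : ℂ) (T : Tensor p N) (i : Fin (p / 2) ↪ Fin n) :
    interaction (c • T) i = c • interaction T i := by
  simp only [interaction, Pi.smul_apply, smul_eq_mul, mul_smul, Finset.smul_sum]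

theorem hamiltonian_add (T S : Tensor p N) :
    hamiltonian n (T + S) = hamiltonian n T + hamiltonian n S := by
  simp only [hamiltonian, interaction_add, Matrix.conjTranspose_add, ← smul_add,
    ← Finset.sum_add_distrib]
  congr 1
  refine Finset.sum_congr rfl fun i _ => ?_
  abel

theorem hamiltonian_smul (c : ℝ) (T : Tensor p N) :
    hamiltonian n ((c : ℂ) • T) = (c : ℂ) • hamiltonian n T := by
  simp only [hamiltonian, interaction_smul, Matrix.conjTranspose_smul, Complex.star_def,
    Complex.conj_ofReal, ← smul_add, ← Finset.smul_sum]
  exact smul_comm _ _ _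

theorem mixedEnergy_add (A B σ : Operator N n) :
    mixedEnergy (A + B) σ = mixedEnergy A σ + mixedEnergy B σ := by
  simp only [mixedEnergy, Matrix.mul_add, Matrix.trace_add, Complex.add_re]

theorem mixedEnergy_smul (c : ℝ) (A σ : Operator N n) :
    mixedEnergy ((c : ℂ) • A) σ = c * mixedEnergy A σ := by
  simp only [mixedEnergy, Matrix.mul_smul, Matrix.trace_smul, smul_eq_mul, Complex.re_ofReal_mul]

theorem mixedEnergy_spiked (lam : ℝ) (v : EuclideanSpace ℝ (Fin N)) (G : Tensor p N)
    (σ : Operator N n) : mixedEnergy (hamiltonian n (spiked lam v G)) σ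
      = lam * mixedEnergy (hamiltonian n (tensorPower p v)) σ
        + mixedEnergy (hamiltonian n G) σ := by
  rw [spiked, hamiltonian_add, hamiltonian_smul, mixedEnergy_add, mixedEnergy_smul]

/-- The product state `v ⊗ ⋯ ⊗ v`, normalized when `|v| = √N`. -/
def productState (n : ℕ) (v : EuclideanSpace ℝ (Fin N)) : State N n :=
  WithLp.toLp 2 fun x => ((Real.sqrt N : ℝ) : ℂ)⁻¹ ^ n * ∏ s, ((v (x s) : ℝ) : ℂ)

theorem productState_mem_symmetricSubspace (v : EuclideanSpace ℝ (Fin N)) :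
    productState n v ∈ symmetricSubspace N n := by
  intro π x
  simp only [productState, Function.comp_apply]
  rw [Equiv.prod_comp π fun s => ((v (x s) : ℝ) : ℂ)]

theorem pureState_productState (v : EuclideanSpace ℝ (Fin N)) :
    pureState (productState n v) = ((N : ℂ)⁻¹ ^ n) • signalOn v Finset.univ := by
  ext x y
  have h : ((Real.sqrt N : ℝ) : ℂ)⁻¹ * ((Real.sqrt N : ℝ) : ℂ)⁻¹ = (N : ℂ)⁻¹ := by
    rw [← mul_inv, ← Complex.ofReal_mul, Real.mul_self_sqrt (Nat.cast_nonneg N),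
      Complex.ofReal_natCast]
  simp only [pureState, productState, signalOn, productOp, signalOp, Finset.mem_univ, if_true,
    Matrix.smul_apply, smul_eq_mul, map_mul, map_pow, map_inv₀, Complex.conj_ofReal, map_prod,
    Finset.prod_mul_distrib, ← h, mul_pow]
  ring

theorem norm_productState {v : EuclideanSpace ℝ (Fin N)} (hN : 0 < N) (hv : ‖v‖ = Real.sqrt N) :
    ‖productState n v‖ = 1 := by
  have h := trace_pureState (productState n v)
  rw [pureState_productState, Matrix.trace_smul, signalOn, trace_productOp] at h
  simp only [Finset.mem_univ, if_true, trace_signalOp hv, Finset.prod_const, Finset.card_univ,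
    Fintype.card_fin, smul_eq_mul, ← mul_pow] at h
  rw [inv_mul_cancel₀ (by exact_mod_cast hN.ne'), one_pow] at h
  have h1 : ‖productState n v‖ ^ 2 = 1 := by exact_mod_cast h.symm
  exact (pow_eq_one_iff_of_nonneg (norm_nonneg _) two_ne_zero).1 h1

/-- The real part of `⟨v^{⊗p}, T⟩`. -/
def signalPairing (v : EuclideanSpace ℝ (Fin N)) (T : Tensor p N) : ℝ :=
  (∑ μ, T μ * tensorPower p v μ).re

/-- All embeddings contribute equally, each idle site giving a factor N against the normalization
N^{-n}. So the noise energy of this state is a single scalar linear in T. -/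
theorem mixedEnergy_productState (hp : Even p) {v : EuclideanSpace ℝ (Fin N)} (hN : 0 < N)
    (hv : ‖v‖ = Real.sqrt N) (T : Tensor p N) :
    mixedEnergy (hamiltonian n T) (pureState (productState n v))
      = numEmbeddings n (p / 2) * (signalPairing v T / (N : ℝ) ^ (p / 2)) := by
  have hN' : (N : ℂ) ≠ 0 := by exact_mod_cast hN.ne'
  have h1 (i : Fin (p / 2) ↪ Fin n) (μ ν : Fin (p / 2) → Fin N) :
      (signalOn v Finset.univ * transitionOp i μ ν).trace
        = (∏ a, ((v (μ a) : ℝ) : ℂ)) * (∏ a, ((v (ν a) : ℝ) : ℂ)) * (N : ℂ) ^ (n - p / 2) := by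
    rw [transitionOp_eq_productOp, signalOn, productOp_mul, trace_productOp, prod_eq_prod_sites i]
    congr 1
    · rw [← Finset.prod_mul_distrib]
      refine Finset.prod_congr rfl fun a _ => ?_
      rw [if_pos (Finset.mem_univ _), trace_signalOp_mul_transitionFactor]
    · rw [← card_compl_sites i, ← Finset.prod_const]
      refine Finset.prod_congr rfl fun s hs => ?_
      rw [if_pos (Finset.mem_univ _), transitionFactor_of_notMem, Matrix.mul_one,
        trace_signalOp hv]
      rwa [← mem_sites, ← Finset.mem_compl]
  have h2 (i : Fin (p / 2) ↪ Fin n) :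
      (pureState (productState n v) * interaction T i).trace.re
        = signalPairing v T / (N : ℝ) ^ (p / 2) := by
    have hkn : p / 2 ≤ n := by simpa using Fintype.card_le_of_embedding i
    have h3 : (pureState (productState n v) * interaction T i).trace
        = (∑ μ, T μ * tensorPower p v μ) * (((N : ℝ) ^ (p / 2))⁻¹ : ℝ) := by
      rw [pureState_productState, interaction, Matrix.mul_sum, Matrix.trace_sum, Finset.sum_mul]
      refine Finset.sum_congr rfl fun μ _ => ?_
      rw [Matrix.mul_smul, Matrix.trace_smul, Matrix.smul_mul, Matrix.trace_smul, h1, tensorPower,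
        prod_halves hp μ (fun a => ((v a : ℝ) : ℂ)), smul_eq_mul, smul_eq_mul]
      have h4 : (N : ℂ)⁻¹ ^ n * (N : ℂ) ^ (n - p / 2) = ((N : ℂ) ^ (p / 2))⁻¹ := by
        obtain ⟨m, rfl⟩ := Nat.exists_eq_add_of_le hkn
        rw [Nat.add_sub_cancel_left, pow_add, mul_assoc, ← mul_pow, inv_mul_cancel₀ hN', one_pow,
          mul_one, inv_pow]
      push_cast
      rw [← h4]
      ring
    rw [h3, Complex.re_mul_ofReal, div_eq_mul_inv, signalPairing]
  rw [mixedEnergy_hamiltonian _ (posSemidef_pureState _).isHermitian,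
    Finset.sum_congr rfl fun i _ => h2 i, Finset.sum_const, nsmul_eq_mul, Finset.card_univ,
    numEmbeddings]

theorem signalPairing_tensorPower (hp : Even p) {v : EuclideanSpace ℝ (Fin N)}
    (hv : ‖v‖ = Real.sqrt N) :
    signalPairing v (tensorPower p v) = (N : ℝ) ^ (p / 2) * (N : ℝ) ^ (p / 2) := by
  have h : ∑ μ : Fin p → Fin N, tensorPower p v μ * tensorPower p v μ = (N : ℂ) ^ p := by
    simp only [tensorPower, ← Finset.prod_mul_distrib]
    have := Finset.prod_univ_sum (fun _ : Fin p => (Finset.univ : Finset (Fin N)))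
      (fun _ c => ((v c : ℝ) : ℂ) * ((v c : ℝ) : ℂ))
    rw [Fintype.piFinset_univ] at this
    rw [← this]
    simp [sum_mul_self_eq hv]
  have hpp : p / 2 + p / 2 = p := by
    obtain ⟨m, rfl⟩ := hp
    omega
  rw [signalPairing, h, ← pow_add, hpp]
  norm_cast

/-! ### The spectral algorithm -/

theorem re_inner_apply_eq_sum {E : Type*} [NormedAddCommGroup E] [InnerProductSpace ℂ E]
    [FiniteDimensional ℂ E] {L : E →ₗ[ℂ] E} (hL : L.IsSymmetric) (Ψ : E) :
    (inner ℂ Ψ (L Ψ)).re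
      = ∑ j, hL.eigenvalues rfl j * ‖inner ℂ (hL.eigenvectorBasis rfl j) Ψ‖ ^ 2 := by
  rw [← (hL.eigenvectorBasis rfl).sum_inner_mul_inner, Complex.re_sum]
  refine Finset.sum_congr rfl fun j _ => ?_
  rw [← hL (hL.eigenvectorBasis rfl j) Ψ, hL.apply_eigenvectorBasis, inner_smul_left,
    ← inner_conj_symm Ψ]
  have : ∀ (e : ℝ) (z : ℂ), (conj z * (conj (e : ℂ) * z)).re = e * ‖z‖ ^ 2 := by
    intro e z
    rw [Complex.conj_ofReal, mul_left_comm, ← Complex.normSq_eq_conj_mul_self, ← Complex.ofReal_mul,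
      Complex.ofReal_re, Complex.normSq_eq_norm_sq]
  exact this _ _

/-- Eigenvectors of different eigenvalues are orthogonal, so Ψ has no component along basis
eigenvectors below E and its energy averages eigenvalues that are at least E. -/
theorem le_energy_of_mem_upperEigenspace {A : Operator N n} (hA : A.IsHermitian) {E : ℝ}
    {Ψ : State N n} (h : Ψ ∈ upperEigenspace A E) (h1 : ‖Ψ‖ = 1) : E ≤ energy A Ψ := by
  have hL := Matrix.isSymmetric_toEuclideanLin_iff.2 hA
  have horth : ∀ j, hL.eigenvalues rfl j < E →
      inner ℂ (hL.eigenvectorBasis rfl j) Ψ = 0 := by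
    refine Submodule.iSup_induction _ (motive := fun Ψ => ∀ j, hL.eigenvalues rfl j < E →
      inner ℂ (hL.eigenvectorBasis rfl j) Ψ = 0) h ?_ ?_ ?_
    · rintro ⟨a, ha⟩ Φ hΦ j hj
      have h2 := hL (hL.eigenvectorBasis rfl j) Φ
      rw [Module.End.mem_eigenspace_iff.1 hΦ, hL.apply_eigenvectorBasis, inner_smul_left,
        inner_smul_right] at h2
      have h3 : ((a : ℂ) - hL.eigenvalues rfl j) * inner ℂ (hL.eigenvectorBasis rfl j) Φ = 0 := by
        rw [sub_mul, ← h2]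
        simp
      refine (mul_eq_zero.1 h3).resolve_left ?_
      rw [← Complex.ofReal_sub]
      exact Complex.ofReal_ne_zero.2 (sub_pos.2 (hj.trans_le ha)).ne'
    · simp
    · intro Φ Φ' hΦ hΦ' j hj
      rw [inner_add_right, hΦ j hj, hΦ' j hj, add_zero]
  rw [energy, re_inner_apply_eq_sum hL]
  have hn : ∑ j, ‖inner ℂ (hL.eigenvectorBasis rfl j) Ψ‖ ^ 2 = 1 := by
    rw [(hL.eigenvectorBasis rfl).sum_sq_norm_inner_right, h1, one_pow]
  calc E = ∑ j, E * ‖inner ℂ (hL.eigenvectorBasis rfl j) Ψ‖ ^ 2 := by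
        rw [← Finset.mul_sum, hn, mul_one]
    _ ≤ _ := by
        refine Finset.sum_le_sum fun j _ => ?_
        rcases lt_or_ge (hL.eigenvalues rfl j) E with hj | hj
        · rw [horth j hj]
          simp
        · gcongr

/-- The energy is an average of eigenvalues of the restriction to V. Working in V lets one argument
serve the full space and the symmetric subspace. -/
theorem exists_hasEigenvector_of_lt_energy {A : Operator N n} (hA : A.IsHermitian) {E : ℝ}
    {V : Submodule ℂ (State N n)} (hV : ∀ Φ ∈ V, Matrix.toEuclideanLin A Φ ∈ V)
    {Ψ : State N n} (hΨ : Ψ ∈ V) (h1 : ‖Ψ‖ = 1) (h : E < energy A Ψ) :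
    ∃ a : ℝ, E < a ∧ ∃ Φ ∈ V, Module.End.HasEigenvector (Matrix.toEuclideanLin A) (a : ℂ) Φ := by
  have hL := (Matrix.isSymmetric_toEuclideanLin_iff.2 hA).restrict_invariant hV
  have h2 := re_inner_apply_eq_sum hL ⟨Ψ, hΨ⟩
  have h3 : (inner ℂ (⟨Ψ, hΨ⟩ : V) ((Matrix.toEuclideanLin A).restrict hV ⟨Ψ, hΨ⟩)).re
      = energy A Ψ := rfl
  have hn : ∑ j, ‖inner ℂ (hL.eigenvectorBasis rfl j) (⟨Ψ, hΨ⟩ : V)‖ ^ 2 = 1 := by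
    rw [(hL.eigenvectorBasis rfl).sum_sq_norm_inner_right, Submodule.coe_norm, h1, one_pow]
  obtain ⟨j, hj⟩ : ∃ j, E < hL.eigenvalues rfl j := by
    by_contra! hc
    refine absurd h (not_lt.2 ?_)
    rw [← h3, h2]
    calc _ ≤ ∑ j, E * ‖inner ℂ (hL.eigenvectorBasis rfl j) (⟨Ψ, hΨ⟩ : V)‖ ^ 2 :=
          Finset.sum_le_sum fun j _ => mul_le_mul_of_nonneg_right (hc j) (sq_nonneg _)
      _ = E := by rw [← Finset.mul_sum, hn, mul_one]
  have h4 := hL.hasEigenvector_eigenvectorBasis rfl j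
  refine ⟨_, hj, (hL.eigenvectorBasis rfl j : V), SetLike.coe_mem _, ?_⟩
  rw [Module.End.hasEigenvector_iff, Module.End.mem_eigenspace_iff] at h4 ⊢
  refine ⟨?_, fun h0 => h4.2 (Subtype.ext h0)⟩
  have := congrArg Subtype.val h4.1
  exact this

theorem transitionOp_comp {k : ℕ} (i : Fin k ↪ Fin n) (μ ν : Fin k → Fin N)
    (π : Equiv.Perm (Fin n)) (x y : Fin n → Fin N) :
    transitionOp i μ ν (x ∘ π) (y ∘ π) = transitionOp (i.trans π.toEmbedding) μ ν x y := by
  classical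
  simp only [transitionOp, Function.comp_apply]
  refine if_congr (and_congr Iff.rfl (and_congr Iff.rfl ⟨fun h s hs => ?_, fun h s hs => ?_⟩))
    rfl rfl
  · have := h (π.symm s) (fun ⟨a, ha⟩ => hs ⟨a, by simp [ha]⟩)
    simpa using this
  · exact h (π s) (fun ⟨a, ha⟩ => hs ⟨a, π.injective (by simpa using ha)⟩)

theorem hamiltonian_comp (T : Tensor p N) (π : Equiv.Perm (Fin n)) (x y : Fin n → Fin N) :
    hamiltonian n T (x ∘ π) (y ∘ π) = hamiltonian n T x y := by
  have h (i : Fin (p / 2) ↪ Fin n) (x y : Fin n → Fin N) : interaction T i (x ∘ π) (y ∘ π)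
      = interaction T (i.trans π.toEmbedding) x y := by
    simp only [interaction, Matrix.sum_apply, Matrix.smul_apply, transitionOp_comp]
  simp only [hamiltonian, Matrix.smul_apply, Matrix.sum_apply, Matrix.add_apply,
    Matrix.conjTranspose_apply, h]
  congr 1
  exact Fintype.sum_equiv ((Equiv.refl (Fin (p / 2))).embeddingCongr π) _ _ fun i => by
    congr 2

theorem toEuclideanLin_hamiltonian_mem_symmetricSubspace (T : Tensor p N) :
    ∀ Φ ∈ symmetricSubspace N n,
      Matrix.toEuclideanLin (hamiltonian n T) Φ ∈ symmetricSubspace N n := by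
  intro Φ hΦ π x
  simp only [Matrix.toLpLin_apply, Matrix.mulVec, dotProduct]
  rw [← (Equiv.arrowCongr π.symm (Equiv.refl (Fin N))).sum_comp]
  refine Finset.sum_congr rfl fun y _ => ?_
  have : (Equiv.arrowCongr π.symm (Equiv.refl (Fin N))) y = y ∘ π := by
    ext a; simp [Equiv.arrowCongr]
  rw [this, hamiltonian_comp]
  congr 1
  exact hΦ π y

end States

end SpikedTensor

namespace SpikedTensor

section Noise

variable {N n p : ℕ}

/-! ### Gaussian tensors -/

variable (n) in
/-- The tensors `T` for which `tr(σ H(T)) > B` in some mixed state `σ`. -/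
def exceedanceSet (B : ℝ) : Set (Tensor p N) :=
  {T | ∃ σ : Operator N n, IsDensityMatrix σ ∧ B < mixedEnergy (hamiltonian n T) σ}

theorem continuous_mixedEnergy_hamiltonian (σ : Operator N n) :
    Continuous fun T : Tensor p N => mixedEnergy (hamiltonian n T) σ := by
  unfold mixedEnergy hamiltonian interaction
  fun_prop

/-- The union over states is uncountable, but it is a union of open sets. -/
theorem measurableSet_exceedanceSet (B : ℝ) :
    MeasurableSet (exceedanceSet n B : Set (Tensor p N)) := by
  have : (exceedanceSet n B : Set (Tensor p N)) = ⋃ σ ∈ {σ : Operator N n | IsDensityMatrix σ},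
      {T | B < mixedEnergy (hamiltonian n T) σ} := by
    ext T
    simp [exceedanceSet]
  rw [this]
  exact (isOpen_biUnion fun σ _ =>
    isOpen_lt continuous_const (continuous_mixedEnergy_hamiltonian σ)).measurableSet

theorem exceedanceSet_smul {c B : ℝ} (hc : 0 < c) (T : Tensor p N) :
    (c : ℂ) • T ∈ exceedanceSet n (c * B) ↔ T ∈ exceedanceSet n B := by
  simp only [exceedanceSet, Set.mem_ofPred_eq, hamiltonian_smul, mixedEnergy_smul,
    mul_lt_mul_iff_right₀ hc]

theorem mem_exceedanceSet_of_add {B B' : ℝ} {T T' : Tensor p N}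
    (h : T + T' ∈ exceedanceSet n (B + B')) :
    T ∈ exceedanceSet n B ∨ T' ∈ exceedanceSet n B' := by
  obtain ⟨σ, hσ, hlt⟩ := h
  rw [hamiltonian_add, mixedEnergy_add] at hlt
  by_contra! hc
  simp only [exceedanceSet, Set.mem_ofPred_eq, not_exists, not_and, not_lt] at hc
  exact absurd hlt (not_lt.2 (add_le_add (hc.1 σ hσ) (hc.2 σ hσ)))

theorem hamiltonian_zero : hamiltonian n (0 : Tensor p N) = 0 := by
  have := hamiltonian_smul (n := n) 0 (0 : Tensor p N)
  simpa using this

theorem hamiltonian_sum {ι : Type*} (s : Finset ι) (T : ι → Tensor p N) :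
    hamiltonian n (∑ i ∈ s, T i) = ∑ i ∈ s, hamiltonian n (T i) := by
  classical
  induction s using Finset.induction_on with
  | empty => exact hamiltonian_zero
  | insert a s ha ih => rw [Finset.sum_insert ha, Finset.sum_insert ha, hamiltonian_add, ih]

theorem matrixSeries_hamiltonian (ω : ℂ) (g : (Fin p → Fin N) → ℝ) :
    matrixSeries (fun μ : Fin p → Fin N => hamiltonian n (Pi.single μ ω)) g
      = hamiltonian n fun μ => (g μ : ℂ) * ω := by
  have h : (fun μ => (g μ : ℂ) * ω) = ∑ μ, (g μ : ℂ) • (Pi.single μ ω : Tensor p N) := by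
    ext μ
    simp [Finset.sum_apply, Pi.single_apply]
  rw [h, hamiltonian_sum, matrixSeries]
  exact Finset.sum_congr rfl fun μ _ => (hamiltonian_smul _ _).symm

/-! ### The norm of the Gaussian Hamiltonian -/

/-- The maximum of `diagonalWeight` over the computational basis. -/
def maxWeight (N n k : ℕ) : ℝ :=
  1 / 2 * (numEmbeddings n k * (N : ℝ) ^ k + 2 * numEmbeddings n k ^ 2 * (N : ℝ) ^ (k - 1)
    + ((N : ℝ) + n) ^ k * numEmbeddings n k)

theorem numEmbeddings_nonneg (n k : ℕ) : 0 ≤ numEmbeddings n k := Nat.cast_nonneg _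

theorem diagonalWeight_le_maxWeight (k : ℕ) (x : Fin n → Fin N) :
    diagonalWeight n k x ≤ maxWeight N n k := by
  have hM := numEmbeddings_nonneg n k
  have h : numEmbeddings n k / n * coincidences x ≤ numEmbeddings n k := by
    rw [div_mul_eq_mul_div]
    refine div_le_of_le_mul₀ (Nat.cast_nonneg _) hM ?_
    have : (coincidences x : ℝ) ≤ n := by exact_mod_cast coincidences_le x
    gcongr
  unfold diagonalWeight maxWeight
  gcongr

/-- Of the three terms of `maxWeight`, the second is at most the first and the third at least the
first. Halving the third therefore removes at least an eighth of the total. -/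
theorem diagonalWeight_le_of_coincidences_le {k : ℕ} (hk : 0 < k)
    (hMN : 2 * numEmbeddings n k ≤ N) {x : Fin n → Fin N} (hx : 2 * coincidences x ≤ n) :
    diagonalWeight n k x ≤ 7 / 8 * maxWeight N n k := by
  have hM := numEmbeddings_nonneg n k
  have h : numEmbeddings n k / n * coincidences x ≤ numEmbeddings n k / 2 := by
    rw [div_mul_eq_mul_div]
    refine div_le_of_le_mul₀ (Nat.cast_nonneg _) (by positivity) ?_
    have : 2 * (coincidences x : ℝ) ≤ n := by exact_mod_cast hx
    nlinarith
  have h1 : ((N : ℝ) + n) ^ k * (numEmbeddings n k / n * coincidences x)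
      ≤ ((N : ℝ) + n) ^ k * (numEmbeddings n k / 2) := by gcongr
  have h2 : 2 * numEmbeddings n k ^ 2 * (N : ℝ) ^ (k - 1) ≤ numEmbeddings n k * (N : ℝ) ^ k := by
    obtain ⟨j, rfl⟩ := Nat.exists_eq_succ_of_ne_zero hk.ne'
    rw [Nat.succ_eq_add_one, Nat.add_sub_cancel, pow_succ (N : ℝ) j]
    calc 2 * numEmbeddings n (j + 1) ^ 2 * (N : ℝ) ^ j
        = numEmbeddings n (j + 1) * ((N : ℝ) ^ j * (2 * numEmbeddings n (j + 1))) := by ring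
      _ ≤ _ := by gcongr
  have h3 : numEmbeddings n k * (N : ℝ) ^ k ≤ ((N : ℝ) + n) ^ k * numEmbeddings n k := by
    rw [mul_comm]
    gcongr
    simp
  have h4 : 0 ≤ ((N : ℝ) + n) ^ k * numEmbeddings n k := by positivity
  unfold diagonalWeight maxWeight
  linarith

/-- The bound on the largest eigenvalue of the Hamiltonian of a real Gaussian tensor. -/
def noiseScale (N n k : ℕ) : ℝ :=
  Real.sqrt (2 * maxWeight N n k * (n * Real.log N) * Real.exp (-(1 / 1000)))

theorem stdGaussian_exceedance_le (hp : Even p) (hp0 : 0 < p) (hkn : p / 2 ≤ n) (hN : 1 ≤ N)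
    (hn : (n : ℝ) ≤ Real.sqrt N) (hlog : Real.log 2 ≤ Real.log N / 16)
    (hL : 1 ≤ n * Real.log N) (hMN : 2 * numEmbeddings n (p / 2) ≤ N) {ω : ℂ} {ε : ℝ}
    (hε : |ε| = 1) (hω : ω * ω = ε) (hω1 : ω * conj ω = 1) :
    stdGaussian (Fin p → Fin N)
        {g | (fun μ => (g μ : ℂ) * ω) ∈ exceedanceSet n (noiseScale N n (p / 2))}
      ≤ ENNReal.ofReal (tailBound (n * Real.log N)) := by
  have hk : 0 < p / 2 := by
    obtain ⟨m, rfl⟩ := hp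
    omega
  have hn0 : 0 < n := hk.trans_le hkn
  have hM : 0 < numEmbeddings n (p / 2) := by
    have : Nonempty (Fin (p / 2) ↪ Fin n) := ⟨Fin.castLEEmb hkn⟩
    exact Nat.cast_pos.2 Fintype.card_pos
  have hN0 : (0 : ℝ) < N := by exact_mod_cast hN
  have h0 : 0 < maxWeight N n (p / 2) := by
    unfold maxWeight
    positivity
  have h := (diagonallyBounded_hamiltonian (N := N) hp hp0 hn0 hε hω
    hω1).measure_exists_trace_mul_le_tailBound (L := n * Real.log N)
    (S := Finset.univ.filter fun x : Fin n → Fin N => n < 2 * coincidences x)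
    (diagonalWeight_le_maxWeight (p / 2))
    (fun x hx => diagonalWeight_le_of_coincidences_le hk hMN (by simpa using hx)) h0 hL
    (by
      rw [Real.exp_nat_mul, Real.exp_log hN0]
      simp)
    (card_many_coincidences_le hN hn hlog)
  refine le_trans (measure_mono ?_) h
  rintro g ⟨σ, hσ, hlt⟩
  refine ⟨σ, hσ.1, hσ.2, ?_⟩
  rw [matrixSeries_hamiltonian]
  exact hlt

/-! ### The pairing of the signal with a Gaussian tensor -/

theorem sum_tensorPower_sq {v : EuclideanSpace ℝ (Fin N)} (hv : ‖v‖ = Real.sqrt N) :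
    ∑ μ : Fin p → Fin N, (∏ a, v (μ a)) ^ 2 = (N : ℝ) ^ p := by
  have := Finset.prod_univ_sum (fun _ : Fin p => (Finset.univ : Finset (Fin N)))
    (fun _ c => v c ^ 2)
  rw [Fintype.piFinset_univ] at this
  simp only [← Finset.prod_pow, ← this, Finset.prod_const, Finset.card_univ, Fintype.card_fin]
  rw [← EuclideanSpace.real_norm_sq_eq, hv, Real.sq_sqrt (Nat.cast_nonneg N)]

theorem signalPairing_eq (v : EuclideanSpace ℝ (Fin N)) (T : Tensor p N) :
    signalPairing v T = ∑ μ, (T μ).re * ∏ a, v (μ a) := by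
  rw [signalPairing, Complex.re_sum]
  refine Finset.sum_congr rfl fun μ _ => ?_
  rw [tensorPower, ← Complex.ofReal_prod, Complex.re_mul_ofReal]

/-- Chebyshev's inequality, obtained as the moment bound with m = 1 for a series of 1 × 1 matrices.
-/
theorem stdGaussian_lt_abs_sum_le {ι : Type*} [Fintype ι] (V : ι → ℝ) {t : ℝ} (ht : 0 < t) :
    stdGaussian ι {g | t < |∑ i, g i * V i|} ≤ ENNReal.ofReal ((∑ i, V i ^ 2) / t ^ 2) := by
  have hb : DiagonallyBounded (fun i => (V i : ℂ) • (1 : Matrix Unit Unit ℂ))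
      (fun _ => ∑ i, V i ^ 2) := by
    refine ⟨fun i => ?_, fun P => ?_⟩
    · simp [Matrix.IsHermitian, Matrix.conjTranspose_smul]
    · rw [Fintype.sum_unique (ι := Unit), Finset.sum_mul]
      refine Finset.sum_le_sum fun i _ => le_of_eq ?_
      simp only [Matrix.smul_mul, Matrix.one_mul, Matrix.mul_smul, Matrix.trace_smul, smul_eq_mul,
        Complex.re_ofReal_mul]
      simp [Matrix.trace, pow_two, mul_assoc]
  refine le_trans (measure_mono ?_) ((hb.measure_trace_pow_ge ht 1).trans
    (ENNReal.ofReal_le_ofReal ?_))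
  · intro g hg
    have h1 : matrixSeries (fun i => (V i : ℂ) • (1 : Matrix Unit Unit ℂ)) g
        = ((∑ i, g i * V i : ℝ) : ℂ) • 1 := by
      simp only [matrixSeries, smul_smul, ← Finset.sum_smul]
      push_cast
      rfl
    simp only [Set.mem_ofPred_eq] at hg ⊢
    rw [h1, smul_pow, one_pow, Matrix.trace_smul, ← Complex.ofReal_pow, smul_eq_mul,
      Complex.re_ofReal_mul]
    simp only [Matrix.trace_one, Fintype.card_unit, Nat.cast_one, Complex.one_re, mul_one]
    rw [← sq_abs (∑ i, g i * V i)]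
    exact pow_le_pow_left₀ ht.le hg.le 2
  · have := hb.traceMoment_le (s₂ := ∑ i, V i ^ 2) (fun _ => le_rfl)
      (Finset.sum_nonneg fun i _ => sq_nonneg _) 1
    rw [mul_one]
    refine div_le_div_of_nonneg_right (this.trans (le_of_eq ?_)) (by positivity)
    simp [oddFactorial]

/-! ### The four ensembles -/

theorem realNoise_eq_map (p N : ℕ) :
    realNoise p N = (stdGaussian (Fin p → Fin N)).map fun g μ => (g μ : ℂ) := by
  rw [realNoise, stdGaussian, Measure.pi_map_pi fun _ => Complex.measurable_ofReal.aemeasurable]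

theorem map_stdGaussian_mul {ι : Type*} [Fintype ι] :
    (stdGaussian ι).map (fun g i => Real.sqrt (1 / 2) * g i)
      = Measure.pi fun _ : ι => gaussianReal 0 (1 / 2) := by
  rw [stdGaussian, Measure.pi_map_pi fun _ => (measurable_const_mul _).aemeasurable]
  congr 1
  funext i
  rw [gaussianReal_map_const_mul, mul_zero]
  congr 1
  ext
  simp

instance (p N : ℕ) : IsProbabilityMeasure (realNoise p N) := by
  rw [realNoise_eq_map]
  exact Measure.isProbabilityMeasure_map (by fun_prop : Measurable _).aemeasurable

theorem measurable_complex_mk : Measurable fun z : ℝ × ℝ => (⟨z.1, z.2⟩ : ℂ) :=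
  Complex.measurableEquivRealProd.symm.measurable

instance (p N : ℕ) : IsProbabilityMeasure (complexNoise p N) := by
  have : IsProbabilityMeasure (((gaussianReal 0 (1 / 2)).prod (gaussianReal 0 (1 / 2))).map
      (fun z : ℝ × ℝ => (⟨z.1, z.2⟩ : ℂ))) :=
    Measure.isProbabilityMeasure_map measurable_complex_mk.aemeasurable
  rw [complexNoise]
  infer_instance

theorem map_re_complexNoise (p N : ℕ) : (complexNoise p N).map (fun G μ => (G μ).re)
    = (stdGaussian (Fin p → Fin N)).map fun g μ => Real.sqrt (1 / 2) * g μ := by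
  have : IsProbabilityMeasure (((gaussianReal 0 (1 / 2)).prod (gaussianReal 0 (1 / 2))).map
      (fun z : ℝ × ℝ => (⟨z.1, z.2⟩ : ℂ))) :=
    Measure.isProbabilityMeasure_map measurable_complex_mk.aemeasurable
  have h : (((gaussianReal 0 (1 / 2)).prod (gaussianReal 0 (1 / 2))).map
      (fun z : ℝ × ℝ => (⟨z.1, z.2⟩ : ℂ))).map Complex.re = gaussianReal 0 (1 / 2) := by
    rw [Measure.map_map Complex.measurable_re measurable_complex_mk]
    exact measurePreserving_fst.map_eq
  have : SigmaFinite ((((gaussianReal 0 (1 / 2)).prod (gaussianReal 0 (1 / 2))).map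
      (fun z : ℝ × ℝ => (⟨z.1, z.2⟩ : ℂ))).map Complex.re) := by
    rw [h]
    infer_instance
  rw [map_stdGaussian_mul, complexNoise,
    Measure.pi_map_pi fun _ => Complex.measurable_re.aemeasurable, h]

theorem map_im_complexNoise (p N : ℕ) : (complexNoise p N).map (fun G μ => (G μ).im)
    = (stdGaussian (Fin p → Fin N)).map fun g μ => Real.sqrt (1 / 2) * g μ := by
  have : IsProbabilityMeasure (((gaussianReal 0 (1 / 2)).prod (gaussianReal 0 (1 / 2))).map
      (fun z : ℝ × ℝ => (⟨z.1, z.2⟩ : ℂ))) :=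
    Measure.isProbabilityMeasure_map measurable_complex_mk.aemeasurable
  have h : (((gaussianReal 0 (1 / 2)).prod (gaussianReal 0 (1 / 2))).map
      (fun z : ℝ × ℝ => (⟨z.1, z.2⟩ : ℂ))).map Complex.im = gaussianReal 0 (1 / 2) := by
    rw [Measure.map_map Complex.measurable_im measurable_complex_mk]
    exact measurePreserving_snd.map_eq
  have : SigmaFinite ((((gaussianReal 0 (1 / 2)).prod (gaussianReal 0 (1 / 2))).map
      (fun z : ℝ × ℝ => (⟨z.1, z.2⟩ : ℂ))).map Complex.im) := by
    rw [h]
    infer_instance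
  rw [map_stdGaussian_mul, complexNoise,
    Measure.pi_map_pi fun _ => Complex.measurable_im.aemeasurable, h]

/-- The constant `a` in `J ≈ a (p/2)! (n choose p/2) / n^{p/2}`. -/
def Ensemble.factor : Ensemble → ℝ
  | .real => 1
  | .complex => 2
  | .realSymmetrized => 1
  | .complexSymmetrized => 2

end Noise

end SpikedTensor

namespace SpikedTensor

/-! ### Transfer of the estimates to complex and symmetrized noise -/

section Ensembles

variable {N n p : ℕ}

theorem map_comp_pi {ι α : Type*} [Fintype ι] [MeasurableSpace α] (ν : Measure α) [SigmaFinite ν]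
    (e : ι ≃ ι) : (Measure.pi fun _ : ι => ν).map (fun G i => G (e i)) = Measure.pi fun _ => ν := by
  refine (Measure.pi_eq fun s hs => ?_).symm
  rw [Measure.map_apply (by fun_prop) (MeasurableSet.univ_pi hs)]
  have : (fun (G : ι → α) i => G (e i)) ⁻¹' Set.univ.pi s = Set.univ.pi fun i => s (e.symm i) := by
    ext G
    simp only [Set.mem_preimage, Set.mem_pi, Set.mem_univ, true_implies]
    exact ⟨fun h i => by simpa using h (e.symm i), fun h i => by simpa using h (e i)⟩
  rw [this, Measure.pi_pi]
  exact e.symm.prod_comp fun i => ν (s i)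

/-- The permutation of the indices of a tensor. -/
def permuteTensor (π : Equiv.Perm (Fin p)) (T : Tensor p N) : Tensor p N :=
  fun μ => T fun a => μ (π a)

theorem map_permuteTensor_pi (ν : Measure ℂ) [SigmaFinite ν] (π : Equiv.Perm (Fin p)) :
    (Measure.pi fun _ : Fin p → Fin N => ν).map (permuteTensor π) = Measure.pi fun _ => ν :=
  map_comp_pi ν (Equiv.arrowCongr π.symm (Equiv.refl (Fin N)))

theorem measurable_permuteTensor (π : Equiv.Perm (Fin p)) :
    Measurable (permuteTensor π : Tensor p N → Tensor p N) := by
  unfold permuteTensor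
  fun_prop

theorem measurable_symmetrize : Measurable (symmetrize : Tensor p N → Tensor p N) := by
  unfold symmetrize
  fun_prop

theorem map_permuteTensor_realNoise (π : Equiv.Perm (Fin p)) :
    (realNoise p N).map (permuteTensor π) = realNoise p N := by
  have : IsProbabilityMeasure ((gaussianReal 0 1).map (fun x : ℝ => (x : ℂ))) :=
    Measure.isProbabilityMeasure_map Complex.measurable_ofReal.aemeasurable
  exact map_permuteTensor_pi _ π

theorem map_permuteTensor_complexNoise (π : Equiv.Perm (Fin p)) :
    (complexNoise p N).map (permuteTensor π) = complexNoise p N := by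
  have : IsProbabilityMeasure (((gaussianReal 0 (1 / 2)).prod (gaussianReal 0 (1 / 2))).map
      (fun z : ℝ × ℝ => (⟨z.1, z.2⟩ : ℂ))) :=
    Measure.isProbabilityMeasure_map measurable_complex_mk.aemeasurable
  exact map_permuteTensor_pi _ π

theorem symmetrize_eq_smul_sum (T : Tensor p N) :
    symmetrize T = ((p.factorial : ℝ)⁻¹ : ℝ) • ∑ π, permuteTensor π T := by
  ext μ
  simp [symmetrize, permuteTensor, Finset.sum_apply]

/-- The Hamiltonian of the symmetrized tensor is the average of those of the permuted tensors, so if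
its energy in σ exceeds B, so does one of theirs. The permuted tensors have the same law, and a
union bound costs the constant p!. -/
theorem map_symmetrize_exceedance_le {P : Measure (Tensor p N)}
    (hP : ∀ π : Equiv.Perm (Fin p), P.map (permuteTensor π) = P) {B : ℝ} {τ : ℝ≥0∞}
    (h : P (exceedanceSet n B) ≤ τ) :
    P.map symmetrize (exceedanceSet n B) ≤ p.factorial * τ := by
  rw [Measure.map_apply measurable_symmetrize (measurableSet_exceedanceSet B)]
  have hsub : symmetrize ⁻¹' (exceedanceSet n B : Set (Tensor p N))
      ⊆ ⋃ π, permuteTensor π ⁻¹' exceedanceSet n B := by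
    rintro T ⟨σ, hσ, hlt⟩
    simp only [Set.mem_iUnion, Set.mem_preimage]
    by_contra! hc
    refine absurd hlt (not_lt.2 ?_)
    have hc' (π : Equiv.Perm (Fin p)) : mixedEnergy (hamiltonian n (permuteTensor π T)) σ ≤ B :=
      not_lt.1 fun h' => hc π ⟨σ, hσ, h'⟩
    have hf : (0 : ℝ) < p.factorial := by exact_mod_cast p.factorial_pos
    have h1 : mixedEnergy (hamiltonian n (symmetrize T)) σ
        = (p.factorial : ℝ)⁻¹ * ∑ π, mixedEnergy (hamiltonian n (permuteTensor π T)) σ := by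
      have h2 : symmetrize T = (((p.factorial : ℝ)⁻¹ : ℝ) : ℂ) • ∑ π, permuteTensor π T := by
        rw [symmetrize_eq_smul_sum, Complex.coe_smul]
      rw [h2, hamiltonian_smul, mixedEnergy_smul, hamiltonian_sum]
      simp only [mixedEnergy, Matrix.mul_sum, Matrix.trace_sum, Complex.re_sum]
    rw [h1, inv_mul_le_iff₀ hf]
    refine (Finset.sum_le_sum fun π _ => hc' π).trans (le_of_eq ?_)
    rw [Finset.sum_const, Finset.card_univ, Fintype.card_perm, Fintype.card_fin, nsmul_eq_mul]
  refine (measure_mono hsub).trans ((measure_iUnion_fintype_le _ _).trans ?_)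
  refine (Finset.sum_le_sum (g := fun _ => τ) fun π _ => ?_).trans (le_of_eq ?_)
  · rwa [← Measure.map_apply (measurable_permuteTensor π) (measurableSet_exceedanceSet B), hP]
  · rw [Finset.sum_const, Finset.card_univ, Fintype.card_perm, Fintype.card_fin, nsmul_eq_mul]

theorem realNoise_exceedance_le {B : ℝ} {τ : ℝ≥0∞}
    (h : stdGaussian (Fin p → Fin N) {g | (fun μ => (g μ : ℂ) * 1) ∈ exceedanceSet n B} ≤ τ) :
    realNoise p N (exceedanceSet n B) ≤ τ := by
  rw [realNoise_eq_map, Measure.map_apply (by fun_prop) (measurableSet_exceedanceSet B)]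
  simp only [mul_one] at h
  exact h

theorem measurableSet_mul_exceedance (ω : ℂ) (B : ℝ) :
    MeasurableSet {g : (Fin p → Fin N) → ℝ | (fun μ => (g μ : ℂ) * ω) ∈ exceedanceSet n B} :=
  (measurableSet_exceedanceSet B).preimage
    (f := fun (g : (Fin p → Fin N) → ℝ) μ => (g μ : ℂ) * ω) (by fun_prop)

theorem measurable_re_tensor : Measurable fun (G : Tensor p N) μ => (G μ).re :=
  measurable_pi_lambda _ fun μ => Complex.measurable_re.comp (measurable_pi_apply μ)

theorem measurable_im_tensor : Measurable fun (G : Tensor p N) μ => (G μ).im :=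
  measurable_pi_lambda _ fun μ => Complex.measurable_im.comp (measurable_pi_apply μ)

theorem map_mul_exceedance_le {B : ℝ} {τ : ℝ≥0∞} {ω : ℂ}
    (h : stdGaussian (Fin p → Fin N) {g | (fun μ => (g μ : ℂ) * ω) ∈ exceedanceSet n B} ≤ τ) :
    ((stdGaussian (Fin p → Fin N)).map fun g μ => Real.sqrt (1 / 2) * g μ)
      {g | (fun μ => (g μ : ℂ) * ω) ∈ exceedanceSet n (Real.sqrt (1 / 2) * B)} ≤ τ := by
  rw [Measure.map_apply (by fun_prop) (measurableSet_mul_exceedance _ _)]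
  refine le_trans (measure_mono fun g hg => ?_) h
  have h1 : (fun μ => ((Real.sqrt (1 / 2) * g μ : ℝ) : ℂ) * ω)
      = ((Real.sqrt (1 / 2) : ℝ) : ℂ) • fun μ => (g μ : ℂ) * ω := by
    ext μ
    push_cast
    simp [mul_assoc]
  simp only [Set.mem_preimage, Set.mem_ofPred_eq] at hg ⊢
  rwa [h1, exceedanceSet_smul (by positivity)] at hg

/-- Real and imaginary parts are real Gaussian tensors scaled by √(1/2). Bounding them separately
adds the thresholds to 2√(1/2) B = √2 B, which is the origin of a = 2. Their independence is not
needed. -/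
theorem complexNoise_exceedance_le {B : ℝ} {τ : ℝ≥0∞}
    (h1 : stdGaussian (Fin p → Fin N) {g | (fun μ => (g μ : ℂ) * 1) ∈ exceedanceSet n B} ≤ τ)
    (hI : stdGaussian (Fin p → Fin N)
      {g | (fun μ => (g μ : ℂ) * Complex.I) ∈ exceedanceSet n B} ≤ τ) :
    complexNoise p N (exceedanceSet n (Real.sqrt 2 * B)) ≤ 2 * τ := by
  have hB : Real.sqrt 2 * B = Real.sqrt (1 / 2) * B + Real.sqrt (1 / 2) * B := by
    have h2 : Real.sqrt 2 = 2 * Real.sqrt (1 / 2) := by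
      rw [show (2 : ℝ) = 2 ^ 2 * (1 / 2) by norm_num, Real.sqrt_mul (by norm_num),
        Real.sqrt_sq (by norm_num)]
      norm_num
    rw [h2]
    ring
  have hre := map_mul_exceedance_le h1
  have him := map_mul_exceedance_le hI
  rw [← map_re_complexNoise, Measure.map_apply measurable_re_tensor
    (measurableSet_mul_exceedance _ _)] at hre
  rw [← map_im_complexNoise, Measure.map_apply measurable_im_tensor
    (measurableSet_mul_exceedance _ _)] at him
  rw [two_mul τ]
  refine le_trans ?_ ((measure_union_le _ _).trans (add_le_add hre him))
  refine measure_mono fun G hG => ?_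
  have hsplit : G = (fun μ => ((G μ).re : ℂ) * 1) + fun μ => ((G μ).im : ℂ) * Complex.I := by
    ext μ
    simp
  rw [hB, hsplit] at hG
  simp only [Set.mem_union, Set.mem_preimage, Set.mem_ofPred_eq]
  exact mem_exceedanceSet_of_add hG

theorem noise_exceedance_le (e : Ensemble) {B : ℝ} {τ : ℝ≥0∞}
    (h1 : stdGaussian (Fin p → Fin N) {g | (fun μ => (g μ : ℂ) * 1) ∈ exceedanceSet n B} ≤ τ)
    (hI : stdGaussian (Fin p → Fin N)
      {g | (fun μ => (g μ : ℂ) * Complex.I) ∈ exceedanceSet n B} ≤ τ) :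
    noise e p N (exceedanceSet n (Real.sqrt e.factor * B)) ≤ p.factorial * (2 * τ) := by
  have hr : realNoise p N (exceedanceSet n (Real.sqrt 1 * B)) ≤ 2 * τ := by
    rw [Real.sqrt_one, one_mul]
    refine (realNoise_exceedance_le h1).trans ?_
    rw [two_mul]
    exact le_self_add
  have hc := complexNoise_exceedance_le h1 hI
  have hp : 2 * τ ≤ p.factorial * (2 * τ) := by
    refine le_mul_of_one_le_left zero_le ?_
    exact_mod_cast p.factorial_pos
  cases e with
  | real => exact hr.trans hp
  | complex => exact hc.trans hp
  | realSymmetrized => exact map_symmetrize_exceedance_le map_permuteTensor_realNoise hr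
  | complexSymmetrized => exact map_symmetrize_exceedance_le map_permuteTensor_complexNoise hc

/-! ### The pairing of the signal with the noise -/

theorem measurable_signalPairing :
    Measurable fun q : EuclideanSpace ℝ (Fin N) × Tensor p N => signalPairing q.1 q.2 := by
  simp only [signalPairing, tensorPower]
  fun_prop

theorem signalPairing_symmetrize (v : EuclideanSpace ℝ (Fin N)) (T : Tensor p N) :
    signalPairing v (symmetrize T) = signalPairing v T := by
  have hperm (π : Equiv.Perm (Fin p)) :
      ∑ μ, permuteTensor π T μ * tensorPower p v μ = ∑ μ, T μ * tensorPower p v μ := by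
    refine Fintype.sum_equiv (Equiv.arrowCongr π.symm (Equiv.refl (Fin N))) _ _ fun μ => ?_
    have : (Equiv.arrowCongr π.symm (Equiv.refl (Fin N))) μ = fun a => μ (π a) := by
      ext a; simp [Equiv.arrowCongr]
    rw [this, permuteTensor, tensorPower, tensorPower,
      Equiv.prod_comp π fun a => ((v (μ a) : ℝ) : ℂ)]
  have hf : (p.factorial : ℂ) ≠ 0 := by exact_mod_cast p.factorial_ne_zero
  have h : ∑ μ, symmetrize T μ * tensorPower p v μ = ∑ μ, T μ * tensorPower p v μ := by
    have h1 (μ : Fin p → Fin N) : symmetrize T μ * tensorPower p v μ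
        = (p.factorial : ℂ)⁻¹ * ∑ π, permuteTensor π T μ * tensorPower p v μ := by
      rw [symmetrize, mul_assoc, Finset.sum_mul]
      rfl
    rw [Finset.sum_congr rfl fun μ _ => h1 μ, ← Finset.mul_sum, Finset.sum_comm,
      Finset.sum_congr rfl fun π _ => hperm π, Finset.sum_const, Finset.card_univ,
      Fintype.card_perm, Fintype.card_fin, nsmul_eq_mul, inv_mul_cancel_left₀ hf]
  rw [signalPairing, signalPairing, h]

theorem measurableSet_lt_abs_signalPairing (v : EuclideanSpace ℝ (Fin N)) (t : ℝ) :
    MeasurableSet {G : Tensor p N | t < |signalPairing v G|} :=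
  measurableSet_lt measurable_const
    (measurable_signalPairing.comp (measurable_const.prodMk measurable_id)).abs

theorem noise_lt_abs_signalPairing_le (e : Ensemble) {v : EuclideanSpace ℝ (Fin N)}
    (hv : ‖v‖ = Real.sqrt N) {t : ℝ} (ht : 0 < t) :
    noise e p N {G | t < |signalPairing v G|} ≤ ENNReal.ofReal ((N : ℝ) ^ p / t ^ 2) := by
  have h0 := stdGaussian_lt_abs_sum_le (fun μ : Fin p → Fin N => ∏ a, v (μ a)) ht
  rw [sum_tensorPower_sq hv] at h0
  have hr : realNoise p N {G | t < |signalPairing v G|} ≤ ENNReal.ofReal ((N : ℝ) ^ p / t ^ 2) := by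
    rw [realNoise_eq_map, Measure.map_apply (by fun_prop) (measurableSet_lt_abs_signalPairing v t)]
    refine le_trans (measure_mono fun g hg => ?_) h0
    simp only [Set.mem_preimage, Set.mem_ofPred_eq, signalPairing_eq, Complex.ofReal_re] at hg ⊢
    exact hg
  have hc : complexNoise p N {G | t < |signalPairing v G|}
      ≤ ENNReal.ofReal ((N : ℝ) ^ p / t ^ 2) := by
    have hm : MeasurableSet {g : (Fin p → Fin N) → ℝ | t < |∑ μ, g μ * ∏ a, v (μ a)|} :=
      measurableSet_lt measurable_const (by fun_prop)
    have h1 : complexNoise p N {G | t < |signalPairing v G|}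
        = (complexNoise p N).map (fun G μ => (G μ).re)
          {g | t < |∑ μ, g μ * ∏ a, v (μ a)|} := by
      rw [Measure.map_apply measurable_re_tensor hm]
      simp only [signalPairing_eq]
      rfl
    rw [h1, map_re_complexNoise, Measure.map_apply (by fun_prop) hm]
    refine le_trans (measure_mono fun g hg => ?_) h0
    simp only [Set.mem_preimage, Set.mem_ofPred_eq, mul_assoc, ← Finset.mul_sum, abs_mul] at hg ⊢
    refine hg.trans_le (mul_le_of_le_one_left (abs_nonneg _) ?_)
    rw [abs_of_nonneg (Real.sqrt_nonneg _), Real.sqrt_le_one]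
    norm_num
  have hsymm (P : Measure (Tensor p N))
      (h : P {G | t < |signalPairing v G|} ≤ ENNReal.ofReal ((N : ℝ) ^ p / t ^ 2)) :
      P.map symmetrize {G | t < |signalPairing v G|} ≤ ENNReal.ofReal ((N : ℝ) ^ p / t ^ 2) := by
    rw [Measure.map_apply measurable_symmetrize (measurableSet_lt_abs_signalPairing v t)]
    simpa only [Set.preimage_ofPred_eq, signalPairing_symmetrize] using h
  cases e with
  | real => exact hr
  | complex => exact hc
  | realSymmetrized => exact hsymm _ hr
  | complexSymmetrized => exact hsymm _ hc

instance (e : Ensemble) (p N : ℕ) : IsProbabilityMeasure (noise e p N) := by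
  cases e with
  | real => exact inferInstanceAs (IsProbabilityMeasure (realNoise p N))
  | complex => exact inferInstanceAs (IsProbabilityMeasure (complexNoise p N))
  | realSymmetrized => exact Measure.isProbabilityMeasure_map measurable_symmetrize.aemeasurable
  | complexSymmetrized => exact Measure.isProbabilityMeasure_map measurable_symmetrize.aemeasurable

/-! ### The joint law -/

theorem jointLaw_norm_ne {e : Ensemble} {prior : ∀ N : ℕ, Measure (EuclideanSpace ℝ (Fin N))}
    (hv : ∀ᵐ v ∂(prior N), ‖v‖ = Real.sqrt N) :
    jointLaw e p prior N {q | ‖q.1‖ ≠ Real.sqrt N} = 0 := by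
  have : {q : EuclideanSpace ℝ (Fin N) × Tensor p N | ‖q.1‖ ≠ Real.sqrt N}
      = {v | ‖v‖ ≠ Real.sqrt N} ×ˢ Set.univ := by
    ext q
    simp
  rw [jointLaw, this, Measure.prod_prod, ae_iff.1 hv, zero_mul]

theorem jointLaw_noise_le (e : Ensemble) {prior : ∀ N : ℕ, Measure (EuclideanSpace ℝ (Fin N))}
    [IsProbabilityMeasure (prior N)] (B : Set (Tensor p N)) :
    jointLaw e p prior N {q | q.2 ∈ B} ≤ noise e p N B := by
  have : {q : EuclideanSpace ℝ (Fin N) × Tensor p N | q.2 ∈ B} = Set.univ ×ˢ B := by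
    ext q
    simp
  rw [jointLaw, this, Measure.prod_prod, measure_univ, one_mul]

/-- By independence one may fix v and integrate afterwards; the bound depends on v only through its
norm, so the prior is arbitrary. -/
theorem jointLaw_lt_abs_signalPairing_le (e : Ensemble)
    {prior : ∀ N : ℕ, Measure (EuclideanSpace ℝ (Fin N))} [IsProbabilityMeasure (prior N)]
    (hv : ∀ᵐ v ∂(prior N), ‖v‖ = Real.sqrt N) {t : ℝ} (ht : 0 < t) :
    jointLaw e p prior N {q | t < |signalPairing q.1 q.2|}
      ≤ ENNReal.ofReal ((N : ℝ) ^ p / t ^ 2) := by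
  have hm : MeasurableSet
      {q : EuclideanSpace ℝ (Fin N) × Tensor p N | t < |signalPairing q.1 q.2|} :=
    measurableSet_lt measurable_const measurable_signalPairing.abs
  rw [jointLaw, Measure.prod_apply hm]
  refine (lintegral_mono_ae (g := fun _ => ENNReal.ofReal ((N : ℝ) ^ p / t ^ 2)) ?_).trans ?_
  · filter_upwards [hv] with v hv
    exact noise_lt_abs_signalPairing_le e hv ht
  · simp

end Ensembles

end SpikedTensor

namespace SpikedTensor

section Recovery

variable {N n p : ℕ} {v : EuclideanSpace ℝ (Fin N)} {G : Tensor p N} {lam E c t : ℝ}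

/-! ### Consequences of a bound on the noise -/

theorem numEmbeddings_eq (n k : ℕ) : numEmbeddings n k = (n.descFactorial k : ℝ) := by
  rw [numEmbeddings, Fintype.card_embedding_eq, Fintype.card_fin, Fintype.card_fin]

theorem numEmbeddings_eq_mul_choose (n k : ℕ) :
    numEmbeddings n k = (k.factorial : ℝ) * n.choose k := by
  rw [numEmbeddings_eq, Nat.descFactorial_eq_factorial_mul_choose, Nat.cast_mul]

theorem E0_eq (p N n : ℕ) (lam : ℝ) :
    E0 p N n lam = lam * (numEmbeddings n (p / 2) * (N : ℝ) ^ (p / 2)) := by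
  rw [E0, numEmbeddings_eq_mul_choose]
  ring

theorem one_le_numEmbeddings {k : ℕ} (hkn : k ≤ n) : 1 ≤ numEmbeddings n k := by
  rw [numEmbeddings_eq, Nat.one_le_cast, Nat.one_le_iff_ne_zero, Ne,
    Nat.descFactorial_eq_zero_iff_lt]
  exact not_lt.2 hkn

theorem E0_pos (hN : 0 < N) (hkn : p / 2 ≤ n) (hlam : 0 < lam) : 0 < E0 p N n lam := by
  have := one_le_numEmbeddings hkn
  rw [E0_eq]
  positivity

/-- The master inequality: outside the exceedance set, energy above E can come only from overlap
with the signal. -/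
theorem mixedEnergy_spiked_le (hp : Even p) (hp0 : 0 < p) (hN : 0 < N) (hkn : p / 2 ≤ n)
    (hlam : 0 < lam) (hv : ‖v‖ = Real.sqrt N) (hG : G ∉ exceedanceSet n E) {σ : Operator N n}
    (hσ : IsDensityMatrix σ) : mixedEnergy (hamiltonian n (spiked lam v G)) σ
      ≤ E0 p N n lam * overlap v (singleParticle σ) + E := by
  have hn : 0 < n := by
    obtain ⟨m, rfl⟩ := hp
    omega
  have h1 := mixedEnergy_tensorPower_le hp hp0 hn hN hv hσ.1
  have h2 : mixedEnergy (hamiltonian n G) σ ≤ E := not_lt.1 fun h => hG ⟨σ, hσ, h⟩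
  rw [mixedEnergy_spiked, E0_eq, mul_assoc]
  gcongr

theorem le_overlap_of_le_mixedEnergy (hp : Even p) (hp0 : 0 < p) (hN : 0 < N) (hkn : p / 2 ≤ n)
    (hlam : 0 < lam) (hv : ‖v‖ = Real.sqrt N) (hG : G ∉ exceedanceSet n E) {σ : Operator N n}
    (hσ : IsDensityMatrix σ)
    (h : (1 + c) * E ≤ mixedEnergy (hamiltonian n (spiked lam v G)) σ) :
    c * (E / E0 p N n lam) ≤ overlap v (singleParticle σ) := by
  have h1 := mixedEnergy_spiked_le hp hp0 hN hkn hlam hv hG hσ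
  rw [← mul_div_assoc, div_le_iff₀ (E0_pos hN hkn hlam)]
  linarith

/-- At the cutoff the master inequality leaves E₀ · overlap ≥ (E₀ - E)/2, and E ≤ E₀/(1+c). -/
theorem le_overlap_of_mean_le_mixedEnergy (hp : Even p) (hp0 : 0 < p) (hN : 0 < N)
    (hkn : p / 2 ≤ n) (hlam : 0 < lam) (hv : ‖v‖ = Real.sqrt N) (hG : G ∉ exceedanceSet n E)
    (hc : 0 < c) (hE : (1 + c) * E ≤ E0 p N n lam) {σ : Operator N n} (hσ : IsDensityMatrix σ)
    (h : (E0 p N n lam + E) / 2 ≤ mixedEnergy (hamiltonian n (spiked lam v G)) σ) :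
    1 / 2 * (c / (1 + c)) ≤ overlap v (singleParticle σ) := by
  have h1 := mixedEnergy_spiked_le hp hp0 hN hkn hlam hv hG hσ
  have h0 := E0_pos hN hkn hlam
  have h2 : E ≤ E0 p N n lam / (1 + c) := by
    rw [le_div_iff₀ (by positivity)]
    linarith
  have h3 : E0 p N n lam * (1 / 2 * (c / (1 + c)))
      = (E0 p N n lam - E0 p N n lam / (1 + c)) / 2 := by
    field_simp
    ring
  refine le_of_mul_le_mul_left ?_ h0
  rw [h3]
  linarith

/-- The product state has energy E₀ plus a fluctuation, and E₀ exceeds the cutoff by (E₀ - E)/2 ≥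
cE/2, which `hgap` makes larger than the fluctuation. So V has an eigenvalue above the cutoff; its
normalized eigenvector is a possible output. -/
theorem algorithmOutputs_spec (hp : Even p) (hp0 : 0 < p) (hN : 0 < N) (hkn : p / 2 ≤ n)
    (hlam : 0 < lam) (hv : ‖v‖ = Real.sqrt N) (hG : G ∉ exceedanceSet n E)
    (hc : 0 < c) (hE : (1 + c) * E ≤ E0 p N n lam) (ht : |signalPairing v G| ≤ t)
    (hgap : numEmbeddings n (p / 2) * (t / (N : ℝ) ^ (p / 2)) < c * E / 2)
    {V : Submodule ℂ (State N n)}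
    (hV : ∀ Φ ∈ V, Matrix.toEuclideanLin (hamiltonian n (spiked lam v G)) Φ ∈ V)
    (hV' : productState n v ∈ V) :
    (algorithmOutputs V ((E0 p N n lam + E) / 2) (spiked lam v G)).Nonempty ∧
      ∀ ρ ∈ algorithmOutputs V ((E0 p N n lam + E) / 2) (spiked lam v G),
        IsDensityMatrix ρ ∧ 1 / 2 * (c / (1 + c)) ≤ overlap v ρ := by
  have hn : 0 < n := by
    obtain ⟨m, rfl⟩ := hp
    omega
  have hH := isHermitian_hamiltonian (n := n) (spiked lam v G)
  have hlt : (E0 p N n lam + E) / 2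
      < energy (hamiltonian n (spiked lam v G)) (productState n v) := by
    have hN' : (0 : ℝ) < (N : ℝ) ^ (p / 2) := by positivity
    rw [energy_eq_mixedEnergy, mixedEnergy_spiked, mixedEnergy_productState hp hN hv,
      mixedEnergy_productState hp hN hv, signalPairing_tensorPower hp hv,
      mul_div_cancel_right₀ _ hN'.ne', ← E0_eq]
    have h1 : -(numEmbeddings n (p / 2) * (t / (N : ℝ) ^ (p / 2)))
        ≤ numEmbeddings n (p / 2) * (signalPairing v G / (N : ℝ) ^ (p / 2)) := by
      rw [← mul_neg, ← neg_div]
      have := numEmbeddings_nonneg n (p / 2)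
      have := neg_le_of_abs_le ht
      gcongr
    linarith
  have hdet : Detects V ((E0 p N n lam + E) / 2) (spiked lam v G) :=
    exists_hasEigenvector_of_lt_energy hH hV hV' (norm_productState hN hv) hlt
  refine ⟨?_, ?_⟩
  · obtain ⟨a, ha, Φ, hΦ, hΦa⟩ := id hdet
    have hΦ0 : ‖Φ‖ ≠ 0 := norm_ne_zero_iff.2 hΦa.2
    refine ⟨_, hdet, ((‖Φ‖ : ℂ)⁻¹) • Φ, V.smul_mem _ hΦ, Submodule.smul_mem _ _ ?_, ?_, rfl⟩
    · exact (le_iSup (fun a : {a : ℝ // (E0 p N n lam + E) / 2 ≤ a} =>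
        Module.End.eigenspace (Matrix.toEuclideanLin (hamiltonian n (spiked lam v G)))
          ((a : ℝ) : ℂ)) ⟨a, ha.le⟩) hΦa.1
    · rw [norm_smul, norm_inv, Complex.norm_real, norm_norm, inv_mul_cancel₀ hΦ0]
  · rintro ρ ⟨_, Ψ, _, hΨ, hΨ1, rfl⟩
    refine ⟨isDensityMatrix_singleParticle hn hΨ1, ?_⟩
    refine le_overlap_of_mean_le_mixedEnergy hp hp0 hN hkn hlam hv hG hc hE
      (isDensityMatrix_pureState hΨ1) ?_
    rw [← energy_eq_mixedEnergy]
    exact le_energy_of_mem_upperEigenspace hH hΨ hΨ1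

end Recovery

/-! ### Asymptotics -/

section Asymptotics

variable {p : ℕ} {n : ℕ → ℕ} {J : ℕ → ℝ}

theorem tendsto_div_rpow {f : ℕ → ℝ} {D a : ℝ} (h0 : ∀ N, 0 ≤ f N)
    (hf : ∀ᶠ N : ℕ in atTop, f N ≤ D * (N : ℝ) ^ (1 / 8 : ℝ)) (ha : 1 / 8 < a) :
    Tendsto (fun N : ℕ => f N / (N : ℝ) ^ a) atTop (𝓝 0) := by
  have h1 : Tendsto (fun N : ℕ => D * (N : ℝ) ^ (-(a - 1 / 8))) atTop (𝓝 0) := by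
    simpa using ((tendsto_rpow_neg_atTop (sub_pos.2 ha)).comp
      tendsto_natCast_atTop_atTop).const_mul D
  refine squeeze_zero' (Eventually.of_forall fun N => div_nonneg (h0 N) (by positivity)) ?_ h1
  filter_upwards [hf, eventually_gt_atTop 0] with N hN hN0
  have hN0' : (0 : ℝ) < N := by exact_mod_cast hN0
  rwa [div_le_iff₀ (by positivity), mul_assoc, ← Real.rpow_add hN0',
    show -(a - 1 / 8) + a = 1 / 8 by ring]

/-- The exponent 1/(4p) is chosen so that n^{p/2} = O(N^{1/8}); as p ≥ 2, the same holds for n. -/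
theorem exists_le_rpow (hp : Even p) (hp0 : 0 < p)
    (hn : (fun N => (n N : ℝ)) =O[atTop] fun N : ℕ => (N : ℝ) ^ (1 / (4 * p : ℝ))) :
    ∃ D : ℝ, (∀ᶠ N : ℕ in atTop, (n N : ℝ) ≤ D * (N : ℝ) ^ (1 / 8 : ℝ)) ∧
      ∀ᶠ N : ℕ in atTop, numEmbeddings (n N) (p / 2) ≤ D * (N : ℝ) ^ (1 / 8 : ℝ) := by
  obtain ⟨C, hC, h⟩ := hn.exists_pos
  rw [IsBigOWith] at h
  obtain ⟨k, rfl⟩ := hp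
  have hk : (1 : ℝ) ≤ k := by
    have : 1 ≤ k := by omega
    exact_mod_cast this
  have hk2 : (k + k) / 2 = k := by omega
  refine ⟨max C (C ^ k), ?_, ?_⟩
  all_goals
    filter_upwards [h, eventually_ge_atTop 1] with N hN hN1
    have hN1' : (1 : ℝ) ≤ N := by exact_mod_cast hN1
    rw [Real.norm_of_nonneg (by positivity), Real.norm_of_nonneg (by positivity)] at hN
  · refine hN.trans ?_
    gcongr
    · exact le_max_left _ _
    · push_cast
      linarith
  · rw [hk2, numEmbeddings_eq]
    calc ((n N).descFactorial k : ℝ) ≤ (n N : ℝ) ^ k := by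
          exact_mod_cast Nat.descFactorial_le_pow _ _
      _ ≤ (C * (N : ℝ) ^ (1 / (4 * (k + k : ℕ) : ℝ))) ^ k := by gcongr
      _ = C ^ k * (N : ℝ) ^ (1 / 8 : ℝ) := by
          rw [mul_pow, ← Real.rpow_natCast, ← Real.rpow_natCast, ← Real.rpow_mul (by positivity)]
          congr 2
          push_cast
          field_simp
          ring
      _ ≤ _ := by
          gcongr
          exact le_max_right _ _

theorem leadingJ_eq (e : Ensemble) (p n : ℕ) :
    leadingJ e p n = e.factor * (numEmbeddings n (p / 2) / (n : ℝ) ^ (p / 2)) := by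
  rw [numEmbeddings_eq_mul_choose]
  cases e <;> rfl

theorem Ensemble.one_le_factor (e : Ensemble) : 1 ≤ e.factor := by
  cases e <;> norm_num [Ensemble.factor]

/-- The bound is uniform in m ≥ k, including bounded m. It keeps `leadingJ` away from 0, so that the
additive o(1) in J is a small relative error. -/
theorem inv_pow_le_numEmbeddings_div {k m : ℕ} (hk : 0 < k) (hkm : k ≤ m) :
    ((k : ℝ) ^ k)⁻¹ ≤ numEmbeddings m k / (m : ℝ) ^ k := by
  have hm : 0 < m := hk.trans_le hkm
  rw [le_div_iff₀ (by positivity), inv_mul_le_iff₀ (by positivity), numEmbeddings_eq]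
  have h1 := Nat.pow_sub_le_descFactorial m k
  have h2 : m ≤ k * (m + 1 - k) := by
    obtain ⟨j, rfl⟩ := Nat.exists_eq_add_of_le hkm
    rw [show k + j + 1 - k = j + 1 by omega]
    nlinarith
  calc (m : ℝ) ^ k ≤ ((k * (m + 1 - k) : ℕ) : ℝ) ^ k := by
        gcongr
    _ = (k : ℝ) ^ k * (((m + 1 - k) ^ k : ℕ) : ℝ) := by
        push_cast
        rw [mul_pow]
    _ ≤ _ := by
        gcongr

theorem Emax_eq (hp : Even p) {N m : ℕ} {J : ℝ} (hJ : 0 ≤ J) (hN : 1 ≤ N) :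
    Emax p N m J = Real.sqrt
      (2 * J * Real.log N * ((m : ℝ) ^ (p / 2) * m) * (N : ℝ) ^ (p / 2)) := by
  obtain ⟨k, rfl⟩ := hp
  have hk : (k + k) / 2 = k := by omega
  have hlog : 0 ≤ Real.log N := Real.log_natCast_nonneg N
  rw [Real.sqrt_mul (by positivity), Real.sqrt_mul (by positivity), Emax, hk]
  congr 1
  · congr 1
    rw [Real.sqrt_eq_rpow, ← pow_succ, ← Real.rpow_natCast, ← Real.rpow_mul (by positivity)]
    congr 1
    push_cast
    ring
  · rw [Real.sqrt_eq_rpow, ← Real.rpow_natCast, ← Real.rpow_mul (by positivity)]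
    congr 1
    push_cast
    ring

theorem maxWeight_eq {N : ℕ} (hN : 0 < N) (m : ℕ) {k : ℕ} (hk : 0 < k) :
    maxWeight N m k = numEmbeddings m k * (N : ℝ) ^ k
      * (1 / 2 * (1 + 2 * (numEmbeddings m k / N) + (1 + m / (N : ℝ)) ^ k)) := by
  have hN' : (0 : ℝ) < N := by exact_mod_cast hN
  obtain ⟨j, rfl⟩ := Nat.exists_eq_succ_of_ne_zero hk.ne'
  have h1 : (N : ℝ) + m = N * (1 + m / N) := by field_simp
  rw [maxWeight, h1, mul_pow, Nat.succ_eq_add_one, Nat.add_sub_cancel]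
  field_simp
  ring

/-- Apart from the factor e^{-1/1000}, the squares of the two sides agree up to a factor tending to
1. The fixed factor makes the inequality hold for all large N. -/
theorem eventually_noiseScale_le_Emax (hp : Even p) (hp0 : 0 < p) (e : Ensemble)
    (hn : (fun N => (n N : ℝ)) =O[atTop] fun N : ℕ => (N : ℝ) ^ (1 / (4 * p : ℝ)))
    (hkn : ∀ᶠ N in atTop, p / 2 ≤ n N)
    (hJ : Tendsto (fun N => J N - leadingJ e p (n N)) atTop (𝓝 0)) :
    ∀ᶠ N in atTop, Real.sqrt e.factor * noiseScale N (n N) (p / 2) ≤ Emax p N (n N) (J N) := by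
  have hk : 0 < p / 2 := by
    obtain ⟨m, rfl⟩ := hp
    omega
  obtain ⟨D, hD1, hD2⟩ := exists_le_rpow hp hp0 hn
  have t1 := tendsto_div_rpow (a := 1) (fun N => Nat.cast_nonneg _) hD1 (by norm_num)
  have t2 := tendsto_div_rpow (a := 1) (fun N => numEmbeddings_nonneg _ _) hD2 (by norm_num)
  simp only [Real.rpow_one] at t1 t2
  have t3 : Tendsto (fun N : ℕ => 1 / 2 * (1 + 2 * (numEmbeddings (n N) (p / 2) / N)
      + (1 + n N / (N : ℝ)) ^ (p / 2)) * Real.exp (-(1 / 1000))) atTop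
      (𝓝 (1 / 2 * (1 + 2 * 0 + (1 + 0) ^ (p / 2)) * Real.exp (-(1 / 1000)))) :=
    ((((t2.const_mul 2).const_add 1).add ((t1.const_add 1).pow _)).const_mul _).mul_const _
  rw [mul_zero, add_zero, one_pow, show (1 / 2 * (1 + 1) : ℝ) = 1 by norm_num,
    one_mul] at t3
  have he : Real.exp (-(1 / 1000)) < 1 := by
    rw [Real.exp_lt_one_iff]
    norm_num
  -- Half of the available slack is spent on the corrections to `maxWeight`, which give r
  -- e^{-1/1000} ≤ 1 - η. The other half goes to J: with u ≥ b one has u(1 - η) ≤ u - bη ≤ J.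
  set η := (1 - Real.exp (-(1 / 1000))) / 2 with hη
  have hη0 : 0 < η := by linarith
  have hη1 : Real.exp (-(1 / 1000)) < 1 - η := by linarith
  set b : ℝ := (((p / 2 : ℕ) : ℝ) ^ (p / 2))⁻¹ with hb
  have hb0 : 0 < b := by positivity
  filter_upwards [hkn, eventually_ge_atTop 1, t3.eventually (eventually_le_nhds hη1),
    hJ.eventually (eventually_ge_nhds (show -(b * η) < 0 by simpa using mul_pos hb0 hη0))]
    with N hN hN1 hr hJN
  have hn0 : 0 < n N := hk.trans_le hN
  have hbu : b ≤ leadingJ e p (n N) := by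
    rw [leadingJ_eq]
    exact (inv_pow_le_numEmbeddings_div hk hN).trans
      (le_mul_of_one_le_left (by have := numEmbeddings_nonneg (n N) (p / 2); positivity)
        e.one_le_factor)
  set u := leadingJ e p (n N) with hu
  set r := 1 / 2 * (1 + 2 * (numEmbeddings (n N) (p / 2) / N)
      + (1 + n N / (N : ℝ)) ^ (p / 2)) with hr'
  have hur : u * (r * Real.exp (-(1 / 1000))) ≤ J N := by
    calc u * (r * Real.exp (-(1 / 1000))) ≤ u * (1 - η) := by gcongr; linarith
      _ ≤ u - b * η := by nlinarith
      _ ≤ J N := by linarith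
  have hr0 : 0 ≤ r := by
    have := numEmbeddings_nonneg (n N) (p / 2)
    positivity
  have hJ0 : 0 ≤ J N := le_trans (by have := hb0.trans_le hbu; positivity) hur
  have hlog : 0 ≤ Real.log N := Real.log_natCast_nonneg N
  have ha := e.one_le_factor
  rw [Emax_eq hp hJ0 hN1, noiseScale, ← Real.sqrt_mul (by linarith)]
  refine Real.sqrt_le_sqrt ?_
  have hun : e.factor * numEmbeddings (n N) (p / 2) = u * (n N : ℝ) ^ (p / 2) := by
    rw [hu, leadingJ_eq]
    field_simp
  rw [maxWeight_eq hN1 _ hk, ← hr']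
  calc _ = e.factor * numEmbeddings (n N) (p / 2) * (2 * (N : ℝ) ^ (p / 2) * (n N * Real.log N))
        * (r * Real.exp (-(1 / 1000))) := by ring
    _ = u * (r * Real.exp (-(1 / 1000))) * (2 * Real.log N * ((n N : ℝ) ^ (p / 2) * n N)
        * (N : ℝ) ^ (p / 2)) := by rw [hun]; ring
    _ ≤ J N * (2 * Real.log N * ((n N : ℝ) ^ (p / 2) * n N) * (N : ℝ) ^ (p / 2)) := by gcongr
    _ = _ := by ring

/-- A crude lower bound on the energy scale, sufficient to dominate fluctuations of order N^{1/4}.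
-/
theorem sqrt_le_noiseScale {N m k : ℕ} (hk : 0 < k) (hkm : k ≤ m) (hN : 1 ≤ Real.log N) :
    Real.sqrt N ≤ noiseScale N m k := by
  have hN0 : 0 < N := by
    rcases Nat.eq_zero_or_pos N with rfl | h
    · norm_num at hN
    · exact h
  have hN' : (1 : ℝ) ≤ N := by exact_mod_cast hN0
  have hM := one_le_numEmbeddings hkm
  have hm : (1 : ℝ) ≤ m := by exact_mod_cast hk.trans_le hkm
  have he : (1 / 2 : ℝ) ≤ Real.exp (-(1 / 1000)) := by
    have := Real.add_one_le_exp (-(1 / 1000) : ℝ)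
    linarith
  refine Real.sqrt_le_sqrt ?_
  have h1 : (N : ℝ) ≤ maxWeight N m k := by
    have h3 : (1 : ℝ) ≤ (1 + m / (N : ℝ)) ^ k := one_le_pow₀ (by simp; positivity)
    have h4 : 0 ≤ numEmbeddings m k / N := by positivity
    rw [maxWeight_eq hN0 _ hk]
    calc (N : ℝ) = 1 * (N : ℝ) ^ 1 * 1 := by ring
      _ ≤ _ := by
        gcongr
        · exact hk
        · linarith
  have h2 : 0 ≤ maxWeight N m k := (Nat.cast_nonneg N).trans h1
  calc (N : ℝ) = 2 * N * (1 * 1) * (1 / 2) := by ring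
    _ ≤ _ := by gcongr

end Asymptotics

end SpikedTensor

namespace SpikedTensor

/-! ### The good event, its probability and recovery -/

section HighProbability

variable {p : ℕ} {n : ℕ → ℕ} {J : ℕ → ℝ}

/-- The event that the signal is normalized, that no state has noise energy above `E`, and that the
pairing of signal and noise is at most `t`. -/
def goodEvent (p N n : ℕ) (E t : ℝ) : Set (EuclideanSpace ℝ (Fin N) × Tensor p N) :=
  {q | ‖q.1‖ = Real.sqrt N ∧ q.2 ∉ exceedanceSet n E ∧ |signalPairing q.1 q.2| ≤ t}

theorem jointLaw_compl_goodEvent_le (e : Ensemble) {N : ℕ}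
    {prior : ∀ N : ℕ, Measure (EuclideanSpace ℝ (Fin N))} [IsProbabilityMeasure (prior N)]
    (hv : ∀ᵐ v ∂(prior N), ‖v‖ = Real.sqrt N) (n : ℕ) (E : ℝ) {t : ℝ} (ht : 0 < t) :
    jointLaw e p prior N (goodEvent p N n E t)ᶜ
      ≤ noise e p N (exceedanceSet n E) + ENNReal.ofReal ((N : ℝ) ^ p / t ^ 2) := by
  have hsub : (goodEvent p N n E t)ᶜ ⊆ ({q | ‖q.1‖ ≠ Real.sqrt N} ∪ {q | q.2 ∈ exceedanceSet n E})
      ∪ {q | t < |signalPairing q.1 q.2|} := by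
    intro q hq
    by_contra! hc
    simp only [Set.mem_union, Set.mem_ofPred_eq, not_or, not_not, not_lt] at hc
    exact hq ⟨hc.1.1, hc.1.2, hc.2⟩
  refine (measure_mono hsub).trans ((measure_union_le _ _).trans (add_le_add
    ((measure_union_le _ _).trans ?_) (jointLaw_lt_abs_signalPairing_le e hv ht)))
  rw [jointLaw_norm_ne hv, zero_add]
  exact jointLaw_noise_le e _

/-- The second moment of the pairing is at most N^p, so exceeding N^{p/2} N^{1/8} has probability at
most N^{-1/4}. The noise energy is controlled by the tail bound with L = n log N, which tends to
infinity even if n stays bounded. -/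
theorem withHighProbability_goodEvent (hp : Even p) (hp0 : 0 < p) (e : Ensemble)
    {prior : ∀ N : ℕ, Measure (EuclideanSpace ℝ (Fin N))}
    (hn : (fun N => (n N : ℝ)) =O[atTop] fun N : ℕ => (N : ℝ) ^ (1 / (4 * p : ℝ)))
    (hkn : ∀ᶠ N in atTop, p / 2 ≤ n N)
    (hJ : Tendsto (fun N => J N - leadingJ e p (n N)) atTop (𝓝 0))
    (hprob : ∀ N : ℕ, IsProbabilityMeasure (prior N))
    (hv : ∀ N : ℕ, ∀ᵐ v ∂(prior N), ‖v‖ = Real.sqrt N) :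
    WithHighProbability (jointLaw e p prior) fun N =>
      goodEvent p N (n N) (Emax p N (n N) (J N)) ((N : ℝ) ^ (p / 2) * (N : ℝ) ^ (1 / 8 : ℝ)) := by
  have hk : 0 < p / 2 := by
    obtain ⟨m, rfl⟩ := hp
    omega
  obtain ⟨D, hD1, hD2⟩ := exists_le_rpow hp hp0 hn
  have hlog : Tendsto (fun N : ℕ => Real.log N) atTop atTop :=
    Real.tendsto_log_atTop.comp tendsto_natCast_atTop_atTop
  have hL : Tendsto (fun N => n N * Real.log N) atTop atTop := by
    refine tendsto_atTop_mono' _ ?_ hlog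
    filter_upwards [hkn] with N hN
    have : (1 : ℝ) ≤ n N := by exact_mod_cast hk.trans_le hN
    exact le_mul_of_one_le_left (Real.log_natCast_nonneg N) this
  have t1 : Tendsto (fun N : ℕ => (p.factorial : ℝ≥0∞)
      * (2 * ENNReal.ofReal (tailBound (n N * Real.log N)))
      + ENNReal.ofReal ((N : ℝ) ^ (-(1 / 4) : ℝ))) atTop (𝓝 0) := by
    have h1 := ENNReal.tendsto_ofReal (tendsto_tailBound.comp hL)
    have h2 := ENNReal.tendsto_ofReal ((tendsto_rpow_neg_atTop
      (show (0 : ℝ) < 1 / 4 by norm_num)).comp tendsto_natCast_atTop_atTop)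
    rw [ENNReal.ofReal_zero] at h1 h2
    have h3 := ENNReal.Tendsto.const_mul (a := 2) h1 (Or.inr (by simp))
    have h4 := ENNReal.Tendsto.const_mul (a := (p.factorial : ℝ≥0∞)) h3 (Or.inr (by simp))
    simpa using h4.add h2
  refine tendsto_of_tendsto_of_tendsto_of_le_of_le' tendsto_const_nhds t1
    (Eventually.of_forall fun _ => zero_le) ?_
  have s1 := (tendsto_div_rpow (a := 1 / 2) (fun N => Nat.cast_nonneg (n N)) hD1
    (by norm_num)).eventually (eventually_le_nhds one_pos)
  have s2 := (tendsto_div_rpow (a := 1) (fun N => numEmbeddings_nonneg (n N) (p / 2)) hD2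
    (by norm_num)).eventually (eventually_le_nhds (show (0 : ℝ) < 1 / 2 by norm_num))
  filter_upwards [hkn, eventually_ge_atTop 1, s1, s2, hlog.eventually_ge_atTop (16 * Real.log 2),
    hL.eventually_ge_atTop 1, eventually_noiseScale_le_Emax hp hp0 e hn hkn hJ]
    with N hN hN1 hs1 hs2 hs3 hs4 hE
  have hN' : (0 : ℝ) < N := by exact_mod_cast hN1
  have := hprob N
  refine (jointLaw_compl_goodEvent_le e (hv N) (n N) _ (by positivity)).trans ?_
  refine add_le_add ?_ (ENNReal.ofReal_le_ofReal (le_of_eq ?_))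
  · have hsub : (exceedanceSet (n N) (Emax p N (n N) (J N)) : Set (Tensor p N))
        ⊆ exceedanceSet (n N) (Real.sqrt e.factor * noiseScale N (n N) (p / 2)) :=
      fun T ⟨σ, hσ, hlt⟩ => ⟨σ, hσ, hE.trans_lt hlt⟩
    rw [div_le_iff₀ (by positivity), one_mul, ← Real.sqrt_eq_rpow] at hs1
    rw [Real.rpow_one, div_le_iff₀ hN'] at hs2
    refine (measure_mono hsub).trans (noise_exceedance_le e
      (stdGaussian_exceedance_le (ε := 1) hp hp0 hN hN1 hs1 (by linarith) hs4 (by linarith)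
        (by simp) (by simp) (by simp))
      (stdGaussian_exceedance_le (ε := -1) hp hp0 hN hN1 hs1 (by linarith) hs4 (by linarith)
        (by simp) (by simp) (by simp)))
  · have hpp : (N : ℝ) ^ p = ((N : ℝ) ^ (p / 2)) ^ 2 := by
      rw [← pow_mul, Nat.div_mul_cancel hp.two_dvd]
    have h8 : ((N : ℝ) ^ (1 / 8 : ℝ)) ^ 2 = (N : ℝ) ^ (1 / 4 : ℝ) := by
      rw [← Real.rpow_natCast, ← Real.rpow_mul hN'.le]
      norm_num
    rw [mul_pow, ← hpp, h8, Real.rpow_neg hN'.le, div_mul_eq_div_div, div_self (by positivity),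
      one_div]

theorem WithHighProbability.mono {Ω : ℕ → Type} [∀ N, MeasurableSpace (Ω N)]
    {P : ∀ N, Measure (Ω N)} {A B : ∀ N, Set (Ω N)} (h : WithHighProbability P A)
    (hAB : ∀ᶠ N in atTop, A N ⊆ B N) : WithHighProbability P B :=
  tendsto_of_tendsto_of_tendsto_of_le_of_le' tendsto_const_nhds h
    (Eventually.of_forall fun _ => zero_le)
    (hAB.mono fun _ hN => measure_mono (Set.compl_subset_compl.2 hN))

/-- The fluctuation of the product state's energy is at most M N^{1/8} = O(N^{1/4}), whereas E_max
is at least √N. -/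
theorem eventually_mul_lt_Emax (hp : Even p) (hp0 : 0 < p) (e : Ensemble)
    (hn : (fun N => (n N : ℝ)) =O[atTop] fun N : ℕ => (N : ℝ) ^ (1 / (4 * p : ℝ)))
    (hkn : ∀ᶠ N in atTop, p / 2 ≤ n N)
    (hJ : Tendsto (fun N => J N - leadingJ e p (n N)) atTop (𝓝 0)) {c : ℝ} (hc : 0 < c) :
    ∀ᶠ N : ℕ in atTop, numEmbeddings (n N) (p / 2) *
        ((N : ℝ) ^ (p / 2) * (N : ℝ) ^ (1 / 8 : ℝ) / (N : ℝ) ^ (p / 2))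
      < c * Emax p N (n N) (J N) / 2 := by
  have hk : 0 < p / 2 := by
    obtain ⟨m, rfl⟩ := hp
    omega
  obtain ⟨D, -, hD⟩ := exists_le_rpow hp hp0 hn
  have hlog : Tendsto (fun N : ℕ => Real.log N) atTop atTop :=
    Real.tendsto_log_atTop.comp tendsto_natCast_atTop_atTop
  -- The exponent satisfies 3/8 + 1/8 = 1/2, so that M N^{1/8} is compared with √N.
  have s := (tendsto_div_rpow (a := 3 / 8) (fun N => numEmbeddings_nonneg (n N) (p / 2)) hD
    (by norm_num)).eventually (eventually_lt_nhds (show (0 : ℝ) < c / 2 by positivity))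
  filter_upwards [hkn, eventually_ge_atTop 1, s, hlog.eventually_ge_atTop 1,
    eventually_noiseScale_le_Emax hp hp0 e hn hkn hJ] with N hN hN1 hs hlogN hE
  have hN' : (0 : ℝ) < N := by exact_mod_cast hN1
  have h1 : Real.sqrt N ≤ Emax p N (n N) (J N) := by
    refine (sqrt_le_noiseScale hk hN hlogN).trans (le_trans ?_ hE)
    exact le_mul_of_one_le_left (Real.sqrt_nonneg _) (Real.one_le_sqrt.2 e.one_le_factor)
  rw [div_lt_iff₀ (by positivity)] at hs
  rw [mul_div_cancel_left₀ _ (by positivity)]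
  calc numEmbeddings (n N) (p / 2) * (N : ℝ) ^ (1 / 8 : ℝ)
      < c / 2 * (N : ℝ) ^ (3 / 8 : ℝ) * (N : ℝ) ^ (1 / 8 : ℝ) := by gcongr
    _ = c / 2 * Real.sqrt N := by
        rw [mul_assoc, ← Real.rpow_add hN', Real.sqrt_eq_rpow]
        norm_num
    _ ≤ c / 2 * Emax p N (n N) (J N) := by gcongr
    _ = _ := by ring

theorem achievesRecovery_algorithmOutputs (hp : Even p) (hp0 : 0 < p) (e : Ensemble)
    {prior : ∀ N : ℕ, Measure (EuclideanSpace ℝ (Fin N))} {lam : ℕ → ℝ}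
    (hn : (fun N => (n N : ℝ)) =O[atTop] fun N : ℕ => (N : ℝ) ^ (1 / (4 * p : ℝ)))
    (hkn : ∀ᶠ N in atTop, p / 2 ≤ n N)
    (hJ : Tendsto (fun N => J N - leadingJ e p (n N)) atTop (𝓝 0))
    (hprob : ∀ N : ℕ, IsProbabilityMeasure (prior N))
    (hv : ∀ N : ℕ, ∀ᵐ v ∂(prior N), ‖v‖ = Real.sqrt N) (hlam : ∀ᶠ N in atTop, 0 < lam N)
    {c : ℝ} (hc : 0 < c)
    (hE : ∀ᶠ N in atTop, (1 + c) * Emax p N (n N) (J N) ≤ E0 p N (n N) (lam N))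
    (V : ∀ N, Submodule ℂ (State N (n N)))
    (hV : ∀ N (T : Tensor p N), ∀ Φ ∈ V N, Matrix.toEuclideanLin (hamiltonian (n N) T) Φ ∈ V N)
    (hV' : ∀ N v, productState (n N) v ∈ V N) :
    AchievesRecovery p e prior lam (fun N T =>
      algorithmOutputs (V N) (Ecut p N (n N) (lam N) (J N)) T) := by
  refine ⟨1 / 2 * (c / (1 + c)), by positivity,
    (withHighProbability_goodEvent hp hp0 e hn hkn hJ hprob hv).mono ?_⟩
  filter_upwards [hkn, eventually_ge_atTop 1, hlam, hE, eventually_mul_lt_Emax hp hp0 e hn hkn hJ hc]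
    with N hN hN1 hlamN hEN hgap q hq
  exact algorithmOutputs_spec hp hp0 hN1 hN hlamN hq.1 hq.2.1 hc hEN hq.2.2 hgap (hV N _) (hV' N _)

end HighProbability

end SpikedTensor

end

theorem mainTheorem7 (p : ℕ) (hp : Even p) (hp0 : 0 < p) :
    ∃ θ : ℝ, 0 < θ ∧ ∀ θ' : ℝ, (p : ℝ) / 4 < θ' →
    ∀ (e : SpikedTensor.Ensemble) (n : ℕ → ℕ) (lam J : ℕ → ℝ)
      (prior : ∀ N : ℕ, Measure (EuclideanSpace ℝ (Fin N))),
    SpikedTensor.ScalingAssumption p θ θ' n lam →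
    (∀ᶠ N in atTop, p / 2 ≤ n N) →
    Tendsto (fun N => J N - SpikedTensor.leadingJ e p (n N)) atTop (𝓝 0) →
    (∀ N : ℕ, IsProbabilityMeasure (prior N)) →
    (∀ N : ℕ, ∀ᵐ v ∂(prior N), ‖v‖ = Real.sqrt N) →
    -- the general bound, for vectors and for mixed states
    (∃ ε : ℕ → ℝ, Tendsto ε atTop (𝓝 0) ∧
      SpikedTensor.WithHighProbability (SpikedTensor.jointLaw e p prior) fun N =>
        {ω | ∀ c' : ℝ, 0 < c' →
          (∀ Ψ : SpikedTensor.State N (n N), ‖Ψ‖ = 1 →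
            (1 + c') * SpikedTensor.Emax p N (n N) (J N) ≤
              SpikedTensor.energy
                (SpikedTensor.hamiltonian (n N) (SpikedTensor.spiked (lam N) ω.1 ω.2)) Ψ →
            (c' - ε N) *
                (SpikedTensor.Emax p N (n N) (J N) / SpikedTensor.E0 p N (n N) (lam N)) ≤
              SpikedTensor.overlap ω.1
                (SpikedTensor.singleParticle (SpikedTensor.pureState Ψ))) ∧
          (∀ σ : SpikedTensor.Operator N (n N), SpikedTensor.IsDensityMatrix σ →
            (1 + c') * SpikedTensor.Emax p N (n N) (J N) ≤
              SpikedTensor.mixedEnergy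
                (SpikedTensor.hamiltonian (n N) (SpikedTensor.spiked (lam N) ω.1 ω.2)) σ →
            (c' - ε N) *
                (SpikedTensor.Emax p N (n N) (J N) / SpikedTensor.E0 p N (n N) (lam N)) ≤
              SpikedTensor.overlap ω.1 (SpikedTensor.singleParticle σ))}) ∧
    -- above the recovery threshold
    (∀ c : ℝ, 0 < c →
      (∀ᶠ N in atTop, (1 + c) * SpikedTensor.Emax p N (n N) (J N) ≤
        SpikedTensor.E0 p N (n N) (lam N)) →
      (SpikedTensor.WithHighProbability (SpikedTensor.jointLaw e p prior) fun N =>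
        {ω | (∀ Ψ : SpikedTensor.State N (n N), ‖Ψ‖ = 1 →
            SpikedTensor.Ecut p N (n N) (lam N) (J N) ≤
              SpikedTensor.energy
                (SpikedTensor.hamiltonian (n N) (SpikedTensor.spiked (lam N) ω.1 ω.2)) Ψ →
            1 / 2 * (c / (1 + c)) ≤
              SpikedTensor.overlap ω.1
                (SpikedTensor.singleParticle (SpikedTensor.pureState Ψ))) ∧
          (∀ σ : SpikedTensor.Operator N (n N), SpikedTensor.IsDensityMatrix σ →
            SpikedTensor.Ecut p N (n N) (lam N) (J N) ≤
              SpikedTensor.mixedEnergy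
                (SpikedTensor.hamiltonian (n N) (SpikedTensor.spiked (lam N) ω.1 ω.2)) σ →
            1 / 2 * (c / (1 + c)) ≤
              SpikedTensor.overlap ω.1 (SpikedTensor.singleParticle σ))}) ∧
      -- the spectral algorithm achieves recovery, on the full Hilbert space and on the
      -- symmetric subspace
      SpikedTensor.AchievesRecovery p e prior lam (fun N T =>
        SpikedTensor.algorithmOutputs (n := n N) ⊤
          (SpikedTensor.Ecut p N (n N) (lam N) (J N)) T) ∧
      SpikedTensor.AchievesRecovery p e prior lam (fun N T =>
        SpikedTensor.algorithmOutputs (SpikedTensor.symmetricSubspace N (n N))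
          (SpikedTensor.Ecut p N (n N) (lam N) (J N)) T)) := by
  open SpikedTensor in
  refine ⟨1 / (4 * p), by positivity, ?_⟩
  intro θ' _ e n lam J prior hS hkn hJ hprob hv
  have hn := hS.n_upper
  have hlam : ∀ᶠ N in atTop, 0 < lam N := by
    obtain ⟨C, hC, h⟩ := hS.lam_lower
    filter_upwards [h, eventually_gt_atTop 0] with N hN hN0
    have : (0 : ℝ) < N := by exact_mod_cast hN0
    exact lt_of_lt_of_le (by positivity) hN
  have hgood := withHighProbability_goodEvent hp hp0 e hn hkn hJ hprob hv
  -- The error sequence can be taken to be zero: by the gain e^{-1/1000}, E_max itself bounds the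
  -- noise energy with high probability.
  refine ⟨⟨fun _ => 0, tendsto_const_nhds, hgood.mono ?_⟩, fun c hc hE => ⟨hgood.mono ?_, ?_, ?_⟩⟩
  · filter_upwards [hkn, eventually_ge_atTop 1, hlam] with N hN hN1 hlamN q hq c' _
    have key := fun (σ : Operator N (n N)) (hσ : IsDensityMatrix σ) =>
      le_overlap_of_le_mixedEnergy (c := c') hp hp0 hN1 hN hlamN hq.1 hq.2.1 hσ
    refine ⟨fun Ψ hΨ h => ?_, fun σ hσ h => ?_⟩
    · rw [energy_eq_mixedEnergy] at h
      simpa using key _ (isDensityMatrix_pureState hΨ) h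
    · simpa using key σ hσ h
  · filter_upwards [hkn, eventually_ge_atTop 1, hlam, hE] with N hN hN1 hlamN hEN q hq
    have key := fun (σ : Operator N (n N)) (hσ : IsDensityMatrix σ) =>
      le_overlap_of_mean_le_mixedEnergy hp hp0 hN1 hN hlamN hq.1 hq.2.1 hc hEN hσ
    refine ⟨fun Ψ hΨ h => ?_, fun σ hσ h => key σ hσ h⟩
    rw [energy_eq_mixedEnergy] at h
    exact key _ (isDensityMatrix_pureState hΨ) h
  · exact achievesRecovery_algorithmOutputs hp hp0 e hn hkn hJ hprob hv hlam hc hE (fun _ => ⊤)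
      (fun _ _ _ _ => Submodule.mem_top) fun _ _ => Submodule.mem_top
  · exact achievesRecovery_algorithmOutputs hp hp0 e hn hkn hJ hprob hv hlam hc hE
      (fun N => symmetricSubspace N (n N))
      (fun _ T => toEuclideanLin_hamiltonian_mem_symmetricSubspace T)
      fun _ v => productState_mem_symmetricSubspace v
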